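/- Let $n\ge 1$ and $0<p<\infty$. Let $\psi$ and $\varphi$ be non-negative measurable functions on $(0,\infty)$ such that $\varphi$ is non-increasing and $r\mapsto\varphi(r)r^{1/p}$ is non-decreasing on $(0,\infty)$. For a measurable $f:\mathbb{R}^n\to[-\infty,\infty]$ let $f^*(t)=\inf\{\lambda>0: |\{x:|f(x)|>\lambda\}|\le t\}$ be its decreasing rearrangement and $f^{**}(t)=\frac1t\int_0^t f^*(s)\,ds$. The generalized classical Lorentz space $G\Lambda_{p,\psi;\varphi}(\mathbb{R}^n)$ is given by $$\|f\|_{G\Lambda_{p,\psi;\varphi}}=\sup_{r>0}\varphi(r)\Big(\int_0^r(\psi(s)f^*(s))^p\,ds\Big)^{1/p},$$ and its associate norm is $\|f\|_{(G\Lambda_{p,\psi;\varphi})'}=\sup\big\{\int_{\mathbb{R}^n}|fg|\,dx : g \text{ measurable},\ \|g\|_{G\Lambda_{p,\psi;\varphi}}\le 1\big\}$. Put $\Psi_p(t)=\big(\int_0^t\psi(s)^p\,ds\big)^{1/p}$, and assume that $\Psi_p$ is admissible, that is, finite, continuous and strictly increasing on $[0,\infty)$ with $\Psi_p(0)=0$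 and $\Psi_p(t)\to\infty$ as $t\to\infty$. Let $\nu$ be a non-negative Borel measure on $[0,\infty)$ that is a representation measure of $1/\varphi$ with respect to $\Psi_p$, i.e. there is a constant $K\ge1$ such that, for all $t>0$, $$K^{-1}\,\frac1{\varphi(t)}\ \le\ \Psi_p(t)\int_{[0,\infty)}\frac{d\nu(s)}{\Psi_p(s)+\Psi_p(t)}\ \le\ K\,\frac1{\varphi(t)}.$$ Then, with equivalence constants that depend only on $p$ and $K$, the following holds for all measurable $f$ on $\mathbb{R}^n$. (i) If $0<p\le1$, then $$\|f\|_{(G\Lambda_{p,\psi;\varphi})'}\approx\int_{[0,\infty)}\ \sup_{s\in(t,\infty)}\frac{s f^{**}(s)}{\Psi_p(s)}\,d\nu(t).$$ (ii) If $1<p<\infty$ and $p'=p/(p-1)$, then $$\|f\|_{(G\Lambda_{p,\psi;\varphi})'}\approx\int_{[0,\infty)}\Big(\int_t^\infty\Big(\frac{s f^{**}(s)}{\Psi_p(s)^p}\Big)^{p'}\psi(s)^p\,ds\Big)^{1/p'}d\nu(t).$$ Here $A\approx B$ means $A\le CB$ and $B\le CA$ with a constant $C=C(p,K)<\infty$.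 -/

import Mathlib

open Set MeasureTheory Filter Topology
open scoped ENNReal NNReal

namespace Lorentz

/-- The distribution function `|{x : |f x| > l}|` of an extended real valued function on `ℝⁿ`. -/
noncomputable def distribution {n : ℕ} (f : EuclideanSpace ℝ (Fin n) → EReal) (l : ℝ≥0∞) : ℝ≥0∞ :=
  volume {x | l < (f x).abs}

/-- The decreasing rearrangement `f*` (used for `t > 0`). -/
noncomputable def rearrangement {n : ℕ} (f : EuclideanSpace ℝ (Fin n) → EReal) (t : ℝ) : ℝ≥0∞ :=
  sInf {l : ℝ≥0∞ | 0 < l ∧ distribution f l ≤ ENNReal.ofReal t}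

/-- The maximal function `f**(t) = (1/t) ∫₀ᵗ f*(s) ds` (used for `t > 0`). -/
noncomputable def maximalRearrangement {n : ℕ} (f : EuclideanSpace ℝ (Fin n) → EReal) (t : ℝ) :
    ℝ≥0∞ :=
  (∫⁻ s in Ioo 0 t, rearrangement f s) / ENNReal.ofReal t

/-- The `L^p` quasinorm of a non-negative function on the interval `(0, r)`, for `0 < p < ∞`. -/
noncomputable def lpNormOn (p : ℝ) (u : ℝ → ℝ≥0∞) (r : ℝ) : ℝ≥0∞ :=
  (∫⁻ s in Ioo 0 r, u s ^ p) ^ (1 / p)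

/-- The functional defining the generalized classical Lorentz space:
`sup_{r > 0} φ(r) ‖ψ f*‖_{p,(0,r)}`. Only the values of `ψ` and `φ` on `(0, ∞)` matter. -/
noncomputable def gLambdaNorm {n : ℕ} (p : ℝ) (ψ φ : ℝ → ℝ≥0∞)
    (f : EuclideanSpace ℝ (Fin n) → EReal) : ℝ≥0∞ :=
  ⨆ r ∈ Ioi (0 : ℝ), φ r * lpNormOn p (fun s => ψ s * rearrangement f s) r

/-- The associate norm of a functional `N` on measurable functions. For a functional which depends
only on `|g|`, the supremum of `∫ f g` over `N g ≤ 1` is the supremum of `∫ |f| |g|`. -/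
noncomputable def associateNorm {n : ℕ} (N : (EuclideanSpace ℝ (Fin n) → EReal) → ℝ≥0∞)
    (f : EuclideanSpace ℝ (Fin n) → EReal) : ℝ≥0∞ :=
  ⨆ (g : EuclideanSpace ℝ (Fin n) → EReal) (_ : AEMeasurable g volume) (_ : N g ≤ 1),
    ∫⁻ x, (f x).abs * (g x).abs

/-- Admissible functions: finite, continuous and strictly increasing on `[0, ∞)`, vanishing at `0`
and tending to infinity. -/
structure IsAdmissible (θ : ℝ → ℝ≥0∞) : Prop where
  finite : ∀ t ∈ Ici (0 : ℝ), θ t ≠ ∞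
  continuousOn : ContinuousOn θ (Ici 0)
  strictMonoOn : StrictMonoOn θ (Ici 0)
  zero : θ 0 = 0
  tendsto : Tendsto θ atTop (𝓝 ∞)

/-- The fundamental function `t ↦ σ(t) ∫_{[0,∞)} dν(s) / (σ(s) + σ(t))` of `ν` with respect to `σ`
(used for `t > 0`). A Borel measure on `[0, ∞)` is represented by a Borel measure on `ℝ`, of which
only the part on `[0, ∞)` is used. -/
noncomputable def fundamentalFunction (σ : ℝ → ℝ≥0∞) (ν : Measure ℝ) (t : ℝ) : ℝ≥0∞ :=
  σ t * ∫⁻ s in Ici (0 : ℝ), (σ s + σ t)⁻¹ ∂ν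

/-- `ν` is a representation measure of `h` with respect to the admissible function `σ`, with
equivalence constant `K`: on `(0, ∞)`, `h` is equivalent to the fundamental function of `ν`.
For `K = 1` the two functions are equal. -/
structure IsRepresentationMeasure (K : ℝ≥0) (ν : Measure ℝ) (h σ : ℝ → ℝ≥0∞) : Prop where
  admissible : IsAdmissible σ
  le_fundamental : ∀ t ∈ Ioi (0 : ℝ), h t ≤ K * fundamentalFunction σ ν t
  fundamental_le : ∀ t ∈ Ioi (0 : ℝ), fundamentalFunction σ ν t ≤ K * h t

/-- `∫_{[0,∞)} sup_{s > t} s f**(s) / Ψ_p(s) dν(t)`. -/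
noncomputable def supExpression {n : ℕ} (p : ℝ) (ψ : ℝ → ℝ≥0∞) (ν : Measure ℝ)
    (f : EuclideanSpace ℝ (Fin n) → EReal) : ℝ≥0∞ :=
  ∫⁻ t in Ici (0 : ℝ),
    ⨆ s ∈ Ioi t, ENNReal.ofReal s * maximalRearrangement f s / lpNormOn p ψ s ∂ν

/-- `∫_{[0,∞)} (∫_t^∞ (s f**(s) / Ψ_p(s)^p)^{q} ψ(s)^p ds)^{1/q} dν(t)`, where `q = p / (p - 1)`
is the conjugate exponent of `p`. -/
noncomputable def integralExpression {n : ℕ} (p : ℝ) (ψ : ℝ → ℝ≥0∞) (ν : Measure ℝ)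
    (f : EuclideanSpace ℝ (Fin n) → EReal) : ℝ≥0∞ :=
  ∫⁻ t in Ici (0 : ℝ),
    (∫⁻ s in Ioi t, (ENNReal.ofReal s * maximalRearrangement f s / lpNormOn p ψ s ^ p)
      ^ p.conjExponent * ψ s ^ p) ^ (1 / p.conjExponent) ∂ν

end Lorentz

/-!
The weight `ψ` is removed by the time change `x = ∫_0^t ψ ^ p` (`IsTimeChange`): it turns `Ψ_p(t)`
into `x ^ (1 / p)` (`powWeight`), `L^p` norms of `ψ f*` into plain `L^p` norms, and the two
right-hand sides into `∫ Γ Φ dν`, where `Φ(x) = ∫_0^t f*` in the new variable and `Γ Φ` is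
`sup_{x > z} Φ(x) / x ^ (1 / p)` for `p ≤ 1` (`supGauge`) or
`(∫_z^∞ (Φ(x) / x) ^ p' dx) ^ (1 / p')` for `p > 1` (`intGauge`). What matters about both gauges is
that `G = Γ Φ` is non-increasing while `z ^ (1 / p) * G z` is non-decreasing, by dilation invariance
(`IsGauge`). The fundamental function `h` of `ν` has the corresponding property: `h` is
non-decreasing and `h(z) / z ^ (1 / p)` is non-increasing.

Such a pair of functions has a greedy discretization (`exists_chain_constant`). From each point one
moves to the last point at which one of the two functions has still varied by a factor of at most
two; there both have varied by at least two. Hence sums over the chosen points are geometric, and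
on each interval between neighbours one of the functions is constant up to a factor of two.

*Upper bound* (`exists_lintegral_le_gauge`). By the Hardy–Littlewood inequality it suffices to
integrate `k = g*` against `κ = f* dt`, where the `L^p` norms of `k` over `(0, r)` are at most a
multiple of `h(r)`. The discretization is applied to `z ^ (1 / p) * G` and `G`. An interval from `c`
to `d` contributes at most a multiple of `G(c) h(c) + G(d) h(d)`: where `z ^ (1 / p) * G` is nearly
constant because `k(c) c ^ (1 / p)` is at most the norm of `k`, and where `G` is nearly constant by
Hölder's inequality (for `p ≤ 1`, by the embedding of the non-increasing functions of `L^p` into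
`L^{p,1}`). The sum of `G h` over the chosen points is at most a multiple of `∫ G dν`, since the
sequence is lacunary.

*Lower bound* (`exists_gauge_le_lintegral`). The discretization is applied to `h` and
`h / z ^ (1 / p)`, and bounds `∫ G dν` by the sum of `h(x) G(x)` over the chosen points. Each `G(x)`
is realised as `∫ Φ dμ` by a measure `μ` on `(x, ∞)` whose tail `s ↦ μ (s, ∞)` has bounded `L^p`
norm: a Dirac mass for `supGauge`, and for `intGauge` the equality case of Hölder's inequality
together with the dual Hardy inequality (`exists_dual_hardy`). The superposition of these measures
with weights `h(x)` has a tail whose `L^p` norms over `(0, r)` are at most a multiple of `h(r)`.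
Finally the tail is realised as the rearrangement of a function `g` on space which is large where
`f` is. To this end the points of space are ranked by the size of `f` (`exists_ranking`); this is
done for simple functions `w ≤ |f|` of bounded support, whose level sets are split by a radial
perturbation, and `f` is reached by monotone limits (`exists_ranked_exhaustion`).
-/

namespace Lorentz

/-! ### Greedy discretization of quasi-concave functions -/

/-- A pair `u`, `v` with `u` non-decreasing, `v` non-increasing and `u = θ v` on `(0, ∞)`, all
positive and finite: `u` is a quasi-concave function with respect to `θ`. -/
structure QuasiConcavePair (θ u v : ℝ → ℝ≥0∞) : Prop where
  monotoneOn : MonotoneOn u (Ioi 0)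
  antitoneOn : AntitoneOn v (Ioi 0)
  eq_mul : ∀ z, 0 < z → u z = θ z * v z
  ne_zero : ∀ z, 0 < z → u z ≠ 0
  ne_top : ∀ z, 0 < z → u z ≠ ∞
  continuousOn : ContinuousOn θ (Ioi 0)
  weight_ne_zero : ∀ z, 0 < z → θ z ≠ 0
  weight_ne_top : ∀ z, 0 < z → θ z ≠ ∞

/-- On the interval `[c, d]` at least one of `u` and `v` varies by a factor of at most two. -/
def SlowPair (u v : ℝ → ℝ≥0∞) (c d : ℝ) : Prop := u d ≤ 2 * u c ∨ v c ≤ 2 * v d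

namespace QuasiConcavePair

variable {θ u v : ℝ → ℝ≥0∞}

lemma eq_div (h : QuasiConcavePair θ u v) {z : ℝ} (hz : 0 < z) : v z = u z / θ z := by
  rw [h.eq_mul z hz, mul_comm, ENNReal.mul_div_cancel_right (h.weight_ne_zero z hz)
    (h.weight_ne_top z hz)]

lemma v_ne_top (h : QuasiConcavePair θ u v) {z : ℝ} (hz : 0 < z) : v z ≠ ∞ := by
  rw [h.eq_div hz]
  exact ENNReal.div_ne_top (h.ne_top z hz) (h.weight_ne_zero z hz)

/-- Monotonicity of `u` and `v` squeezes `u` between constants and multiples of `θ`, so `u`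
inherits the continuity of `θ`. -/
lemma continuousAt_u (h : QuasiConcavePair θ u v) {c : ℝ} (hc : 0 < c) : ContinuousAt u c := by
  have hθ : Tendsto (fun x => θ x * v c) (𝓝 c) (𝓝 (u c)) := by
    rw [h.eq_mul c hc]
    exact ENNReal.Tendsto.mul_const (h.continuousOn.continuousAt (Ioi_mem_nhds hc))
      (Or.inr (h.v_ne_top hc))
  have hlo : Tendsto (fun x => min (u c) (θ x * v c)) (𝓝 c) (𝓝 (u c)) := by
    simpa using (tendsto_const_nhds (x := u c)).min hθ
  have hhi : Tendsto (fun x => max (u c) (θ x * v c)) (𝓝 c) (𝓝 (u c)) := by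
    simpa using (tendsto_const_nhds (x := u c)).max hθ
  refine tendsto_of_tendsto_of_tendsto_of_le_of_le' hlo hhi ?_ ?_
  · filter_upwards [Ioi_mem_nhds hc] with x hx
    rcases le_total c x with hcx | hcx
    · exact (min_le_left _ _).trans (h.monotoneOn hc hx hcx)
    · refine (min_le_right _ _).trans ?_
      rw [h.eq_mul x hx]
      gcongr
      exact h.antitoneOn hx hc hcx
  · filter_upwards [Ioi_mem_nhds hc] with x hx
    rcases le_total c x with hcx | hcx
    · refine le_trans ?_ (le_max_right _ _)
      rw [h.eq_mul x hx]
      gcongr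
      exact h.antitoneOn hc hx hcx
    · exact (h.monotoneOn hx hc hcx).trans (le_max_left _ _)

lemma continuousAt_v (h : QuasiConcavePair θ u v) {c : ℝ} (hc : 0 < c) : ContinuousAt v c := by
  have h1 : Tendsto (fun x => u x / θ x) (𝓝 c) (𝓝 (u c / θ c)) :=
    ENNReal.Tendsto.div (h.continuousAt_u hc) (Or.inl (h.ne_zero c hc))
      (h.continuousOn.continuousAt (Ioi_mem_nhds hc)) (Or.inl (h.weight_ne_top c hc))
  unfold ContinuousAt
  rw [h.eq_div hc]
  refine h1.congr' ?_
  filter_upwards [Ioi_mem_nhds hc] with x hx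
  exact (h.eq_div hx).symm

/-- The greedy step: either `[a, b]` is slow, or there is a slow interval `[a, c]` at the end of
which `u` has doubled and `v` has halved. -/
lemma exists_next (h : QuasiConcavePair θ u v) {a b : ℝ} (ha : 0 < a) (hab : a ≤ b) :
    SlowPair u v a b ∨
      ∃ c, a ≤ c ∧ c ≤ b ∧ SlowPair u v a c ∧ 2 * u a ≤ u c ∧ 2 * v c ≤ v a := by
  have hpos : ∀ x ∈ Icc a b, 0 < x := fun x hx => ha.trans_le hx.1
  have hcu : ContinuousOn u (Icc a b) := fun x hx =>
    (h.continuousAt_u (hpos x hx)).continuousWithinAt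
  have hcv : ContinuousOn v (Icc a b) := fun x hx =>
    (h.continuousAt_v (hpos x hx)).continuousWithinAt
  have hcv2 : ContinuousOn (fun x => 2 * v x) (Icc a b) := fun x hx =>
    ENNReal.Tendsto.const_mul (hcv x hx) (Or.inr (by simp))
  set S : Set ℝ := {x ∈ Icc a b | SlowPair u v a x} with hS
  have hSeq : S =
      (Icc a b ∩ u ⁻¹' Iic (2 * u a)) ∪ (Icc a b ∩ (fun x => 2 * v x) ⁻¹' Ici (v a)) := by
    ext x; simp only [hS, SlowPair, mem_ofPred_eq, mem_union, mem_inter_iff, mem_preimage, mem_Iic,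
      mem_Ici]; tauto
  have hclosed : IsClosed S := by
    rw [hSeq]
    exact (hcu.preimage_isClosed_of_isClosed isClosed_Icc isClosed_Iic).union
      (hcv2.preimage_isClosed_of_isClosed isClosed_Icc isClosed_Ici)
  have hcompact : IsCompact S := isCompact_Icc.of_isClosed_subset hclosed (fun x hx => hx.1)
  have haS : a ∈ S := ⟨⟨le_rfl, hab⟩, Or.inl (by rw [two_mul]; exact le_self_add)⟩
  have hmem := hcompact.sSup_mem ⟨a, haS⟩
  -- the greedy choice: the last point up to which the interval is slow
  set c := sSup S with hc
  rcases hmem.1.2.eq_or_lt with hcb | hcb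
  · left; rw [← hcb]; exact hmem.2
  right
  refine ⟨c, hmem.1.1, hmem.1.2, hmem.2, ?_, ?_⟩
  all_goals
    have hc0 := hpos c hmem.1
    have hnot : ∀ x ∈ Ioc c b, ¬ SlowPair u v a x := fun x hx hx' =>
      absurd (le_csSup hcompact.bddAbove (show x ∈ S from ⟨⟨hmem.1.1.trans hx.1.le, hx.2⟩, hx'⟩))
        (not_le.2 hx.1)
    have hev : ∀ᶠ x in 𝓝[>] c, ¬ SlowPair u v a x := by
      filter_upwards [Ioc_mem_nhdsGT hcb] with x hx using hnot x hx
  · refine ge_of_tendsto ((h.continuousAt_u hc0).mono_left (nhdsWithin_le_nhds (s := Ioi c))) ?_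
    filter_upwards [hev] with x hx
    simp only [SlowPair, not_or, not_le] at hx
    exact hx.1.le
  · refine le_of_tendsto (ENNReal.Tendsto.const_mul
      ((h.continuousAt_v hc0).mono_left (nhdsWithin_le_nhds (s := Ioi c))) (Or.inr (by simp))) ?_
    filter_upwards [hev] with x hx
    simp only [SlowPair, not_or, not_le] at hx
    exact hx.2.le

end QuasiConcavePair

/-- Numerical constants closing the induction over greedy steps: `A` and `c` absorb one more term
of a geometric series of ratio `2 ^ (-q)`. -/
lemma exists_geometric_constants (q : ℝ) (hq : 0 < q) :
    ∃ A c B : ℝ≥0, 1 + (A : ℝ≥0∞) * 2⁻¹ ^ q ≤ A ∧ (2 : ℝ≥0∞) ≤ A ∧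
      (1 + (c : ℝ≥0∞)) * 2⁻¹ ^ q ≤ c ∧ (A : ℝ≥0∞) + 2 + c ≤ B := by
  set ρ : ℝ≥0 := 2⁻¹ ^ q with hρ
  have hρ1 : ρ < 1 := NNReal.rpow_lt_one (by rw [← NNReal.coe_lt_coe]; norm_num) hq
  have hcoe : (2⁻¹ : ℝ≥0∞) ^ q = (ρ : ℝ≥0∞) := by
    rw [hρ, ENNReal.coe_rpow_of_nonneg _ hq.le, ENNReal.coe_inv (by norm_num)]; norm_num
  rw [hcoe]
  have hd : (0 : ℝ) < 1 - ρ := sub_pos.2 (by exact_mod_cast hρ1)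
  have hρ0 : (0 : ℝ) ≤ ρ := ρ.2
  obtain ⟨A, hA⟩ : ∃ A : ℝ≥0, (A : ℝ) = 2 / (1 - ρ) := ⟨⟨2 / (1 - ρ), by positivity⟩, rfl⟩
  obtain ⟨c, hc⟩ : ∃ c : ℝ≥0, (c : ℝ) = ρ / (1 - ρ) := ⟨⟨ρ / (1 - ρ), by positivity⟩, rfl⟩
  refine ⟨A, c, A + 2 + c, ?_, ?_, ?_, by push_cast; exact le_rfl⟩
  · norm_cast
    rw [← NNReal.coe_le_coe]
    push_cast
    rw [hA, ← sub_nonneg]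
    have : 2 / (1 - (ρ : ℝ)) - (1 + 2 / (1 - ρ) * ρ) = 1 := by field_simp; ring
    rw [this]; norm_num
  · norm_cast
    rw [← NNReal.coe_le_coe]
    push_cast
    rw [hA, le_div_iff₀ hd]; linarith
  · norm_cast
    rw [← NNReal.coe_le_coe]
    push_cast
    rw [hc]
    apply le_of_eq; field_simp; ring

namespace QuasiConcavePair

variable {θ u v : ℝ → ℝ≥0∞}

lemma rpow_le_of_two_mul_le {x y : ℝ≥0∞} {q : ℝ} (hq : 0 < q) (hxy : 2 * x ≤ y) :
    x ^ q ≤ 2⁻¹ ^ q * y ^ q := by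
  rw [← ENNReal.mul_rpow_of_nonneg _ _ hq.le]
  refine ENNReal.rpow_le_rpow ?_ hq.le
  calc x = 2⁻¹ * (2 * x) := by
        rw [← mul_assoc, ENNReal.inv_mul_cancel (by simp) (by simp), one_mul]
    _ ≤ _ := by gcongr

lemma min_le_u (h : QuasiConcavePair θ u v) {x r : ℝ} (hx : 0 < x) (hr : 0 < r) :
    min (u x) (θ r * v x) ≤ u r := by
  rcases le_total x r with hxr | hxr
  · exact (min_le_left _ _).trans (h.monotoneOn hx hr hxr)
  · refine (min_le_right _ _).trans ?_
    rw [h.eq_mul r hr]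
    gcongr
    exact h.antitoneOn hr hx hxr

lemma sum_min_le (h : QuasiConcavePair θ u v) {q : ℝ} (hq : 0 < q) {a : ℝ} (ha : 0 < a)
    {l : List ℝ} {A : ℝ≥0∞} (hA : (l.map fun x => v x ^ q).sum ≤ A * v a ^ q) {r : ℝ}
    (hr : 0 < r) (hra : r ≤ a) :
    (l.map fun x => min (u x) (θ r * v x) ^ q).sum ≤ A * u r ^ q := by
  calc (l.map fun x => min (u x) (θ r * v x) ^ q).sum
      ≤ (l.map fun x => θ r ^ q * v x ^ q).sum := by
        refine List.sum_le_sum fun x _ => ?_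
        rw [← ENNReal.mul_rpow_of_nonneg _ _ hq.le]
        exact ENNReal.rpow_le_rpow (min_le_right _ _) hq.le
    _ = θ r ^ q * (l.map fun x => v x ^ q).sum := by rw [List.sum_map_mul_left]
    _ ≤ θ r ^ q * (A * v r ^ q) := by
        gcongr
        refine hA.trans ?_
        gcongr
        exact h.antitoneOn hr ha hra
    _ = A * u r ^ q := by
        rw [h.eq_mul r hr, ENNReal.mul_rpow_of_nonneg _ _ hq.le]; ring

/-- The induction behind `exists_chain_constant`, on the number of doublings of `u` between `a`
and `b`. The summands `w a` and `c * u a ^ q` on the left are the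
room needed to prepend one more point. -/
lemma exists_chain_aux (h : QuasiConcavePair θ u v) {q : ℝ} (hq : 0 < q) {A c B : ℝ≥0}
    (h1 : 1 + (A : ℝ≥0∞) * 2⁻¹ ^ q ≤ A) (h2 : (2 : ℝ≥0∞) ≤ A)
    (h3 : (1 + (c : ℝ≥0∞)) * 2⁻¹ ^ q ≤ c) (h4 : (A : ℝ≥0∞) + 2 + c ≤ B) {b : ℝ} (N : ℕ) :
    ∀ a, 0 < a → a ≤ b → u b ≤ 2 ^ N * u a → ∃ l : List ℝ, (∀ x ∈ l, a ≤ x) ∧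
      (∀ (m : Measure ℝ) (w : ℝ → ℝ≥0∞), (∀ c d, 0 < c → c ≤ d → SlowPair u v c d →
        m (Ioc c d) ≤ w c + w d) → m (Ioc a b) + w a ≤ 2 * (l.map w).sum) ∧
      (l.map fun x => v x ^ q).sum ≤ A * v a ^ q ∧
      ∀ r, a ≤ r → (l.map fun x => min (u x) (θ r * v x) ^ q).sum + c * u a ^ q ≤ B * u r ^ q := by
  have base : ∀ a, 0 < a → a ≤ b → SlowPair u v a b → ∃ l : List ℝ, (∀ x ∈ l, a ≤ x) ∧
      (∀ (m : Measure ℝ) (w : ℝ → ℝ≥0∞), (∀ c d, 0 < c → c ≤ d → SlowPair u v c d →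
        m (Ioc c d) ≤ w c + w d) → m (Ioc a b) + w a ≤ 2 * (l.map w).sum) ∧
      (l.map fun x => v x ^ q).sum ≤ A * v a ^ q ∧
      ∀ r, a ≤ r → (l.map fun x => min (u x) (θ r * v x) ^ q).sum + c * u a ^ q ≤ B * u r ^ q := by
    intro a ha hab hs
    have hb := ha.trans_le hab
    refine ⟨[a, b], by simp [hab], fun m w hm => ?_, ?_, fun r har => ?_⟩
    · simp only [List.map_cons, List.map_nil, List.sum_cons, List.sum_nil, add_zero]
      calc m (Ioc a b) + w a ≤ (w a + w b) + (w a + w b) := by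
            gcongr
            · exact hm a b ha hab hs
            · exact le_self_add
        _ = 2 * (w a + w b) := by ring
    · simp only [List.map_cons, List.map_nil, List.sum_cons, List.sum_nil, add_zero]
      calc v a ^ q + v b ^ q ≤ v a ^ q + v a ^ q := by
            gcongr
            exact h.antitoneOn ha hb hab
        _ = 2 * v a ^ q := by ring
        _ ≤ _ := by gcongr
    · have hr := ha.trans_le har
      simp only [List.map_cons, List.map_nil, List.sum_cons, List.sum_nil, add_zero]
      calc min (u a) (θ r * v a) ^ q + min (u b) (θ r * v b) ^ q + c * u a ^ q
          ≤ u r ^ q + u r ^ q + c * u r ^ q := by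
            gcongr
            · exact h.min_le_u ha hr
            · exact h.min_le_u hb hr
            · exact h.monotoneOn ha hr har
        _ = (2 + c) * u r ^ q := by ring
        _ ≤ (A + 2 + c) * u r ^ q := by
            gcongr
            exact le_add_self
        _ ≤ _ := by gcongr
  induction N with
  | zero =>
    intro a ha hab hN
    refine base a ha hab (Or.inl (hN.trans ?_))
    rw [pow_zero, one_mul, two_mul]; exact le_self_add
  | succ N ih =>
    intro a ha hab hN
    rcases h.exists_next ha hab with hs | ⟨d, had, hdb, hs, hu, hv⟩
    · exact base a ha hab hs
    have hd := ha.trans_le had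
    obtain ⟨l, hl, hm, hA, hB⟩ := ih d hd hdb (by
      refine hN.trans ?_
      rw [pow_succ, mul_assoc]
      gcongr)
    have hv' : (A : ℝ≥0∞) * v d ^ q ≤ A * (2⁻¹ ^ q * v a ^ q) := by
      gcongr; exact rpow_le_of_two_mul_le hq hv
    refine ⟨a :: l, by simpa using fun x hx => had.trans (hl x hx),
      fun m w hmw => ?_, ?_, fun r har => ?_⟩
    · rw [List.map_cons, List.sum_cons]
      calc m (Ioc a b) + w a ≤ m (Ioc a d) + m (Ioc d b) + w a := by
            gcongr
            rw [← Ioc_union_Ioc_eq_Ioc had hdb]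
            exact measure_union_le _ _
        _ ≤ (w a + w d) + m (Ioc d b) + w a := by
            gcongr
            exact hmw a d ha had hs
        _ = 2 * w a + (m (Ioc d b) + w d) := by ring
        _ ≤ 2 * w a + 2 * (l.map w).sum := by gcongr; exact hm m w hmw
        _ = _ := by ring
    · rw [List.map_cons, List.sum_cons]
      calc v a ^ q + (l.map fun x => v x ^ q).sum ≤ v a ^ q + A * (2⁻¹ ^ q * v a ^ q) := by
            gcongr; exact hA.trans hv'
        _ = (1 + A * 2⁻¹ ^ q) * v a ^ q := by ring
        _ ≤ _ := by gcongr
    · have hr := ha.trans_le har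
      rw [List.map_cons, List.sum_cons]
      rcases le_total d r with hdr | hrd
      · calc min (u a) (θ r * v a) ^ q + (l.map fun x => min (u x) (θ r * v x) ^ q).sum
              + c * u a ^ q
            ≤ u a ^ q + (l.map fun x => min (u x) (θ r * v x) ^ q).sum + c * u a ^ q := by
              gcongr; exact min_le_left _ _
          _ = (l.map fun x => min (u x) (θ r * v x) ^ q).sum + (1 + c) * u a ^ q := by ring
          _ ≤ (l.map fun x => min (u x) (θ r * v x) ^ q).sum + (1 + c) * (2⁻¹ ^ q * u d ^ q) := by
              gcongr; exact rpow_le_of_two_mul_le hq hu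
          _ = (l.map fun x => min (u x) (θ r * v x) ^ q).sum + ((1 + c) * 2⁻¹ ^ q) * u d ^ q := by
              ring
          _ ≤ (l.map fun x => min (u x) (θ r * v x) ^ q).sum + c * u d ^ q := by gcongr
          _ ≤ _ := hB r hdr
      · calc min (u a) (θ r * v a) ^ q + (l.map fun x => min (u x) (θ r * v x) ^ q).sum
              + c * u a ^ q
            ≤ u r ^ q + A * u r ^ q + c * u r ^ q := by
              gcongr
              · exact h.min_le_u ha hr
              · exact h.sum_min_le hq hd hA hr hrd
              · exact h.monotoneOn ha hr har
          _ = (A + 1 + c) * u r ^ q := by ring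
          _ ≤ (A + 2 + c) * u r ^ q := by gcongr; norm_num
          _ ≤ _ := by gcongr

end QuasiConcavePair

/-- Greedy discretization. Between `a` and `b` there are finitely many points which carry every
measure that is controlled on slow intervals by a function `w` of their endpoints, while the
`q`-sums of the functions `r ↦ min (u x) (θ r * v x)` over these points are comparable to
`u ^ q`. -/
lemma exists_chain_constant {q : ℝ} (hq : 0 < q) : ∃ B : ℝ≥0, ∀ {θ u v : ℝ → ℝ≥0∞},
    QuasiConcavePair θ u v → ∀ a b : ℝ, 0 < a → a ≤ b → ∃ l : List ℝ, (∀ x ∈ l, a ≤ x) ∧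
      (∀ (m : Measure ℝ) (w : ℝ → ℝ≥0∞), (∀ c d, 0 < c → c ≤ d → SlowPair u v c d →
        m (Ioc c d) ≤ w c + w d) → m (Ioc a b) ≤ 2 * (l.map w).sum) ∧
      ∀ r, 0 < r → (l.map fun x => min (u x) (θ r * v x) ^ q).sum ≤ B * u r ^ q := by
  obtain ⟨A, c, B, h1, h2, h3, h4⟩ := exists_geometric_constants q hq
  refine ⟨B, fun {θ u v} h a b ha hab => ?_⟩
  have hua := h.ne_zero a ha
  obtain ⟨N, hN⟩ := ENNReal.exists_nat_gt
    (ENNReal.div_ne_top (h.ne_top b (ha.trans_le hab)) hua)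
  have hN' : u b ≤ 2 ^ N * u a := by
    rw [← ENNReal.div_le_iff hua (h.ne_top a ha)]
    refine hN.le.trans ?_
    exact_mod_cast Nat.lt_two_pow_self.le
  obtain ⟨l, hl, hm, hA, hB⟩ := h.exists_chain_aux hq h1 h2 h3 h4 N a ha hab hN'
  refine ⟨l, hl, fun m w hmw => le_self_add.trans (hm m w hmw), fun r hr => ?_⟩
  rcases le_total a r with har | hra
  · exact le_self_add.trans (hB r har)
  · refine (h.sum_min_le hq ha hA hr hra).trans ?_
    gcongr
    have h5 : (A : ℝ≥0∞) ≤ B := by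
      refine le_trans ?_ h4
      rw [add_assoc]; exact le_self_add
    exact_mod_cast h5

/-! ### Gauges -/

/-- The weight `z ^ (1 / p)`, which is the fundamental function of `L^p(0, ∞)`. -/
noncomputable def powWeight (p z : ℝ) : ℝ≥0∞ := ENNReal.ofReal z ^ (1 / p)

section powWeight
variable {p : ℝ}

lemma powWeight_mono (hp : 0 < p) : Monotone (powWeight p) := fun _ _ h =>
  ENNReal.rpow_le_rpow (ENNReal.ofReal_le_ofReal h) (by positivity)

lemma powWeight_ne_zero {z : ℝ} (hz : 0 < z) : powWeight p z ≠ 0 := by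
  have := ENNReal.rpow_pos (p := 1 / p) (ENNReal.ofReal_pos.2 hz) ENNReal.ofReal_ne_top
  exact this.ne'

lemma powWeight_ne_top (hp : 0 < p) (z : ℝ) : powWeight p z ≠ ∞ :=
  ENNReal.rpow_ne_top_of_nonneg (by positivity) ENNReal.ofReal_ne_top

lemma powWeight_zero (hp : 0 < p) : powWeight p 0 = 0 := by
  rw [powWeight, ENNReal.ofReal_zero, ENNReal.zero_rpow_of_pos (by positivity)]

lemma powWeight_rpow (hp : 0 < p) (z : ℝ) : powWeight p z ^ p = ENNReal.ofReal z := by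
  rw [powWeight, ← ENNReal.rpow_mul, one_div_mul_cancel hp.ne', ENNReal.rpow_one]

lemma continuous_powWeight : Continuous (powWeight p) :=
  ENNReal.continuous_rpow_const.comp ENNReal.continuous_ofReal

end powWeight

/-- A function `G` such that `G` is non-increasing and `z ^ (1 / p) * G z` is
non-decreasing. -/
structure IsGauge (p : ℝ) (G : ℝ → ℝ≥0∞) : Prop where
  antitoneOn : AntitoneOn G (Ici 0)
  monotoneOn : MonotoneOn (fun z => powWeight p z * G z) (Ioi 0)

namespace IsGauge
variable {p : ℝ} {G : ℝ → ℝ≥0∞}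

lemma eq_zero (hG : IsGauge p G) {a z : ℝ} (ha : 0 < a) (hGa : G a = 0)
    (hz : 0 < z) : G z = 0 := by
  rcases le_total a z with h | h
  · exact le_antisymm ((hG.antitoneOn ha.le hz.le h).trans hGa.le) bot_le
  · have := hG.monotoneOn hz ha h
    simp only [hGa, mul_zero, nonpos_iff_eq_zero, mul_eq_zero] at this
    exact this.resolve_left (powWeight_ne_zero hz)

lemma eq_top (hp : 0 < p) (hG : IsGauge p G) {a z : ℝ} (ha : 0 < a) (hGa : G a = ∞)
    (hz : 0 ≤ z) : G z = ∞ := by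
  rcases le_total z a with h | h
  · exact top_le_iff.1 (hGa.symm.le.trans (hG.antitoneOn hz ha.le h))
  · have hz' := ha.trans_le h
    have := hG.monotoneOn ha hz' h
    simp only [hGa, ENNReal.mul_top (powWeight_ne_zero ha), top_le_iff] at this
    by_contra hne
    exact ENNReal.mul_ne_top (powWeight_ne_top hp z) hne this

lemma quasiConcavePair (hp : 0 < p) (hG : IsGauge p G) (h0 : ∀ z, 0 < z → G z ≠ 0)
    (ht : ∀ z, 0 < z → G z ≠ ∞) :
    QuasiConcavePair (powWeight p) (fun z => powWeight p z * G z) G where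
  monotoneOn := hG.monotoneOn
  antitoneOn := hG.antitoneOn.mono Ioi_subset_Ici_self
  eq_mul _ _ := rfl
  ne_zero z hz := mul_ne_zero (powWeight_ne_zero hz) (h0 z hz)
  ne_top z hz := ENNReal.mul_ne_top (powWeight_ne_top hp z) (ht z hz)
  continuousOn := continuous_powWeight.continuousOn
  weight_ne_zero _ hz := powWeight_ne_zero hz
  weight_ne_top z _ := powWeight_ne_top hp z

end IsGauge

lemma measure_Ioi_zero_le {m : Measure ℝ} {X : ℝ≥0∞}
    (h : ∀ a b : ℝ, 0 < a → a ≤ b → m (Ioc a b) ≤ X) : m (Ioi 0) ≤ X := by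
  have hU : Ioi (0 : ℝ) = ⋃ n : ℕ, Ioc (1 / ((n : ℝ) + 1)) (n + 1) := by
    ext x
    simp only [mem_Ioi, mem_iUnion, mem_Ioc]
    constructor
    · intro hx
      obtain ⟨n, hn⟩ := exists_nat_one_div_lt hx
      obtain ⟨k, hk⟩ := exists_nat_ge x
      refine ⟨max n k, ?_, ?_⟩
      · refine lt_of_le_of_lt ?_ hn
        apply one_div_le_one_div_of_le (by positivity)
        push_cast
        gcongr
        exact le_max_left _ _
      · push_cast
        have : (k : ℝ) ≤ max (n : ℝ) k := le_max_right _ _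
        linarith
    · rintro ⟨n, hn, -⟩
      exact lt_trans (by positivity) hn
  have hmono : Monotone fun n : ℕ => Ioc (1 / ((n : ℝ) + 1)) ((n : ℝ) + 1) := by
    intro i j hij
    have : (i : ℝ) ≤ j := by exact_mod_cast hij
    apply Ioc_subset_Ioc
    · apply one_div_le_one_div_of_le (by positivity); linarith
    · linarith
  rw [hU, hmono.measure_iUnion]
  refine iSup_le fun n => h _ _ (by positivity) ?_
  rw [div_le_iff₀ (by positivity)]
  nlinarith [(Nat.cast_nonneg n : (0 : ℝ) ≤ n)]

lemma list_sum_lintegral_le {α : Type*} [MeasurableSpace α] (μ : Measure α) (l : List ℝ)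
    (F : ℝ → α → ℝ≥0∞) :
    (l.map fun x => ∫⁻ s, F x s ∂μ).sum ≤ ∫⁻ s, (l.map fun x => F x s).sum ∂μ := by
  induction l with
  | nil => simp
  | cons a l ih =>
    simp only [List.map_cons, List.sum_cons]
    exact (add_le_add le_rfl ih).trans (le_lintegral_add _ _)

/-- A discretization of a gauge `G` which is lacunary for both `G` and `z ^ (1 / p) * G z` is
dominated by the integral of `G` against the representing measure. -/
lemma sum_gauge_mul_fundamental_le {p : ℝ} (hp : 0 < p) {G : ℝ → ℝ≥0∞} (hG : IsGauge p G)
    (ν : Measure ℝ) {l : List ℝ} {a : ℝ} (ha : 0 < a) (hl : ∀ x ∈ l, a ≤ x) {B : ℝ≥0}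
    (hB : ∀ r, 0 < r → (l.map fun x => min (powWeight p x * G x) (powWeight p r * G x)).sum
      ≤ B * (powWeight p r * G r)) :
    (l.map fun x => G x * fundamentalFunction (powWeight p) ν x).sum
      ≤ B * ∫⁻ s in Ici 0, G s ∂ν := by
  have cancel : ∀ r, 0 < r → ∀ y : ℝ≥0∞, (powWeight p r)⁻¹ * (powWeight p r * y) = y := by
    intro r hr y
    rw [← mul_assoc, ENNReal.inv_mul_cancel (powWeight_ne_zero hr) (powWeight_ne_top hp r), one_mul]
  calc (l.map fun x => G x * fundamentalFunction (powWeight p) ν x).sum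
      ≤ (l.map fun x => ∫⁻ s in Ici 0,
          powWeight p x * G x * (powWeight p s + powWeight p x)⁻¹ ∂ν).sum := by
        refine List.sum_le_sum fun x _ => ?_
        rw [fundamentalFunction, ← mul_assoc, mul_comm (G x)]
        exact lintegral_const_mul_le _ _
    _ ≤ ∫⁻ s in Ici 0, (l.map fun x =>
          powWeight p x * G x * (powWeight p s + powWeight p x)⁻¹).sum ∂ν :=
        list_sum_lintegral_le _ _ _
    _ ≤ ∫⁻ s in Ici 0, B * G s ∂ν := by
        refine setLIntegral_mono' measurableSet_Ici fun s hs => ?_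
        have hx1 : ∀ x ∈ l, powWeight p x * G x * (powWeight p s + powWeight p x)⁻¹ ≤ G x := by
          intro x hx
          have hx0 := ha.trans_le (hl x hx)
          calc _ ≤ powWeight p x * G x * (powWeight p x)⁻¹ := by
                gcongr; exact le_add_self
            _ = (powWeight p x)⁻¹ * (powWeight p x * G x) := by ring
            _ = G x := cancel x hx0 _
        rcases (mem_Ici.1 hs).eq_or_lt with rfl | hs0
        · calc _ ≤ (l.map fun x => G x).sum := List.sum_le_sum hx1
            _ = (l.map fun x => (powWeight p a)⁻¹ * (powWeight p a * G x)).sum := by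
                simp only [cancel a ha]
            _ = (powWeight p a)⁻¹ * (l.map fun x => powWeight p a * G x).sum := by
                rw [List.sum_map_mul_left]
            _ ≤ (powWeight p a)⁻¹ * (l.map fun x =>
                  min (powWeight p x * G x) (powWeight p a * G x)).sum := by
                gcongr
                refine List.sum_le_sum fun x hx => le_min ?_ le_rfl
                gcongr
                exact powWeight_mono hp (hl x hx)
            _ ≤ (powWeight p a)⁻¹ * (powWeight p a * (B * G a)) := by
                gcongr; refine (hB a ha).trans_eq ?_; ring
            _ = B * G a := cancel a ha _
            _ ≤ B * G 0 := by
                gcongr; exact hG.antitoneOn (mem_Ici.2 le_rfl) ha.le ha.le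
        · calc _ ≤ (l.map fun x => (powWeight p s)⁻¹ *
                  min (powWeight p x * G x) (powWeight p s * G x)).sum := by
                refine List.sum_le_sum fun x hx => ?_
                rcases min_choice (powWeight p x * G x) (powWeight p s * G x) with h | h
                · rw [h, mul_comm]
                  gcongr
                  exact le_self_add
                · rw [h, cancel s hs0]
                  exact hx1 x hx
            _ = (powWeight p s)⁻¹ * (l.map fun x =>
                  min (powWeight p x * G x) (powWeight p s * G x)).sum := by
                rw [List.sum_map_mul_left]
            _ ≤ (powWeight p s)⁻¹ * (powWeight p s * (B * G s)) := by
                gcongr; refine (hB s hs0).trans_eq ?_; ring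
            _ = B * G s := cancel s hs0 _
    _ = _ := by rw [lintegral_const_mul' _ _ ENNReal.coe_ne_top]

/-- The value of a non-increasing function times the weight is at most its `L^p` norm. -/
lemma mul_powWeight_le_lpNormOn {p : ℝ} (hp : 0 < p) {k : ℝ → ℝ≥0∞} (hk : Antitone k) {c : ℝ} :
    k c * powWeight p c ≤ lpNormOn p k c := by
  have h1 : k c ^ p * ENNReal.ofReal c ≤ ∫⁻ s in Ioo 0 c, k s ^ p := by
    calc k c ^ p * ENNReal.ofReal c = ∫⁻ _ in Ioo 0 c, k c ^ p := by simp
      _ ≤ _ := setLIntegral_mono' measurableSet_Ioo fun s hs => by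
          gcongr; exact hk hs.2.le
  calc k c * powWeight p c = (k c ^ p * ENNReal.ofReal c) ^ (1 / p) := by
        rw [ENNReal.mul_rpow_of_nonneg _ _ (by positivity), ← ENNReal.rpow_mul,
          mul_one_div_cancel hp.ne', ENNReal.rpow_one, powWeight]
    _ ≤ _ := by
        rw [lpNormOn]; gcongr

/-- The upper half of the duality for an abstract gauge: a non-increasing function `k` whose `L^p`
norms over `(0, r)` are dominated by the fundamental function of `ν` is integrated against `κ` by
at most the `ν`-integral of the gauge. -/
theorem exists_lintegral_le_gauge {p : ℝ} (hp : 0 < p) (K C₁ C₂ : ℝ≥0) : ∃ C : ℝ≥0,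
    ∀ (κ : Measure ℝ) (G : ℝ → ℝ≥0∞) (ν : Measure ℝ) (k : ℝ → ℝ≥0∞), IsGauge p G →
      (∀ z, 0 < z → κ (Ioc 0 z) ≤ C₁ * (powWeight p z * G z)) →
      (∀ c d, 0 < c → c ≤ d → ∫⁻ s in Ioc c d, k s ∂κ ≤ C₂ * (G c * lpNormOn p k d)) →
      Antitone k →
      (∀ r, 0 < r → lpNormOn p k r ≤ K * fundamentalFunction (powWeight p) ν r) →
      ∫⁻ s in Ioi 0, k s ∂κ ≤ C * ∫⁻ s in Ici 0, G s ∂ν := by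
  obtain ⟨B, hB⟩ := exists_chain_constant one_pos
  -- the summand one keeps the constant positive where the right-hand side is infinite
  refine ⟨2 * (((2 * C₁ + 2 * C₂) * K) * B) + 1, fun κ G ν k hG hκ hkκ hk hkK => ?_⟩
  set h := fundamentalFunction (powWeight p) ν with hh
  by_cases h0 : ∃ z, 0 < z ∧ G z = 0
  · -- `G` vanishes on `(0, ∞)`, so `κ` does
    obtain ⟨a, ha, hGa⟩ := h0
    have : κ (Ioi 0) = 0 := by
      refine le_antisymm (measure_Ioi_zero_le fun a b ha' hab => ?_) bot_le
      have hb := ha'.trans_le hab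
      refine (measure_mono (Ioc_subset_Ioc_left ha'.le)).trans ((hκ b hb).trans ?_)
      rw [hG.eq_zero ha hGa hb, mul_zero, mul_zero]
    rw [setLIntegral_measure_zero _ _ this]
    exact bot_le
  push Not at h0
  by_cases ht : ∃ z, 0 < z ∧ G z = ∞
  · -- `G` is identically infinite, so the claim is trivial unless `ν` is null on `[0, ∞)`
    obtain ⟨a, ha, hGa⟩ := ht
    have hGt : ∫⁻ s in Ici 0, G s ∂ν = ∞ * ν (Ici 0) := by
      rw [← setLIntegral_const]
      exact setLIntegral_congr_fun measurableSet_Ici fun s hs => hG.eq_top hp ha hGa hs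
    by_cases hν : ν (Ici 0) = 0
    · have hk0 : ∀ s ∈ Ioi (0 : ℝ), k s = 0 := by
        intro s hs
        have h1 := (mul_powWeight_le_lpNormOn hp hk).trans (hkK s hs)
        rw [hh, fundamentalFunction, setLIntegral_measure_zero _ _ hν, mul_zero, mul_zero,
          nonpos_iff_eq_zero, mul_eq_zero] at h1
        exact h1.resolve_right (powWeight_ne_zero hs)
      rw [setLIntegral_congr_fun measurableSet_Ioi hk0]
      simp
    · rw [hGt, ENNReal.top_mul hν, ENNReal.mul_top]
      · exact le_top
      · push_cast; positivity
  push Not at ht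
  refine (?_ : (_ : ℝ≥0∞) ≤ (2 * (((2 * C₁ + 2 * C₂) * K) * B) : ℝ≥0) * _).trans
    (by gcongr; simp)
  rw [← withDensity_apply _ measurableSet_Ioi]
  refine measure_Ioi_zero_le fun a b ha hab => ?_
  obtain ⟨l, hl, hm, hr⟩ := hB (hG.quasiConcavePair hp h0 ht) a b ha hab
  simp only [ENNReal.rpow_one] at hr
  refine (hm _ (fun x => ((2 * C₁ + 2 * C₂) * K : ℝ≥0) * (G x * h x)) ?_).trans ?_
  · intro c d hc hcd hs
    have hd := hc.trans_le hcd
    rw [withDensity_apply _ measurableSet_Ioc]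
    rcases hs with hs | hs
    · refine le_trans ?_ le_self_add
      calc ∫⁻ s in Ioc c d, k s ∂κ ≤ ∫⁻ _ in Ioc c d, k c ∂κ :=
            setLIntegral_mono' measurableSet_Ioc fun s hs => hk hs.1.le
        _ = k c * κ (Ioc c d) := setLIntegral_const _ _
        _ ≤ k c * κ (Ioc 0 d) := by
            gcongr
        _ ≤ k c * (C₁ * (2 * (powWeight p c * G c))) := by
            gcongr
            exact (hκ d hd).trans (by gcongr)
        _ = 2 * C₁ * G c * (k c * powWeight p c) := by ring
        _ ≤ 2 * C₁ * G c * (K * h c) := by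
            refine mul_le_mul' le_rfl ?_
            exact (mul_powWeight_le_lpNormOn hp hk).trans (hkK c hc)
        _ = ((2 * C₁) * K) * (G c * h c) := by ring
        _ ≤ _ := by
            push_cast
            gcongr
            exact le_self_add
    · refine le_trans ?_ le_add_self
      calc ∫⁻ s in Ioc c d, k s ∂κ ≤ C₂ * (G c * lpNormOn p k d) := hkκ c d hc hcd
        _ ≤ C₂ * ((2 * G d) * (K * h d)) := by
            gcongr
            exact hkK d hd
        _ = ((2 * C₂) * K) * (G d * h d) := by ring
        _ ≤ _ := by
            push_cast
            gcongr
            exact le_add_self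
  · rw [List.sum_map_mul_left]
    calc _ ≤ 2 * ((((2 * C₁ + 2 * C₂) * K : ℝ≥0) : ℝ≥0∞) * (B * ∫⁻ s in Ici 0, G s ∂ν)) := by
          gcongr
          exact sum_gauge_mul_fundamental_le hp hG ν ha hl hr
      _ = _ := by push_cast; ring

/-! ### Fundamental functions and the lower half of the duality -/

/-- The quotient of the fundamental function of `ν` by `z ^ (1 / p)`. -/
noncomputable def fundamentalQuotient (p : ℝ) (ν : Measure ℝ) (z : ℝ) : ℝ≥0∞ :=
  ∫⁻ s in Ici (0 : ℝ), (powWeight p s + powWeight p z)⁻¹ ∂ν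

lemma ennreal_mul_inv_add_le {a b c : ℝ≥0∞} (ha : a ≠ 0) (hb : b ≠ ∞) (hc : c ≠ ∞) (hab : a ≤ b) :
    a * (c + a)⁻¹ ≤ b * (c + b)⁻¹ := by
  have hb0 : b ≠ 0 := fun h => ha (le_antisymm (hab.trans h.le) bot_le)
  have ha' : a ≠ ∞ := (hab.trans_lt (lt_top_iff_ne_top.2 hb)).ne
  rw [← div_eq_mul_inv, ← div_eq_mul_inv,
    ENNReal.le_div_iff_mul_le (Or.inl (by simp [hb0])) (Or.inl (ENNReal.add_ne_top.2 ⟨hc, hb⟩)),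
    mul_comm, ← mul_div_assoc, ENNReal.div_le_iff (by simp [ha]) (ENNReal.add_ne_top.2 ⟨hc, ha'⟩)]
  calc (c + b) * a = a * c + b * a := by ring
    _ ≤ b * c + b * a := by gcongr
    _ = b * (c + a) := by ring

lemma quasiConcavePair_fundamental {p : ℝ} (hp : 0 < p) {ν : Measure ℝ}
    (h0 : ∀ z, 0 < z → fundamentalFunction (powWeight p) ν z ≠ 0)
    (ht : ∀ z, 0 < z → fundamentalFunction (powWeight p) ν z ≠ ∞) :
    QuasiConcavePair (powWeight p) (fundamentalFunction (powWeight p) ν)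
      (fundamentalQuotient p ν) where
  monotoneOn x hx y hy hxy := by
    unfold fundamentalFunction
    rw [← lintegral_const_mul' _ _ (powWeight_ne_top hp x),
      ← lintegral_const_mul' _ _ (powWeight_ne_top hp y)]
    refine lintegral_mono fun s => ?_
    exact ennreal_mul_inv_add_le (powWeight_ne_zero hx) (powWeight_ne_top hp _)
      (powWeight_ne_top hp _) (powWeight_mono hp hxy)
  antitoneOn x hx y hy hxy := by
    refine lintegral_mono fun s => ?_
    simp only
    gcongr
    exact powWeight_mono hp hxy
  eq_mul _ _ := rfl
  ne_zero := h0
  ne_top := ht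
  continuousOn := continuous_powWeight.continuousOn
  weight_ne_zero _ hz := powWeight_ne_zero hz
  weight_ne_top z _ := powWeight_ne_top hp z

lemma measure_Ioc_le_fundamental {p : ℝ} (hp : 0 < p) (ν : Measure ℝ) {c d : ℝ} (hc : 0 < c)
    (hcd : c ≤ d) : ν (Ioc c d) ≤ 2 * fundamentalFunction (powWeight p) ν d := by
  have hd := hc.trans_le hcd
  unfold fundamentalFunction
  rw [← lintegral_const_mul' _ _ (powWeight_ne_top hp d), ← lintegral_const_mul' _ _ (by simp)]
  calc ν (Ioc c d) = ∫⁻ _ in Ioc c d, 1 ∂ν := by simp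
    _ ≤ ∫⁻ s in Ioc c d, 2 * (powWeight p d * (powWeight p s + powWeight p d)⁻¹) ∂ν := by
        refine setLIntegral_mono' measurableSet_Ioc fun s hs => ?_
        have h2 : (2 : ℝ≥0∞) * powWeight p d ≠ 0 := mul_ne_zero (by simp) (powWeight_ne_zero hd)
        have h2' : (2 : ℝ≥0∞) * powWeight p d ≠ ∞ :=
          ENNReal.mul_ne_top (by simp) (powWeight_ne_top hp d)
        calc (1 : ℝ≥0∞) = (2 * powWeight p d) * (2 * powWeight p d)⁻¹ :=
              (ENNReal.mul_inv_cancel h2 h2').symm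
          _ ≤ (2 * powWeight p d) * (powWeight p s + powWeight p d)⁻¹ := by
              gcongr
              rw [two_mul]
              gcongr
              exact powWeight_mono hp hs.2
          _ = _ := by ring
    _ ≤ _ := lintegral_mono_set fun s hs => (hc.trans hs.1).le

lemma lintegral_Ioc_inv_powWeight_le {p : ℝ} (hp : 0 < p) (ν : Measure ℝ) {c d : ℝ} (hc : 0 < c) :
    ∫⁻ s in Ioc c d, (powWeight p s)⁻¹ ∂ν ≤ 2 * fundamentalQuotient p ν c := by
  unfold fundamentalQuotient
  rw [← lintegral_const_mul' _ _ (by simp)]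
  calc ∫⁻ s in Ioc c d, (powWeight p s)⁻¹ ∂ν
      ≤ ∫⁻ s in Ioc c d, 2 * (powWeight p s + powWeight p c)⁻¹ ∂ν := by
        refine setLIntegral_mono' measurableSet_Ioc fun s hs => ?_
        calc (powWeight p s)⁻¹ = 2 * (2 * powWeight p s)⁻¹ := by
              rw [ENNReal.mul_inv (Or.inl (by simp)) (Or.inl (by simp)), ← mul_assoc,
                ENNReal.mul_inv_cancel (by simp) (by simp), one_mul]
          _ ≤ _ := by
              gcongr
              rw [two_mul]
              gcongr
              exact powWeight_mono hp hs.1.le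
    _ ≤ _ := lintegral_mono_set fun s hs => (hc.trans hs.1).le

/-- On a slow interval the integral of a gauge is controlled by the endpoints. -/
lemma lintegral_Ioc_gauge_le {p : ℝ} (hp : 0 < p) {G : ℝ → ℝ≥0∞} (hG : IsGauge p G)
    (ν : Measure ℝ) {c d : ℝ} (hc : 0 < c) (hcd : c ≤ d)
    (hs : SlowPair (fundamentalFunction (powWeight p) ν) (fundamentalQuotient p ν) c d) :
    ∫⁻ s in Ioc c d, G s ∂ν ≤ 4 * (fundamentalFunction (powWeight p) ν c * G c) +
      4 * (fundamentalFunction (powWeight p) ν d * G d) := by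
  have hd := hc.trans_le hcd
  rcases hs with hs | hs
  · refine le_trans ?_ le_self_add
    calc ∫⁻ s in Ioc c d, G s ∂ν ≤ ∫⁻ _ in Ioc c d, G c ∂ν :=
          setLIntegral_mono' measurableSet_Ioc fun s hs =>
            hG.antitoneOn hc.le (hc.trans hs.1).le hs.1.le
      _ = G c * ν (Ioc c d) := setLIntegral_const _ _
      _ ≤ G c * (2 * (2 * fundamentalFunction (powWeight p) ν c)) := by
          gcongr
          exact (measure_Ioc_le_fundamental hp ν hc hcd).trans (by gcongr)
      _ = _ := by ring
  · refine le_trans ?_ le_add_self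
    calc ∫⁻ s in Ioc c d, G s ∂ν
        ≤ ∫⁻ s in Ioc c d, powWeight p d * G d * (powWeight p s)⁻¹ ∂ν := by
          refine setLIntegral_mono' measurableSet_Ioc fun s hs => ?_
          have hs0 : 0 < s := hc.trans hs.1
          calc G s = (powWeight p s * G s) * (powWeight p s)⁻¹ := by
                rw [mul_comm, ← mul_assoc, ENNReal.inv_mul_cancel (powWeight_ne_zero hs0)
                  (powWeight_ne_top hp s), one_mul]
            _ ≤ _ := by
                exact mul_le_mul' (hG.monotoneOn hs0 hd hs.2) le_rfl
      _ = powWeight p d * G d * ∫⁻ s in Ioc c d, (powWeight p s)⁻¹ ∂ν := by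
          refine lintegral_const_mul _ ?_
          exact continuous_powWeight.measurable.inv
      _ ≤ powWeight p d * G d * (2 * (2 * fundamentalQuotient p ν d)) := by
          refine mul_le_mul' le_rfl ?_
          exact (lintegral_Ioc_inv_powWeight_le hp ν hc).trans (mul_le_mul' le_rfl hs)
      _ = 4 * (powWeight p d * fundamentalQuotient p ν d * G d) := by ring
      _ = _ := rfl

lemma measure_zero_le_fundamental {p : ℝ} (hp : 0 < p) (ν : Measure ℝ) {r : ℝ} (hr : 0 < r) :
    ν {0} ≤ fundamentalFunction (powWeight p) ν r := by
  unfold fundamentalFunction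
  calc ν {0} = powWeight p r * ∫⁻ _ in ({0} : Set ℝ), (powWeight p r)⁻¹ ∂ν := by
        rw [setLIntegral_const, ← mul_assoc,
          ENNReal.mul_inv_cancel (powWeight_ne_zero hr) (powWeight_ne_top hp r), one_mul]
    _ ≤ powWeight p r * ∫⁻ s in ({0} : Set ℝ), (powWeight p s + powWeight p r)⁻¹ ∂ν := by
        gcongr 1
        refine setLIntegral_mono' (measurableSet_singleton _) fun s hs => ?_
        rw [mem_singleton_iff.1 hs, powWeight_zero hp, zero_add]
    _ ≤ _ := by
        gcongr
        simp

/-- The triangle inequality for the `L^p` quasinorm raised to the power `min p 1`. -/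
lemma lpNormOn_add_rpow_le {p : ℝ} (hp : 0 < p) {f g : ℝ → ℝ≥0∞} (hf : Measurable f)
    (hg : Measurable g) (r : ℝ) :
    lpNormOn p (fun s => f s + g s) r ^ min p 1 ≤
      lpNormOn p f r ^ min p 1 + lpNormOn p g r ^ min p 1 := by
  unfold lpNormOn
  rcases le_total p 1 with h | h
  · rw [min_eq_left h]
    simp only [← ENNReal.rpow_mul, one_div_mul_cancel hp.ne', ENNReal.rpow_one]
    rw [← lintegral_add_left (hf.pow_const _)]
    exact lintegral_mono fun s => ENNReal.rpow_add_le_add_rpow _ _ hp.le h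
  · rw [min_eq_right h]
    simp only [ENNReal.rpow_one]
    exact ENNReal.lintegral_Lp_add_le hf.aemeasurable hg.aemeasurable h

lemma lpNormOn_const_mul {p : ℝ} (hp : 0 < p) {f : ℝ → ℝ≥0∞} (hf : Measurable f) (c : ℝ≥0∞)
    (r : ℝ) : lpNormOn p (fun s => c * f s) r = c * lpNormOn p f r := by
  unfold lpNormOn
  simp only [ENNReal.mul_rpow_of_nonneg _ _ hp.le]
  rw [lintegral_const_mul _ (hf.pow_const _), ENNReal.mul_rpow_of_nonneg _ _ (by positivity),
    ← ENNReal.rpow_mul, mul_one_div_cancel hp.ne', ENNReal.rpow_one]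

lemma lpNormOn_mono {p : ℝ} (hp : 0 < p) {f g : ℝ → ℝ≥0∞} {r : ℝ}
    (h : ∀ s ∈ Ioo 0 r, f s ≤ g s) : lpNormOn p f r ≤ lpNormOn p g r := by
  unfold lpNormOn
  gcongr 1
  exact setLIntegral_mono' measurableSet_Ioo fun s hs => by gcongr; exact h s hs

/-- The tail function of a measure. -/
noncomputable def tail (μ : Measure ℝ) (x : ℝ) : ℝ≥0∞ := μ (Ioi x)

lemma tail_antitone (μ : Measure ℝ) : Antitone (tail μ) := fun _ _ h =>
  measure_mono (Ioi_subset_Ioi h)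

lemma tail_add (μ₁ μ₂ : Measure ℝ) : tail (μ₁ + μ₂) = fun s => tail μ₁ s + tail μ₂ s := rfl

lemma tail_smul (c : ℝ≥0∞) (μ : Measure ℝ) : tail (c • μ) = fun s => c * tail μ s := rfl

/-- The tail of a measure living on `(t, ∞)` is constant on `(0, t)`, which gives a gain over the
global `L^p` norm on short intervals. -/
lemma powWeight_mul_lpNormOn_tail_le {p : ℝ} (hp : 0 < p) {μ : Measure ℝ} {t : ℝ}
    (hμ : μ (Iic t) = 0) {C : ℝ≥0∞} (hC : ∫⁻ x in Ioi 0, tail μ x ^ p ≤ C) (r : ℝ) :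
    powWeight p t * lpNormOn p (tail μ) r ≤ C ^ (1 / p) * powWeight p r ∧
      lpNormOn p (tail μ) r ≤ C ^ (1 / p) := by
  have h2 : lpNormOn p (tail μ) r ≤ C ^ (1 / p) := by
    unfold lpNormOn
    gcongr 1
    exact (lintegral_mono_set Ioo_subset_Ioi_self).trans hC
  refine ⟨?_, h2⟩
  rcases le_total t r with htr | hrt
  · rw [mul_comm]
    exact mul_le_mul' h2 (powWeight_mono hp htr)
  have hle : ∀ s, s ≤ t → tail μ s = tail μ t := by
    intro s hst
    refine le_antisymm ?_ (tail_antitone μ hst)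
    calc tail μ s ≤ μ (Iic t ∪ Ioi t) := measure_mono (by rw [Iic_union_Ioi]; exact subset_univ _)
      _ ≤ μ (Iic t) + μ (Ioi t) := measure_union_le _ _
      _ = tail μ t := by rw [hμ, zero_add]; rfl
  have hI : ∀ r, r ≤ t → ∫⁻ x in Ioo 0 r, tail μ x ^ p = tail μ t ^ p * ENNReal.ofReal r := by
    intro r hrt
    rw [setLIntegral_congr_fun measurableSet_Ioo (g := fun _ => tail μ t ^ p)
      (fun s hs => by rw [hle s (hs.2.le.trans hrt)])]
    simp
  have hCt : tail μ t ^ p * ENNReal.ofReal t ≤ C := by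
    rw [← hI t le_rfl]
    exact (lintegral_mono_set Ioo_subset_Ioi_self).trans hC
  unfold lpNormOn powWeight
  rw [hI r hrt, ← ENNReal.mul_rpow_of_nonneg _ _ (by positivity),
    ← ENNReal.mul_rpow_of_nonneg _ _ (by positivity)]
  gcongr 1
  calc ENNReal.ofReal t * (tail μ t ^ p * ENNReal.ofReal r)
      = (tail μ t ^ p * ENNReal.ofReal t) * ENNReal.ofReal r := by ring
    _ ≤ _ := by gcongr

/-- A superposition of the extremal measures of a gauge over the points of a list. -/
lemma exists_superposition {p : ℝ} (hp : 0 < p) {C₁ : ℝ≥0} {G u v Φ : ℝ → ℝ≥0∞}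
    (huv : ∀ z, 0 < z → u z = powWeight p z * v z)
    (htest : ∀ t, 0 < t → ∃ μ : Measure ℝ, SFinite μ ∧ μ (Iic t) = 0 ∧ G t ≤ 2 * ∫⁻ x, Φ x ∂μ ∧
      ∫⁻ x in Ioi 0, tail μ x ^ p ≤ C₁) (l : List ℝ) (hl : ∀ x ∈ l, 0 < x) :
    ∃ μ : Measure ℝ, SFinite μ ∧ μ (Iic 0) = 0 ∧ (l.map fun x => u x * G x).sum ≤ 2 * ∫⁻ x, Φ x ∂μ ∧
      ∀ r, lpNormOn p (tail μ) r ^ min p 1 ≤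
        ((C₁ : ℝ≥0∞) ^ (1 / p)) ^ min p 1 *
          (l.map fun x => min (u x) (powWeight p r * v x) ^ min p 1).sum := by
  have hq : 0 < min p 1 := lt_min hp one_pos
  induction l with
  | nil =>
    refine ⟨0, inferInstance, by simp, by simp, fun r => ?_⟩
    have : tail (0 : Measure ℝ) = fun _ => 0 := by ext; simp [tail]
    simp [this, lpNormOn, hp, hq]
  | cons a l ih =>
    obtain ⟨μ, hμs, hμ0, hμ, hμr⟩ := ih fun x hx => hl x (List.mem_cons_of_mem _ hx)
    have ha : 0 < a := hl a List.mem_cons_self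
    obtain ⟨μa, hμas, hμa0, hμa, hμar⟩ := htest a ha
    have hmeas : ∀ m : Measure ℝ, Measurable (tail m) := fun m => (tail_antitone m).measurable
    refine ⟨u a • μa + μ, inferInstance, ?_, ?_, fun r => ?_⟩
    · have : μa (Iic 0) = 0 := measure_mono_null (Iic_subset_Iic.2 ha.le) hμa0
      simp [hμ0, this]
    · simp only [List.map_cons, List.sum_cons, lintegral_add_measure, lintegral_smul_measure,
        smul_eq_mul, mul_add]
      refine add_le_add ?_ hμ
      calc u a * G a ≤ u a * (2 * ∫⁻ x, Φ x ∂μa) := by gcongr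
        _ = _ := by ring
    · simp only [List.map_cons, List.sum_cons, tail_add, tail_smul, mul_add]
      refine (lpNormOn_add_rpow_le hp ((hmeas _).const_mul _) (hmeas _) r).trans
        (add_le_add ?_ (hμr r))
      rw [lpNormOn_const_mul hp (hmeas _), ← ENNReal.mul_rpow_of_nonneg _ _ hq.le]
      gcongr 1
      obtain ⟨h1, h2⟩ := powWeight_mul_lpNormOn_tail_le hp hμa0 hμar r
      rcases min_choice (u a) (powWeight p r * v a) with h | h
      · rw [h, mul_comm]
        gcongr
      · rw [h, huv a ha]
        calc powWeight p a * v a * lpNormOn p (tail μa) r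
            = v a * (powWeight p a * lpNormOn p (tail μa) r) := by ring
          _ ≤ v a * ((C₁ : ℝ≥0∞) ^ (1 / p) * powWeight p r) := by gcongr
          _ = _ := by ring

/-- The lower half of the duality for an abstract gauge. If every value `G t` is attained, up to a
factor, by integrating `Φ` against a measure on `(t, ∞)` whose tail has bounded `L^p` norm, then
the `ν`-integral of `G` is bounded by the integrals of `Φ` against measures whose tails have `L^p`
norms over `(0, r)` dominated by the fundamental function of `ν`. -/
theorem exists_gauge_le_lintegral {p : ℝ} (hp : 0 < p) (C₁ : ℝ≥0) : ∃ C : ℝ≥0,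
    ∀ (G Φ : ℝ → ℝ≥0∞) (ν : Measure ℝ) (Y : ℝ≥0∞), IsGauge p G → G 0 ≤ ⨆ a ∈ Ioi (0 : ℝ), G a →
      (∀ t, 0 < t → ∃ μ : Measure ℝ, SFinite μ ∧ μ (Iic t) = 0 ∧ G t ≤ 2 * ∫⁻ x, Φ x ∂μ ∧
        ∫⁻ x in Ioi 0, tail μ x ^ p ≤ C₁) →
      (∀ z, 0 < z → fundamentalFunction (powWeight p) ν z ≠ 0) →
      (∀ z, 0 < z → fundamentalFunction (powWeight p) ν z ≠ ∞) →
      (∀ μ : Measure ℝ, SFinite μ → μ (Iic 0) = 0 →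
        (∀ r, 0 < r → lpNormOn p (tail μ) r ≤ fundamentalFunction (powWeight p) ν r) →
        ∫⁻ x, Φ x ∂μ ≤ Y) →
      ∫⁻ s in Ici 0, G s ∂ν ≤ C * Y := by
  have hq : 0 < min p 1 := lt_min hp one_pos
  obtain ⟨B, hB⟩ := exists_chain_constant hq
  set D : ℝ≥0 := C₁ ^ (1 / p) with hD
  have hDc : (C₁ : ℝ≥0∞) ^ (1 / p) = D := by rw [hD, ENNReal.coe_rpow_of_nonneg _ (by positivity)]
  -- the summands serve the superposition over a chain and the atom of `ν` at the origin; the last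
  -- one keeps `M` invertible
  set M : ℝ≥0 := D * B ^ (1 / min p 1) + D + 1 with hM
  have hBc : ((B ^ (1 / min p 1) : ℝ≥0) : ℝ≥0∞) ^ min p 1 = B := by
    rw [ENNReal.coe_rpow_of_nonneg _ (by positivity), ← ENNReal.rpow_mul,
      one_div_mul_cancel hq.ne', ENNReal.rpow_one]
  have hM0 : (M : ℝ≥0∞) ≠ 0 := by
    rw [ENNReal.coe_ne_zero]; exact (by positivity : 0 < M).ne'
  refine ⟨2 * M + 16 * M, fun G Φ ν Y hG hG0 htest h0 ht hY => ?_⟩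
  set h := fundamentalFunction (powWeight p) ν with hh
  have hmeas : ∀ m : Measure ℝ, Measurable (tail m) := fun m => (tail_antitone m).measurable
  have hYM : ∀ μ : Measure ℝ, SFinite μ → μ (Iic 0) = 0 →
      (∀ r, 0 < r → lpNormOn p (tail μ) r ≤ M * h r) → ∫⁻ x, Φ x ∂μ ≤ M * Y := by
    intro μ hμ hμ0 hμr
    have := hY ((M : ℝ≥0∞)⁻¹ • μ) inferInstance (by simp [hμ0]) (fun r hr => by
      rw [tail_smul, lpNormOn_const_mul hp (hmeas _)]
      calc (M : ℝ≥0∞)⁻¹ * lpNormOn p (tail μ) r ≤ (M : ℝ≥0∞)⁻¹ * (M * h r) := by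
            gcongr; exact hμr r hr
        _ = h r := by
            rw [← mul_assoc, ENNReal.inv_mul_cancel hM0 ENNReal.coe_ne_top, one_mul])
    rw [lintegral_smul_measure, smul_eq_mul] at this
    calc ∫⁻ x, Φ x ∂μ = M * ((M : ℝ≥0∞)⁻¹ * ∫⁻ x, Φ x ∂μ) := by
          rw [← mul_assoc, ENNReal.mul_inv_cancel hM0 ENNReal.coe_ne_top, one_mul]
      _ ≤ _ := by gcongr
  -- an atom of `ν` at the origin, which the discretization of `(0, ∞)` does not see
  have hatom : ∫⁻ s in ({0} : Set ℝ), G s ∂ν ≤ (2 * M) * Y := by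
    rw [lintegral_singleton, mul_comm]
    calc ν {0} * G 0 ≤ ν {0} * ⨆ a ∈ Ioi (0 : ℝ), G a := by gcongr
      _ = ⨆ a ∈ Ioi (0 : ℝ), ν {0} * G a := by simp only [ENNReal.mul_iSup]
      _ ≤ _ := by
        refine iSup₂_le fun a ha => ?_
        obtain ⟨μ, hμs, hμ0, hμ, hμr⟩ := htest a ha
        have h1 := hYM (ν {0} • μ) inferInstance
          (by simp [measure_mono_null (Iic_subset_Iic.2 (mem_Ioi.1 ha).le) hμ0]) (fun r hr => by
            rw [tail_smul, lpNormOn_const_mul hp (hmeas _), mul_comm]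
            refine mul_le_mul' ?_ (measure_zero_le_fundamental hp ν hr)
            refine (powWeight_mul_lpNormOn_tail_le hp hμ0 hμr r).2.trans ?_
            rw [hDc]
            exact_mod_cast le_trans le_add_self (le_self_add (b := 1)))
        rw [lintegral_smul_measure, smul_eq_mul] at h1
        calc ν {0} * G a ≤ ν {0} * (2 * ∫⁻ x, Φ x ∂μ) := by gcongr
          _ = 2 * (ν {0} * ∫⁻ x, Φ x ∂μ) := by ring
          _ ≤ 2 * (M * Y) := by gcongr
          _ = _ := by ring
  have hpos : ∫⁻ s in Ioi 0, G s ∂ν ≤ (16 * M) * Y := by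
    rw [← withDensity_apply _ measurableSet_Ioi]
    refine measure_Ioi_zero_le fun a b ha hab => ?_
    obtain ⟨l, hl, hm, hr⟩ := hB (quasiConcavePair_fundamental hp h0 ht) a b ha hab
    obtain ⟨μ, hμs, hμ0, hμ, hμr⟩ := exists_superposition hp (C₁ := C₁) (G := G) (Φ := Φ)
      (u := h) (v := fundamentalQuotient p ν) (fun _ _ => rfl) htest l
      fun x hx => ha.trans_le (hl x hx)
    have h1 := hYM μ hμs hμ0 (fun r hr0 => by
      rw [← ENNReal.rpow_le_rpow_iff hq]
      calc lpNormOn p (tail μ) r ^ min p 1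
          ≤ (D : ℝ≥0∞) ^ min p 1 * (B * h r ^ min p 1) := by
            refine (hμr r).trans ?_
            rw [hDc]
            gcongr
            exact hr r hr0
        _ = ((D * B ^ (1 / min p 1) : ℝ≥0) * h r) ^ min p 1 := by
            rw [ENNReal.mul_rpow_of_nonneg _ _ hq.le, ENNReal.coe_mul,
              ENNReal.mul_rpow_of_nonneg _ _ hq.le, hBc, mul_assoc]
        _ ≤ _ := by
            gcongr
            rw [hM, add_assoc]; exact le_self_add)
    calc (ν.withDensity G) (Ioc a b) ≤ 2 * (l.map fun x => 4 * (h x * G x)).sum := by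
          refine hm _ _ fun c d hc hcd hs => ?_
          rw [withDensity_apply _ measurableSet_Ioc]
          exact lintegral_Ioc_gauge_le hp hG ν hc hcd hs
      _ = 8 * (l.map fun x => h x * G x).sum := by
          rw [List.sum_map_mul_left]; ring
      _ ≤ 8 * (2 * ∫⁻ x, Φ x ∂μ) := by gcongr
      _ ≤ 8 * (2 * (M * Y)) := by gcongr
      _ = _ := by ring
  calc ∫⁻ s in Ici 0, G s ∂ν = ∫⁻ s in {0} ∪ Ioi 0, G s ∂ν := by
        rw [singleton_union, Ioi_insert]
    _ ≤ (2 * M) * Y + (16 * M) * Y := (lintegral_union_le _ _ _).trans (add_le_add hatom hpos)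
    _ = _ := by push_cast; ring

/-! ### Dilations, power integrals and Hardy-type estimates -/

lemma lintegral_comp_const_mul {c : ℝ} (hc : 0 < c) (g : ℝ → ℝ≥0∞) :
    ∫⁻ z, g z = ENNReal.ofReal c * ∫⁻ w, g (c * w) := by
  have hemb : MeasurableEmbedding fun x : ℝ => c * x :=
    (Homeomorph.mulLeft₀ c hc.ne').measurableEmbedding
  rw [← hemb.lintegral_map, Real.map_volume_mul_left hc.ne', lintegral_smul_measure, smul_eq_mul,
    abs_of_pos (inv_pos.2 hc), ← mul_assoc, ← ENNReal.ofReal_mul hc.le, mul_inv_cancel₀ hc.ne',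
    ENNReal.ofReal_one, one_mul]

lemma setLIntegral_Ioi_dilation {c : ℝ} (hc : 0 < c) (g : ℝ → ℝ≥0∞) (a : ℝ) :
    ∫⁻ z in Ioi (c * a), g z = ENNReal.ofReal c * ∫⁻ w in Ioi a, g (c * w) := by
  rw [← lintegral_indicator measurableSet_Ioi, ← lintegral_indicator measurableSet_Ioi,
    lintegral_comp_const_mul hc]
  congr 2
  ext w
  simp only [indicator, mem_Ioi, mul_lt_mul_iff_right₀ hc]

lemma setLIntegral_Ioo_half (g : ℝ → ℝ≥0∞) (d : ℝ) :
    ∫⁻ z in Ioo 0 (2 * d), g (z / 2) = 2 * ∫⁻ w in Ioo 0 d, g w := by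
  rw [← lintegral_indicator measurableSet_Ioo, ← lintegral_indicator measurableSet_Ioo,
    lintegral_comp_const_mul two_pos]
  congr 2
  · norm_num
  · ext w
    have : (2 * w ∈ Ioo 0 (2 * d)) ↔ w ∈ Ioo 0 d := by
      simp only [mem_Ioo]
      constructor <;> rintro ⟨h1, h2⟩ <;> constructor <;> linarith
    simp only [indicator, this]
    simp

lemma lintegral_Ioi_rpow {e x : ℝ} (he : 0 < e) (hx : 0 < x) :
    ∫⁻ z in Ioi x, ENNReal.ofReal z ^ (-e - 1) = ENNReal.ofReal e⁻¹ * ENNReal.ofReal x ^ (-e) := by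
  have h1 : ∫⁻ z in Ioi x, ENNReal.ofReal z ^ (-e - 1)
      = ∫⁻ z in Ioi x, ENNReal.ofReal (z ^ (-e - 1)) :=
    setLIntegral_congr_fun measurableSet_Ioi fun z hz =>
      ENNReal.ofReal_rpow_of_pos (hx.trans hz)
  rw [h1, ← ofReal_integral_eq_lintegral_ofReal (integrableOn_Ioi_rpow_of_lt (by linarith) hx),
    integral_Ioi_rpow_of_lt (by linarith) hx, ENNReal.ofReal_rpow_of_pos hx,
    ← ENNReal.ofReal_mul (by positivity)]
  · congr 1
    rw [show -e - 1 + 1 = -e by ring]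
    field_simp
  · filter_upwards [self_mem_ae_restrict measurableSet_Ioi] with z hz
    exact Real.rpow_nonneg (hx.trans hz).le _

lemma lintegral_Ioo_rpow_neg_half {z : ℝ} (hz : 0 < z) :
    ∫⁻ x in Ioo 0 z, ENNReal.ofReal x ^ (-(1 / 2) : ℝ) = 2 * ENNReal.ofReal z ^ (1 / 2 : ℝ) := by
  have h1 : ∫⁻ x in Ioo 0 z, ENNReal.ofReal x ^ (-(1 / 2) : ℝ)
      = ∫⁻ x in Ioo 0 z, ENNReal.ofReal (x ^ (-(1 / 2) : ℝ)) :=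
    setLIntegral_congr_fun measurableSet_Ioo fun x hx => ENNReal.ofReal_rpow_of_pos hx.1
  have hint : IntegrableOn (fun x : ℝ => x ^ (-(1 / 2) : ℝ)) (Ioo 0 z) :=
    ((intervalIntegrable_iff_integrableOn_Ioc_of_le hz.le).1
      (intervalIntegral.intervalIntegrable_rpow' (by norm_num))).mono_set Ioo_subset_Ioc_self
  rw [h1, ← ofReal_integral_eq_lintegral_ofReal hint, ← integral_Ioc_eq_integral_Ioo,
    ← intervalIntegral.integral_of_le hz.le, integral_rpow (Or.inl (by norm_num)),
    ENNReal.ofReal_rpow_of_pos hz]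
  · rw [← ENNReal.ofReal_ofNat, ← ENNReal.ofReal_mul (by norm_num)]
    congr 1
    rw [Real.zero_rpow (by norm_num)]
    norm_num
    ring
  · filter_upwards [self_mem_ae_restrict measurableSet_Ioo] with x hx
    exact Real.rpow_nonneg hx.1.le _

/-- The dual Hardy inequality: `b ↦ ∫_x^∞ b(z) dz / z` is bounded on `L^p(0, ∞)` for `p > 1`.
The proof is Hölder's inequality with a power weight, followed by Tonelli's theorem. -/
theorem exists_dual_hardy {p : ℝ} (hp : 1 < p) : ∃ C : ℝ≥0, ∀ b : ℝ → ℝ≥0∞, Measurable b →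
    ∫⁻ x in Ioi (0 : ℝ), (∫⁻ z in Ioi x, b z / ENNReal.ofReal z) ^ p
      ≤ C * ∫⁻ z in Ioi (0 : ℝ), b z ^ p := by
  have hpq := Real.HolderConjugate.conjExponent hp
  set q := p.conjExponent with hq
  have hp0 : 0 < p := by linarith
  have hq0 : 0 < q := hpq.symm.pos
  -- the exponent of the power weight; any `α` with `0 < α < 1 / p` would do
  set α : ℝ := 1 / (2 * p) with hα
  have hα0 : 0 < α := by positivity
  have hαp : α * p = 1 / 2 := by rw [hα]; field_simp
  set D : ℝ≥0∞ := ENNReal.ofReal (α * q)⁻¹ ^ (p / q) with hD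
  have hDt : D ≠ ∞ := ENNReal.rpow_ne_top_of_nonneg (by positivity) ENNReal.ofReal_ne_top
  have hrpow : ∀ e : ℝ, Measurable fun z : ℝ => ENNReal.ofReal z ^ e := fun e =>
    ENNReal.measurable_ofReal.pow_const e
  refine ⟨(2 * D).toNNReal, fun b hb => ?_⟩
  rw [ENNReal.coe_toNNReal (ENNReal.mul_ne_top (by simp) hDt)]
  have key : ∀ x ∈ Ioi (0 : ℝ), (∫⁻ z in Ioi x, b z / ENNReal.ofReal z) ^ p ≤
      D * ∫⁻ z in Ioi x, ENNReal.ofReal x ^ (-(1 / 2) : ℝ) *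
        (b z ^ p * ENNReal.ofReal z ^ (-(1 / 2) : ℝ)) := by
    intro x hx
    have hx : 0 < x := hx
    have h1 : ∫⁻ z in Ioi x, b z / ENNReal.ofReal z ≤
        (∫⁻ z in Ioi x, b z ^ p * ENNReal.ofReal z ^ (-(1 / 2) : ℝ)) ^ (1 / p) *
          (∫⁻ z in Ioi x, ENNReal.ofReal z ^ (-(α * q) - 1)) ^ (1 / q) := by
      calc ∫⁻ z in Ioi x, b z / ENNReal.ofReal z
          = ∫⁻ z in Ioi x, ((fun z => b z * ENNReal.ofReal z ^ (α - 1 / p)) *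
              (fun z => ENNReal.ofReal z ^ (-α - 1 / q))) z := by
            refine setLIntegral_congr_fun measurableSet_Ioi fun z hz => ?_
            have hz0 : 0 < z := hx.trans hz
            simp only [Pi.mul_apply]
            rw [mul_assoc, ← ENNReal.rpow_add _ _ (by simpa using hz0) ENNReal.ofReal_ne_top,
              show α - 1 / p + (-α - 1 / q) = -1 by
                have := hpq.inv_add_inv_eq_one
                rw [one_div, one_div]; linarith, ENNReal.rpow_neg_one, div_eq_mul_inv]
        _ ≤ _ := ENNReal.lintegral_mul_le_Lp_mul_Lq _ hpq
            (hb.mul (hrpow _)).aemeasurable (hrpow _).aemeasurable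
        _ = _ := by
            congr 2
            · refine lintegral_congr fun z => ?_
              rw [ENNReal.mul_rpow_of_nonneg _ _ hp0.le, ← ENNReal.rpow_mul]
              congr 2
              rw [sub_mul, hαp, one_div_mul_cancel hp0.ne']; norm_num
            · refine lintegral_congr fun z => ?_
              rw [← ENNReal.rpow_mul]
              congr 1
              rw [sub_mul, one_div_mul_cancel hq0.ne']; ring
    calc (∫⁻ z in Ioi x, b z / ENNReal.ofReal z) ^ p
        ≤ ((∫⁻ z in Ioi x, b z ^ p * ENNReal.ofReal z ^ (-(1 / 2) : ℝ)) ^ (1 / p) *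
          (∫⁻ z in Ioi x, ENNReal.ofReal z ^ (-(α * q) - 1)) ^ (1 / q)) ^ p := by gcongr
      _ = (∫⁻ z in Ioi x, b z ^ p * ENNReal.ofReal z ^ (-(1 / 2) : ℝ)) *
          (D * ENNReal.ofReal x ^ (-(1 / 2) : ℝ)) := by
          rw [ENNReal.mul_rpow_of_nonneg _ _ hp0.le, ← ENNReal.rpow_mul, ← ENNReal.rpow_mul,
            one_div_mul_cancel hp0.ne', ENNReal.rpow_one, lintegral_Ioi_rpow (by positivity) hx,
            ENNReal.mul_rpow_of_nonneg _ _ (by positivity), ← ENNReal.rpow_mul, hD,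
            show 1 / q * p = p / q by ring,
            show -(α * q) * (p / q) = -(1 / 2) by rw [← hαp]; field_simp]
      _ = _ := by
          have : Measurable fun z => b z ^ p * ENNReal.ofReal z ^ (-(1 / 2) : ℝ) :=
            (hb.pow_const _).mul (hrpow _)
          rw [lintegral_const_mul _ this]; ring
  calc ∫⁻ x in Ioi (0 : ℝ), (∫⁻ z in Ioi x, b z / ENNReal.ofReal z) ^ p
      ≤ ∫⁻ x in Ioi (0 : ℝ), D * ∫⁻ z in Ioi x, ENNReal.ofReal x ^ (-(1 / 2) : ℝ) *
        (b z ^ p * ENNReal.ofReal z ^ (-(1 / 2) : ℝ)) :=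
        setLIntegral_mono' measurableSet_Ioi key
    _ = D * ∫⁻ x in Ioi (0 : ℝ), ∫⁻ z in Ioi x, ENNReal.ofReal x ^ (-(1 / 2) : ℝ) *
        (b z ^ p * ENNReal.ofReal z ^ (-(1 / 2) : ℝ)) := lintegral_const_mul' _ _ hDt
    _ = D * ∫⁻ x in Ioi (0 : ℝ), ∫⁻ z in Ioi (0 : ℝ), {w : ℝ × ℝ | w.1 < w.2}.indicator
          (fun w => ENNReal.ofReal w.1 ^ (-(1 / 2) : ℝ) *
            (b w.2 ^ p * ENNReal.ofReal w.2 ^ (-(1 / 2) : ℝ))) (x, z) := by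
        congr 1
        refine setLIntegral_congr_fun measurableSet_Ioi fun x hx => ?_
        rw [← lintegral_indicator measurableSet_Ioi, ← lintegral_indicator measurableSet_Ioi]
        refine lintegral_congr fun z => ?_
        have hx : 0 < x := hx
        by_cases hxz : x < z
        · simp [indicator, hxz, hx.trans hxz]
        · simp [indicator, hxz]
    _ = D * ∫⁻ z in Ioi (0 : ℝ), ∫⁻ x in Ioi (0 : ℝ), {w : ℝ × ℝ | w.1 < w.2}.indicator
          (fun w => ENNReal.ofReal w.1 ^ (-(1 / 2) : ℝ) *
            (b w.2 ^ p * ENNReal.ofReal w.2 ^ (-(1 / 2) : ℝ))) (x, z) := by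
        rw [lintegral_lintegral_swap]
        refine Measurable.aemeasurable ?_
        refine Measurable.indicator ?_ (measurableSet_lt measurable_fst measurable_snd)
        exact ((hrpow _).comp measurable_fst).mul
          (((hb.pow_const _).comp measurable_snd).mul ((hrpow _).comp measurable_snd))
    _ = D * ∫⁻ z in Ioi (0 : ℝ), 2 * b z ^ p := by
        congr 1
        refine setLIntegral_congr_fun measurableSet_Ioi fun z hz => ?_
        have hz : 0 < z := hz
        calc ∫⁻ x in Ioi (0 : ℝ), {w : ℝ × ℝ | w.1 < w.2}.indicator
                (fun w => ENNReal.ofReal w.1 ^ (-(1 / 2) : ℝ) *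
                  (b w.2 ^ p * ENNReal.ofReal w.2 ^ (-(1 / 2) : ℝ))) (x, z)
            = ∫⁻ x in Ioo 0 z, ENNReal.ofReal x ^ (-(1 / 2) : ℝ) *
              (b z ^ p * ENNReal.ofReal z ^ (-(1 / 2) : ℝ)) := by
              rw [← lintegral_indicator measurableSet_Ioi, ← lintegral_indicator measurableSet_Ioo]
              refine lintegral_congr fun x => ?_
              by_cases h1 : 0 < x <;> by_cases h2 : x < z <;> simp [indicator, h1, h2]
          _ = 2 * b z ^ p * (ENNReal.ofReal z ^ (1 / 2 : ℝ) *
                ENNReal.ofReal z ^ (-(1 / 2) : ℝ)) := by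
              rw [lintegral_mul_const _ (hrpow _), lintegral_Ioo_rpow_neg_half hz]; ring
          _ = _ := by
              rw [← ENNReal.rpow_add _ _ (by simpa using hz) ENNReal.ofReal_ne_top]
              simp
    _ = _ := by
        rw [lintegral_const_mul _ (hb.pow_const _)]; ring

/-- A non-increasing function is dominated by a logarithmic average of its dilation by two over
`(s, 2s)`. After integration against `κ` this replaces `κ` by its distribution function. -/
lemma lintegral_antitone_le {κ : Measure ℝ} [SFinite κ] {k : ℝ → ℝ≥0∞} (hk : Antitone k)
    {c d : ℝ} (hc : 0 < c) :
    ∫⁻ s in Ioc c d, k s ∂κ ≤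
      2 * ∫⁻ z in Ioo c (2 * d), k (z / 2) * (κ (Ioc 0 z) / ENNReal.ofReal z) := by
  set f : ℝ × ℝ → ℝ≥0∞ := {w : ℝ × ℝ | w.1 < w.2 ∧ w.2 < 2 * w.1}.indicator
    (fun w => k (w.2 / 2) / ENNReal.ofReal w.2) with hf
  have hfm : Measurable f := by
    refine Measurable.indicator ?_ ((measurableSet_lt measurable_fst measurable_snd).inter
      (measurableSet_lt measurable_snd (measurable_fst.const_mul 2)))
    exact (hk.measurable.comp (measurable_snd.div_const 2)).div
      (ENNReal.measurable_ofReal.comp measurable_snd)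
  have h1 : ∀ s ∈ Ioc c d, k s ≤ 2 * ∫⁻ z, f (s, z) := by
    intro s hs
    have hs0 : 0 < s := hc.trans hs.1
    have h0 : ENNReal.ofReal s ≠ 0 := by simpa using hs0
    calc k s = 2 * ∫⁻ _ in Ioo s (2 * s), k s / ENNReal.ofReal (2 * s) := by
          rw [setLIntegral_const, Real.volume_Ioo, show 2 * s - s = s by ring,
            ENNReal.ofReal_mul two_pos.le, ENNReal.ofReal_ofNat, div_eq_mul_inv,
            ENNReal.mul_inv (Or.inl (by simp)) (Or.inl (by simp))]
          calc k s = k s * (2 * 2⁻¹) * ((ENNReal.ofReal s)⁻¹ * ENNReal.ofReal s) := by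
                rw [ENNReal.mul_inv_cancel (by simp) (by simp),
                  ENNReal.inv_mul_cancel h0 ENNReal.ofReal_ne_top, mul_one, mul_one]
            _ = _ := by ring
      _ ≤ 2 * ∫⁻ z in Ioo s (2 * s), k (z / 2) / ENNReal.ofReal z := by
          gcongr 1
          refine setLIntegral_mono' measurableSet_Ioo fun z hz => ?_
          gcongr
          · exact hk (by linarith [hz.2])
          · exact hz.2.le
      _ = 2 * ∫⁻ z, f (s, z) := by
          rw [← lintegral_indicator measurableSet_Ioo]
          rfl
  calc ∫⁻ s in Ioc c d, k s ∂κ ≤ ∫⁻ s in Ioc c d, 2 * (∫⁻ z, f (s, z)) ∂κ :=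
        setLIntegral_mono' measurableSet_Ioc h1
    _ = 2 * ∫⁻ s in Ioc c d, (∫⁻ z, f (s, z)) ∂κ := lintegral_const_mul' _ _ (by simp)
    _ = 2 * ∫⁻ z, ∫⁻ s in Ioc c d, f (s, z) ∂κ := by
        rw [lintegral_lintegral_swap (f := fun s z => f (s, z)) hfm.aemeasurable]
    _ ≤ _ := by
        gcongr 1
        rw [← lintegral_indicator measurableSet_Ioo]
        refine lintegral_mono fun z => ?_
        by_cases hz : z ∈ Ioo c (2 * d)
        · rw [indicator_of_mem hz]
          calc ∫⁻ s in Ioc c d, f (s, z) ∂κ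
              ≤ ∫⁻ s in Ioc c d, (Ioc 0 z).indicator
                  (fun _ => k (z / 2) / ENNReal.ofReal z) s ∂κ := by
                refine setLIntegral_mono' measurableSet_Ioc fun s hs => ?_
                by_cases h : s < z ∧ z < 2 * s
                · have : s ∈ Ioc 0 z := ⟨hc.trans hs.1, h.1.le⟩
                  simp [hf, indicator, h.1, h.2, this, -mem_Ioc]
                · simp [hf, indicator, h]
            _ ≤ ∫⁻ s, (Ioc 0 z).indicator (fun _ => k (z / 2) / ENNReal.ofReal z) s ∂κ :=
                setLIntegral_le_lintegral _ _
            _ = k (z / 2) / ENNReal.ofReal z * κ (Ioc 0 z) := by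
                rw [lintegral_indicator measurableSet_Ioc, setLIntegral_const]
            _ = _ := by simp only [div_eq_mul_inv]; ring
        · rw [indicator_of_notMem hz, nonpos_iff_eq_zero, ← nonpos_iff_eq_zero]
          calc ∫⁻ s in Ioc c d, f (s, z) ∂κ = ∫⁻ s in Ioc c d, 0 ∂κ := by
                refine setLIntegral_congr_fun measurableSet_Ioc fun s hs => ?_
                have : ¬ (s < z ∧ z < 2 * s) := fun h =>
                  hz ⟨hs.1.trans h.1, h.2.trans_le (by linarith [hs.2])⟩
                simp [hf, this]
            _ ≤ 0 := by simp

/-! ### The two gauges -/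

/-- The gauge for `p ≤ 1`: `sup_{x > z} Φ(x) / x ^ (1 / p)`. -/
noncomputable def supGauge (p : ℝ) (Φ : ℝ → ℝ≥0∞) (z : ℝ) : ℝ≥0∞ :=
  ⨆ x ∈ Ioi z, Φ x / powWeight p x

/-- The gauge for `p > 1`: `(∫_z^∞ (Φ(x) / x) ^ p' dx) ^ (1 / p')`. -/
noncomputable def intGauge (p : ℝ) (Φ : ℝ → ℝ≥0∞) (z : ℝ) : ℝ≥0∞ :=
  (∫⁻ x in Ioi z, (Φ x / ENNReal.ofReal x) ^ p.conjExponent) ^ (1 / p.conjExponent)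

lemma powWeight_mul {p a b : ℝ} (hp : 0 < p) (ha : 0 ≤ a) :
    powWeight p (a * b) = powWeight p a * powWeight p b := by
  rw [powWeight, ENNReal.ofReal_mul ha, ENNReal.mul_rpow_of_nonneg _ _ (by positivity)]; rfl

section supGauge
variable {p : ℝ} {Φ : ℝ → ℝ≥0∞}

lemma div_powWeight_le_supGauge {x z : ℝ} (h : z < x) : Φ x / powWeight p x ≤ supGauge p Φ z :=
  le_iSup₂ (f := fun x (_ : x ∈ Ioi z) => Φ x / powWeight p x) x h

lemma le_powWeight_mul_supGauge (hp : 0 < p) {x z : ℝ} (hz : 0 ≤ z) (h : z < x) :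
    Φ x ≤ powWeight p x * supGauge p Φ z := by
  have := div_powWeight_le_supGauge (p := p) (Φ := Φ) h
  rwa [ENNReal.div_le_iff (powWeight_ne_zero (hz.trans_lt h)) (powWeight_ne_top hp x),
    mul_comm] at this

lemma supGauge_antitone : Antitone (supGauge p Φ) := fun _ _ hxy =>
  iSup₂_le fun _ hw => div_powWeight_le_supGauge (hxy.trans_lt hw)

lemma isGauge_supGauge (hp : 0 < p) (hΦ : Monotone Φ) : IsGauge p (supGauge p Φ) where
  antitoneOn := supGauge_antitone.antitoneOn _
  monotoneOn x hx y hy hxy := by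
    have hx : 0 < x := hx
    have hy : 0 < y := hy
    simp only
    rw [supGauge]
    simp only [ENNReal.mul_iSup]
    refine iSup₂_le fun w hw => ?_
    have hw : x < w := hw
    have hw0 : 0 < w := hx.trans hw
    have h1 : (1 : ℝ) ≤ y / x := (one_le_div hx).2 hxy
    have hyx : 0 < y / x := by positivity
    calc powWeight p x * (Φ w / powWeight p w)
        ≤ powWeight p x * (Φ (y / x * w) / powWeight p w) := by
          gcongr
          exact hΦ (by nlinarith)
      _ = powWeight p x * (Φ (y / x * w) * powWeight p (y / x) /
            (powWeight p w * powWeight p (y / x))) := by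
          rw [ENNReal.mul_div_mul_right _ _ (powWeight_ne_zero hyx) (powWeight_ne_top hp _)]
      _ = (powWeight p (y / x) * powWeight p x) *
            (Φ (y / x * w) / powWeight p (y / x * w)) := by
          rw [powWeight_mul hp hyx.le, mul_comm (powWeight p w)]
          simp only [div_eq_mul_inv]
          ring
      _ = powWeight p y * (Φ (y / x * w) / powWeight p (y / x * w)) := by
          rw [← powWeight_mul hp hyx.le, div_mul_cancel₀ _ hx.ne']
      _ ≤ _ := by
          refine mul_le_mul' le_rfl (div_powWeight_le_supGauge ?_)
          calc y = y / x * x := (div_mul_cancel₀ _ hx.ne').symm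
            _ < y / x * w := by gcongr

lemma le_supGauge (hp : 0 < p) (hΦ : Monotone Φ) {z : ℝ} (hz : 0 < z) :
    Φ z ≤ powWeight p 2 * (powWeight p z * supGauge p Φ z) := by
  rw [← mul_assoc, ← powWeight_mul hp (by norm_num)]
  exact (hΦ (by linarith)).trans (le_powWeight_mul_supGauge hp hz.le (by linarith))

lemma supGauge_zero_le : supGauge p Φ 0 ≤ ⨆ a ∈ Ioi (0 : ℝ), supGauge p Φ a := by
  refine iSup₂_le fun x hx => ?_
  have hx : 0 < x := hx
  exact (div_powWeight_le_supGauge (half_lt_self hx)).trans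
    (le_iSup₂ (f := fun a (_ : a ∈ Ioi (0 : ℝ)) => supGauge p Φ a) (x / 2) (half_pos hx))

/-- The extremal measure for `supGauge` at `t` is a multiple of a Dirac mass at a point where the
supremum is almost attained. -/
lemma exists_test_supGauge (hp : 0 < p) {t : ℝ} (ht : 0 < t) (hfin : supGauge p Φ t ≠ ∞) :
    ∃ μ : Measure ℝ, SFinite μ ∧ μ (Iic t) = 0 ∧ supGauge p Φ t ≤ 2 * ∫⁻ x, Φ x ∂μ ∧
      ∫⁻ x in Ioi 0, tail μ x ^ p ≤ (1 : ℝ≥0) := by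
  by_cases h0 : supGauge p Φ t = 0
  · refine ⟨0, inferInstance, by simp, by simp [h0], ?_⟩
    simp [tail, hp]
  have hlt : supGauge p Φ t / 2 < ⨆ x ∈ Ioi t, Φ x / powWeight p x := ENNReal.half_lt_self h0 hfin
  obtain ⟨x, hx⟩ := lt_iSup_iff.1 hlt
  obtain ⟨hxt, hx⟩ := lt_iSup_iff.1 hx
  have hxt : t < x := hxt
  have hx0 := ht.trans hxt
  refine ⟨(powWeight p x)⁻¹ • Measure.dirac x, inferInstance, ?_, ?_, ?_⟩
  · simp [hxt]
  · rw [lintegral_smul_measure, lintegral_dirac, smul_eq_mul, mul_comm _ (Φ x), ← div_eq_mul_inv,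
      mul_comm]
    exact (ENNReal.div_le_iff (by simp) (by simp)).1 hx.le
  · calc ∫⁻ s in Ioi 0, tail ((powWeight p x)⁻¹ • Measure.dirac x) s ^ p
        = ∫⁻ s in Ioi 0, (Iio x).indicator (fun _ => (ENNReal.ofReal x)⁻¹) s := by
          refine lintegral_congr fun s => ?_
          by_cases hs : s < x
          · simp only [tail, Measure.smul_apply, measurableSet_Ioi, Measure.dirac_apply',
              smul_eq_mul]
            rw [indicator_of_mem (show x ∈ Ioi s from hs),
              indicator_of_mem (show s ∈ Iio x from hs),
              Pi.one_apply, mul_one, ENNReal.inv_rpow, powWeight_rpow hp]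
          · simp [tail, hs, hp]
      _ = (ENNReal.ofReal x)⁻¹ * volume (Iio x ∩ Ioi 0) := by
          rw [lintegral_indicator_const measurableSet_Iio, Measure.restrict_apply measurableSet_Iio]
      _ = (ENNReal.ofReal x)⁻¹ * ENNReal.ofReal x := by
          rw [Iio_inter_Ioi, Real.volume_Ioo, sub_zero]
      _ ≤ _ := by
          rw [ENNReal.inv_mul_cancel (by simpa using hx0) ENNReal.ofReal_ne_top]; simp

end supGauge

/-- For `p ≤ 1` a non-increasing function in `L^p` lies in the Lorentz space `L^{p,1}`; after a
dilation by two. -/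
lemma lintegral_mul_powWeight_div_le {p : ℝ} (hp : 0 < p) (hp1 : p ≤ 1) {k : ℝ → ℝ≥0∞}
    (hk : Antitone k) (d : ℝ) :
    ∫⁻ z in Ioo 0 (2 * d), k (z / 2) * (powWeight p z / ENNReal.ofReal z)
      ≤ powWeight p 2 * lpNormOn p k d := by
  set N := powWeight p 2 * lpNormOn p k d with hN
  have hNp : N ^ p = 2 * ∫⁻ w in Ioo 0 d, k w ^ p := by
    rw [hN, ENNReal.mul_rpow_of_nonneg _ _ hp.le, powWeight_rpow hp, lpNormOn, ← ENNReal.rpow_mul,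
      one_div_mul_cancel hp.ne', ENNReal.rpow_one]
    simp
  have hp1' : 0 ≤ 1 - p := sub_nonneg.2 hp1
  have hpt : ∀ z ∈ Ioo 0 (2 * d),
      k (z / 2) * (powWeight p z / ENNReal.ofReal z) ≤ k (z / 2) ^ p * N ^ (1 - p) := by
    intro z hz
    have hz0 : ENNReal.ofReal z ≠ 0 := by simpa using hz.1
    have h1 : k (z / 2) * powWeight p z ≤ N := by
      calc k (z / 2) * powWeight p z = powWeight p 2 * (k (z / 2) * powWeight p (z / 2)) := by
            rw [mul_left_comm, ← powWeight_mul hp two_pos.le, mul_div_cancel₀ _ two_ne_zero]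
        _ ≤ powWeight p 2 * lpNormOn p k (z / 2) := by
            gcongr
            exact mul_powWeight_le_lpNormOn hp hk
        _ ≤ N := by
            rw [hN]
            unfold lpNormOn
            gcongr 2
            exact lintegral_mono_set (Ioo_subset_Ioo_right (by linarith [hz.2]))
    calc k (z / 2) * (powWeight p z / ENNReal.ofReal z)
        = (k (z / 2) * powWeight p z) ^ (p + (1 - p)) * (ENNReal.ofReal z)⁻¹ := by
          rw [add_sub_cancel, ENNReal.rpow_one, ← div_eq_mul_inv, mul_div_assoc]
      _ = (k (z / 2) * powWeight p z) ^ p * (k (z / 2) * powWeight p z) ^ (1 - p) *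
            (ENNReal.ofReal z)⁻¹ := by
          rw [ENNReal.rpow_add_of_nonneg _ _ hp.le (by linarith)]
      _ ≤ (k (z / 2) * powWeight p z) ^ p * N ^ (1 - p) * (ENNReal.ofReal z)⁻¹ := by
          gcongr
      _ = k (z / 2) ^ p * N ^ (1 - p) * (ENNReal.ofReal z * (ENNReal.ofReal z)⁻¹) := by
          rw [ENNReal.mul_rpow_of_nonneg _ _ hp.le, powWeight_rpow hp]; ring
      _ = _ := by rw [ENNReal.mul_inv_cancel hz0 ENNReal.ofReal_ne_top, mul_one]
  calc ∫⁻ z in Ioo 0 (2 * d), k (z / 2) * (powWeight p z / ENNReal.ofReal z)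
      ≤ ∫⁻ z in Ioo 0 (2 * d), k (z / 2) ^ p * N ^ (1 - p) :=
        setLIntegral_mono' measurableSet_Ioo hpt
    _ = (∫⁻ z in Ioo 0 (2 * d), k (z / 2) ^ p) * N ^ (1 - p) := by
        refine lintegral_mul_const _ ?_
        exact ((hk.measurable.comp (measurable_id.div_const 2)).pow_const _)
    _ = N ^ p * N ^ (1 - p) := by
        rw [setLIntegral_Ioo_half (fun w => k w ^ p), hNp]
    _ = N := by
        rw [← ENNReal.rpow_add_of_nonneg _ _ hp.le (by linarith), add_sub_cancel, ENNReal.rpow_one]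
    _ ≤ _ := le_rfl

/-- On a short interval `k` is integrated against `κ` by at most `supGauge` times its `L^p` norm. -/
lemma lintegral_Ioc_le_supGauge {p : ℝ} (hp : 0 < p) (hp1 : p ≤ 1) {κ : Measure ℝ} [SFinite κ]
    {k : ℝ → ℝ≥0∞} (hk : Antitone k) {c d : ℝ} (hc : 0 < c) :
    ∫⁻ s in Ioc c d, k s ∂κ ≤
      2 * powWeight p 2 * (supGauge p (fun z => κ (Ioc 0 z)) c * lpNormOn p k d) := by
  set G := supGauge p (fun z => κ (Ioc 0 z)) c with hG
  calc ∫⁻ s in Ioc c d, k s ∂κ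
      ≤ 2 * ∫⁻ z in Ioo c (2 * d), k (z / 2) * (κ (Ioc 0 z) / ENNReal.ofReal z) :=
        lintegral_antitone_le hk hc
    _ ≤ 2 * ∫⁻ z in Ioo c (2 * d), G * (k (z / 2) * (powWeight p z / ENNReal.ofReal z)) := by
        gcongr 1
        refine setLIntegral_mono' measurableSet_Ioo fun z hz => ?_
        calc k (z / 2) * (κ (Ioc 0 z) / ENNReal.ofReal z)
            ≤ k (z / 2) * (powWeight p z * G / ENNReal.ofReal z) := by
              gcongr
              exact le_powWeight_mul_supGauge hp (Φ := fun z => κ (Ioc 0 z)) hc.le hz.1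
          _ = _ := by simp only [div_eq_mul_inv]; ring
    _ ≤ 2 * ∫⁻ z in Ioo 0 (2 * d), G * (k (z / 2) * (powWeight p z / ENNReal.ofReal z)) := by
        gcongr 1
        exact lintegral_mono_set (Ioo_subset_Ioo_left hc.le)
    _ = 2 * (G * ∫⁻ z in Ioo 0 (2 * d), k (z / 2) * (powWeight p z / ENNReal.ofReal z)) := by
        rw [lintegral_const_mul]
        exact (hk.measurable.comp (measurable_id.div_const 2)).mul
          (continuous_powWeight.measurable.div ENNReal.measurable_ofReal)
    _ ≤ 2 * (G * (powWeight p 2 * lpNormOn p k d)) := by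
        gcongr
        exact lintegral_mul_powWeight_div_le hp hp1 hk d
    _ = _ := by ring

section intGauge
variable {p : ℝ} {Φ : ℝ → ℝ≥0∞}

/-- Dilation invariance: the product of `intGauge` with the weight is an average of dilations of
`Φ`. -/
lemma powWeight_mul_intGauge (hp : 1 < p) (hΦ : Measurable Φ) {z : ℝ} (hz : 0 < z) :
    powWeight p z * intGauge p Φ z =
      (∫⁻ w in Ioi 1, (Φ (z * w) / ENNReal.ofReal w) ^ p.conjExponent) ^ (1 / p.conjExponent) := by
  have hpq := Real.HolderConjugate.conjExponent hp
  set q := p.conjExponent with hq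
  have hq0 : 0 < q := hpq.symm.pos
  have hp0 : 0 < p := by linarith
  have hz0 : ENNReal.ofReal z ≠ 0 := by simpa using hz
  have h1 : powWeight p z = (ENNReal.ofReal z ^ (q - 1)) ^ (1 / q) := by
    rw [powWeight, ← ENNReal.rpow_mul]
    congr 1
    have := hpq.inv_add_inv_eq_one
    rw [mul_one_div, sub_div, div_self hq0.ne', one_div, one_div]; linarith
  rw [h1, intGauge, ← ENNReal.mul_rpow_of_nonneg _ _ (by positivity)]
  congr 1
  have h2 := setLIntegral_Ioi_dilation hz (fun x => (Φ x / ENNReal.ofReal x) ^ q) 1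
  rw [mul_one] at h2
  have hm : Measurable fun w => (Φ (z * w) / ENNReal.ofReal w) ^ q :=
    ((hΦ.comp (measurable_const_mul z)).div ENNReal.measurable_ofReal).pow_const _
  have h3 : ∫⁻ w in Ioi 1, (Φ (z * w) / ENNReal.ofReal (z * w)) ^ q =
      ENNReal.ofReal z ^ (-q) * ∫⁻ w in Ioi 1, (Φ (z * w) / ENNReal.ofReal w) ^ q := by
    rw [← lintegral_const_mul _ hm]
    refine lintegral_congr fun w => ?_
    rw [ENNReal.rpow_neg, ← ENNReal.inv_rpow, ← ENNReal.mul_rpow_of_nonneg _ _ hq0.le,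
      ENNReal.ofReal_mul hz.le, div_eq_mul_inv, ENNReal.mul_inv (Or.inl hz0)
      (Or.inl ENNReal.ofReal_ne_top), div_eq_mul_inv]
    ring_nf
  calc ENNReal.ofReal z ^ (q - 1) * ∫⁻ x in Ioi z, (Φ x / ENNReal.ofReal x) ^ q
      = ENNReal.ofReal z ^ (q - 1) * (ENNReal.ofReal z ^ (1 : ℝ) * (ENNReal.ofReal z ^ (-q) *
          ∫⁻ w in Ioi 1, (Φ (z * w) / ENNReal.ofReal w) ^ q)) := by
        rw [h2, h3, ENNReal.rpow_one]
    _ = (ENNReal.ofReal z ^ (q - 1) * ENNReal.ofReal z ^ (1 : ℝ) * ENNReal.ofReal z ^ (-q)) *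
          ∫⁻ w in Ioi 1, (Φ (z * w) / ENNReal.ofReal w) ^ q := by ring
    _ = _ := by
        rw [← ENNReal.rpow_add _ _ hz0 ENNReal.ofReal_ne_top,
          ← ENNReal.rpow_add _ _ hz0 ENNReal.ofReal_ne_top]
        simp

lemma intGauge_antitone (hp : 1 < p) : Antitone (intGauge p Φ) := fun x y hxy => by
  have hq0 : 0 < p.conjExponent := (Real.HolderConjugate.conjExponent hp).symm.pos
  unfold intGauge
  gcongr 1
  exact lintegral_mono_set (Ioi_subset_Ioi hxy)

lemma isGauge_intGauge (hp : 1 < p) (hΦ : Monotone Φ) : IsGauge p (intGauge p Φ) where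
  antitoneOn := (intGauge_antitone hp).antitoneOn _
  monotoneOn x hx y hy hxy := by
    have hq0 : 0 < p.conjExponent := (Real.HolderConjugate.conjExponent hp).symm.pos
    simp only
    rw [powWeight_mul_intGauge hp hΦ.measurable hx, powWeight_mul_intGauge hp hΦ.measurable hy]
    gcongr 1
    refine setLIntegral_mono' measurableSet_Ioi fun w hw => ?_
    gcongr
    exact hΦ (mul_le_mul_of_nonneg_right hxy (zero_le_one.trans (mem_Ioi.1 hw).le))

lemma le_intGauge (hp : 1 < p) (hΦ : Monotone Φ) {z : ℝ} (hz : 0 < z) :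
    Φ z ≤ 2 * (powWeight p z * intGauge p Φ z) := by
  have hq0 : 0 < p.conjExponent := (Real.HolderConjugate.conjExponent hp).symm.pos
  rw [powWeight_mul_intGauge hp hΦ.measurable hz]
  set q := p.conjExponent with hq
  calc Φ z = 2 * ((Φ z / 2) ^ q) ^ (1 / q) := by
        rw [← ENNReal.rpow_mul, mul_one_div_cancel hq0.ne', ENNReal.rpow_one,
          ENNReal.mul_div_cancel (by simp) (by simp)]
    _ = 2 * (∫⁻ _ in Ioc (1 : ℝ) 2, (Φ z / 2) ^ q) ^ (1 / q) := by
        rw [setLIntegral_const, Real.volume_Ioc]; norm_num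
    _ ≤ 2 * (∫⁻ w in Ioc 1 2, (Φ (z * w) / ENNReal.ofReal w) ^ q) ^ (1 / q) := by
        gcongr 2
        refine setLIntegral_mono' measurableSet_Ioc fun w hw => ?_
        gcongr
        · exact hΦ (by nlinarith [hw.1])
        · rw [← ENNReal.ofReal_ofNat]
          exact ENNReal.ofReal_le_ofReal hw.2
    _ ≤ _ := by
        gcongr 2
        exact lintegral_mono_set Ioc_subset_Ioi_self

lemma intGauge_zero_le (hp : 1 < p) :
    intGauge p Φ 0 ≤ ⨆ a ∈ Ioi (0 : ℝ), intGauge p Φ a := by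
  have hq0 : 0 < p.conjExponent := (Real.HolderConjugate.conjExponent hp).symm.pos
  set S := ⨆ a ∈ Ioi (0 : ℝ), intGauge p Φ a with hS
  rw [intGauge, one_div, ENNReal.rpow_inv_le_iff hq0, ← withDensity_apply _ measurableSet_Ioi]
  refine measure_Ioi_zero_le fun a b ha _ => ?_
  rw [withDensity_apply _ measurableSet_Ioc, ← ENNReal.rpow_inv_le_iff hq0, ← one_div]
  refine le_trans ?_ (le_iSup₂ (f := fun a (_ : a ∈ Ioi (0 : ℝ)) => intGauge p Φ a) a ha)
  unfold intGauge
  gcongr 1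
  exact lintegral_mono_set Ioc_subset_Ioi_self

lemma lintegral_Ioc_le_intGauge (hp : 1 < p) {κ : Measure ℝ} [SFinite κ]
    {k : ℝ → ℝ≥0∞} (hk : Antitone k) {c d : ℝ} (hc : 0 < c) :
    ∫⁻ s in Ioc c d, k s ∂κ ≤
      2 * powWeight p 2 * (intGauge p (fun z => κ (Ioc 0 z)) c * lpNormOn p k d) := by
  have hpq := Real.HolderConjugate.conjExponent hp
  have hq0 : 0 < p.conjExponent := hpq.symm.pos
  have hp0 : 0 < p := by linarith
  have hκ : Monotone fun z => κ (Ioc 0 z) := fun _ _ h => measure_mono (Ioc_subset_Ioc_right h)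
  calc ∫⁻ s in Ioc c d, k s ∂κ
      ≤ 2 * ∫⁻ z in Ioo c (2 * d), k (z / 2) * (κ (Ioc 0 z) / ENNReal.ofReal z) :=
        lintegral_antitone_le hk hc
    _ ≤ 2 * ((∫⁻ z in Ioo c (2 * d), k (z / 2) ^ p) ^ (1 / p) *
          (∫⁻ z in Ioo c (2 * d), (κ (Ioc 0 z) / ENNReal.ofReal z) ^ p.conjExponent)
            ^ (1 / p.conjExponent)) := by
        gcongr 1
        exact ENNReal.lintegral_mul_le_Lp_mul_Lq _ hpq
          (hk.measurable.comp (measurable_id.div_const 2)).aemeasurable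
          (hκ.measurable.div ENNReal.measurable_ofReal).aemeasurable
    _ ≤ 2 * ((∫⁻ z in Ioo 0 (2 * d), k (z / 2) ^ p) ^ (1 / p) *
          intGauge p (fun z => κ (Ioc 0 z)) c) := by
        unfold intGauge
        gcongr 3
        · exact lintegral_mono_set (Ioo_subset_Ioo_left hc.le)
        · exact lintegral_mono_set Ioo_subset_Ioi_self
    _ = 2 * (powWeight p 2 * lpNormOn p k d * intGauge p (fun z => κ (Ioc 0 z)) c) := by
        rw [setLIntegral_Ioo_half (fun w => k w ^ p),
          ENNReal.mul_rpow_of_nonneg _ _ (by positivity), powWeight, ENNReal.ofReal_ofNat, lpNormOn]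
    _ = _ := by ring

end intGauge

/-- The extremal measure for `intGauge` at `t` is given by the equality case of Hölder's
inequality; the dual Hardy inequality bounds the `L^p` norm of its tail. -/
lemma exists_test_intGauge {p : ℝ} (hp : 1 < p) : ∃ C : ℝ≥0, ∀ Φ : ℝ → ℝ≥0∞, Measurable Φ →
    ∀ t, 0 < t → intGauge p Φ t ≠ ∞ →
    ∃ μ : Measure ℝ, SFinite μ ∧ μ (Iic t) = 0 ∧ intGauge p Φ t ≤ 2 * ∫⁻ x, Φ x ∂μ ∧
      ∫⁻ x in Ioi 0, tail μ x ^ p ≤ C := by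
  obtain ⟨C, hC⟩ := exists_dual_hardy hp
  refine ⟨C, fun Φ hΦ t ht hfin => ?_⟩
  have hpq := Real.HolderConjugate.conjExponent hp
  have hp0 : 0 < p := by linarith
  by_cases h0 : intGauge p Φ t = 0
  · refine ⟨0, inferInstance, by simp, by simp [h0], ?_⟩
    simp [tail, hp0]
  set G := intGauge p Φ t with hG
  set q := p.conjExponent with hq
  have hq0 : 0 < q := hpq.symm.pos
  have hq1 : 0 < q - 1 := by have := hpq.symm.lt; linarith
  have hGq : ∫⁻ x in Ioi t, (Φ x / ENNReal.ofReal x) ^ q = G ^ q := by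
    rw [hG, intGauge, ← ENNReal.rpow_mul, one_div_mul_cancel hq0.ne', ENNReal.rpow_one]
  set b : ℝ → ℝ≥0∞ := (Ioi t).indicator fun x => (Φ x / ENNReal.ofReal x / G) ^ (q - 1) with hb
  have hm : Measurable fun x => Φ x / ENNReal.ofReal x := hΦ.div ENNReal.measurable_ofReal
  have hbm : Measurable b := ((hm.div_const G).pow_const _).indicator measurableSet_Ioi
  have hbm' : Measurable fun x => b x / ENNReal.ofReal x := hbm.div ENNReal.measurable_ofReal
  have hnorm : ∀ x, (Φ x / ENNReal.ofReal x / G) ^ q = (Φ x / ENNReal.ofReal x) ^ q * (G ^ q)⁻¹ :=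
    fun x => by
      rw [div_eq_mul_inv _ G, ENNReal.mul_rpow_of_nonneg _ _ hq0.le, ENNReal.inv_rpow]
  have hGq0 : G ^ q ≠ 0 := by simp [ENNReal.rpow_eq_zero_iff, h0, hfin]
  have hGqt : G ^ q ≠ ∞ := ENNReal.rpow_ne_top_of_nonneg hq0.le hfin
  have hint1 : ∫⁻ x in Ioi t, (Φ x / ENNReal.ofReal x / G) ^ q = 1 := by
    simp only [hnorm]
    rw [lintegral_mul_const _ (hm.pow_const _), hGq, ENNReal.mul_inv_cancel hGq0 hGqt]
  refine ⟨volume.withDensity fun x => b x / ENNReal.ofReal x, inferInstance, ?_, ?_, ?_⟩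
  · rw [withDensity_apply _ measurableSet_Iic,
      setLIntegral_congr_fun measurableSet_Iic (g := fun _ => 0) (fun x hx => by
        have : x ∉ Ioi t := notMem_Ioi.2 hx
        simp [hb, indicator_of_notMem this])]
    simp
  · calc G = G * ∫⁻ x in Ioi t, (Φ x / ENNReal.ofReal x / G) ^ q := by rw [hint1, mul_one]
      _ = ∫⁻ x in Ioi t, G * (Φ x / ENNReal.ofReal x / G) ^ q :=
          (lintegral_const_mul _ ((hm.div_const G).pow_const _)).symm
      _ = ∫⁻ x in Ioi t, b x / ENNReal.ofReal x * Φ x := by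
          refine setLIntegral_congr_fun measurableSet_Ioi fun x hx => ?_
          simp only [hb]
          rw [indicator_of_mem hx]
          calc G * (Φ x / ENNReal.ofReal x / G) ^ q
              = G * (Φ x / ENNReal.ofReal x / G) ^ ((q - 1) + 1) := by rw [sub_add_cancel]
            _ = G * ((Φ x / ENNReal.ofReal x / G) ^ (q - 1) * (Φ x / ENNReal.ofReal x / G)) := by
                rw [ENNReal.rpow_add_of_nonneg _ _ hq1.le zero_le_one, ENNReal.rpow_one]
            _ = (Φ x / ENNReal.ofReal x / G) ^ (q - 1) * (G * (Φ x / ENNReal.ofReal x / G)) := by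
                ring
            _ = (Φ x / ENNReal.ofReal x / G) ^ (q - 1) * (Φ x / ENNReal.ofReal x) := by
                rw [ENNReal.mul_div_cancel h0 hfin]
            _ = _ := by simp only [div_eq_mul_inv]; ring
      _ ≤ ∫⁻ x, b x / ENNReal.ofReal x * Φ x := setLIntegral_le_lintegral _ _
      _ = ∫⁻ x, Φ x ∂(volume.withDensity fun x => b x / ENNReal.ofReal x) := by
          rw [lintegral_withDensity_eq_lintegral_mul _ hbm' hΦ]; rfl
      _ ≤ _ := by rw [two_mul]; exact le_self_add
  · calc ∫⁻ x in Ioi 0, tail (volume.withDensity fun x => b x / ENNReal.ofReal x) x ^ p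
        = ∫⁻ x in Ioi (0 : ℝ), (∫⁻ z in Ioi x, b z / ENNReal.ofReal z) ^ p := by
          simp only [tail, withDensity_apply _ measurableSet_Ioi]
      _ ≤ C * ∫⁻ z in Ioi (0 : ℝ), b z ^ p := hC b hbm
      _ ≤ C * ∫⁻ z, (Ioi t).indicator (fun x => (Φ x / ENNReal.ofReal x / G) ^ q) z := by
          gcongr 1
          refine (setLIntegral_le_lintegral _ _).trans (lintegral_mono fun z => ?_)
          by_cases hz : z ∈ Ioi t
          · simp only [hb, indicator_of_mem hz]
            rw [← ENNReal.rpow_mul, hpq.symm.sub_one_mul_conj]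
          · simp [hb, indicator_of_notMem hz, hp0]
      _ = C := by rw [lintegral_indicator measurableSet_Ioi, hint1, mul_one]

/-! ### Layer cakes and the decreasing rearrangement -/

lemma volume_Ioi_inter_lt (D : ℝ≥0∞) : volume {t : ℝ | t ∈ Ioi 0 ∧ ENNReal.ofReal t < D} = D := by
  rcases eq_or_ne D ∞ with rfl | hD
  · have : {t : ℝ | t ∈ Ioi 0 ∧ ENNReal.ofReal t < ∞} = Ioi 0 := by ext; simp
    rw [this, Real.volume_Ioi]
  · have : {t : ℝ | t ∈ Ioi 0 ∧ ENNReal.ofReal t < D} = Ioo 0 D.toReal := by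
      ext t
      simp only [mem_ofPred_eq, mem_Ioi, mem_Ioo]
      refine and_congr_right fun ht => ?_
      rw [ENNReal.ofReal_lt_iff_lt_toReal ht.le hD]
    rw [this, Real.volume_Ioo, sub_zero, ENNReal.ofReal_toReal hD]

lemma volume_Ioo_inter_lt (s : ℝ) (D : ℝ≥0∞) :
    volume {t : ℝ | t ∈ Ioo 0 s ∧ ENNReal.ofReal t < D} = min (ENNReal.ofReal s) D := by
  rw [← volume_Ioi_inter_lt (min (ENNReal.ofReal s) D)]
  congr 1
  ext t
  simp only [mem_ofPred_eq, mem_Ioo, mem_Ioi, lt_min_iff]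
  constructor
  · rintro ⟨⟨h0, hs⟩, hD⟩
    exact ⟨h0, (ENNReal.ofReal_lt_ofReal_iff (h0.trans hs)).2 hs, hD⟩
  · rintro ⟨h0, hs, hD⟩
    exact ⟨⟨h0, (ENNReal.ofReal_lt_ofReal_iff_of_nonneg h0.le).1 hs⟩, hD⟩

lemma lintegral_indicator_lt (a : ℝ≥0∞) :
    ∫⁻ l in Ioi (0 : ℝ), {l : ℝ | ENNReal.ofReal l < a}.indicator 1 l = a := by
  have hm : MeasurableSet {l : ℝ | ENNReal.ofReal l < a} :=
    measurableSet_lt ENNReal.measurable_ofReal measurable_const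
  rw [lintegral_indicator_one hm, Measure.restrict_apply hm]
  conv_rhs => rw [← volume_Ioi_inter_lt a]
  congr 1
  ext t; exact and_comm

/-- Right continuity of the distribution function. -/
lemma exists_gt_lt_measure {α : Type*} [MeasurableSpace α] {μ : Measure α} (w : α → ℝ≥0∞)
    {l D : ℝ≥0∞} (h : D < μ {x | l < w x}) :
    ∃ l', l < l' ∧ D < μ {x | l' < w x} := by
  have hl : l ≠ ∞ := by
    rintro rfl
    simp at h
  obtain ⟨u, hu, hul, hut⟩ := exists_seq_strictAnti_tendsto' (lt_top_iff_ne_top.2 hl)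
  have hU : {x | l < w x} = ⋃ n, {x | u n < w x} := by
    ext x
    simp only [mem_ofPred_eq, mem_iUnion]
    constructor
    · intro hx
      exact ((tendsto_order.1 hut).2 _ hx).exists
    · rintro ⟨n, hn⟩
      exact (hul n).1.trans hn
  have hmono : Monotone fun n => {x | u n < w x} := fun i j hij x hx =>
    (hu.antitone hij).trans_lt hx
  rw [hU, hmono.measure_iUnion, lt_iSup_iff] at h
  obtain ⟨n, hn⟩ := h
  exact ⟨u n, (hul n).1, hn⟩

section LayerCake
variable {α : Type*} [MeasurableSpace α] {μ : Measure α} [SFinite μ]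

lemma lintegral_eq_lintegral_measure_lt {a : α → ℝ≥0∞} (ha : Measurable a) :
    ∫⁻ x, a x ∂μ = ∫⁻ l in Ioi (0 : ℝ), μ {x | ENNReal.ofReal l < a x} := by
  calc ∫⁻ x, a x ∂μ = ∫⁻ x, (∫⁻ l in Ioi (0 : ℝ),
        {w : α × ℝ | ENNReal.ofReal w.2 < a w.1}.indicator 1 (x, l)) ∂μ := by
        refine lintegral_congr fun x => ?_
        conv_lhs => rw [← lintegral_indicator_lt (a x)]
        rfl
    _ = ∫⁻ l in Ioi (0 : ℝ), ∫⁻ x,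
        {w : α × ℝ | ENNReal.ofReal w.2 < a w.1}.indicator 1 (x, l) ∂μ := by
        refine lintegral_lintegral_swap (Measurable.aemeasurable ?_)
        exact measurable_one.indicator (measurableSet_lt
          (ENNReal.measurable_ofReal.comp measurable_snd) (ha.comp measurable_fst))
    _ = _ := by
        refine lintegral_congr fun l => ?_
        rw [← lintegral_indicator_one (measurableSet_lt measurable_const ha)]
        rfl

lemma lintegral_mul_eq_lintegral_measure_lt {a b : α → ℝ≥0∞} (ha : Measurable a)
    (hb : Measurable b) :
    ∫⁻ x, a x * b x ∂μ = ∫⁻ l in Ioi (0 : ℝ), ∫⁻ m in Ioi (0 : ℝ),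
      μ {x | ENNReal.ofReal l < a x ∧ ENNReal.ofReal m < b x} := by
  calc ∫⁻ x, a x * b x ∂μ = ∫⁻ x, b x ∂(μ.withDensity a) := by
        rw [lintegral_withDensity_eq_lintegral_mul _ ha hb]; rfl
    _ = ∫⁻ m in Ioi (0 : ℝ), (μ.withDensity a) {x | ENNReal.ofReal m < b x} :=
        lintegral_eq_lintegral_measure_lt hb
    _ = ∫⁻ m in Ioi (0 : ℝ), ∫⁻ l in Ioi (0 : ℝ),
          μ {x | ENNReal.ofReal l < a x ∧ ENNReal.ofReal m < b x} := by
        refine lintegral_congr fun m => ?_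
        have hm : MeasurableSet {x | ENNReal.ofReal m < b x} := measurableSet_lt measurable_const hb
        rw [withDensity_apply _ hm, lintegral_eq_lintegral_measure_lt ha]
        refine lintegral_congr fun l => ?_
        rw [Measure.restrict_apply (measurableSet_lt measurable_const ha)]
        rfl
    _ = _ := by
        rw [lintegral_lintegral_swap]
        refine Measurable.aemeasurable ?_
        exact measurable_measure_prodMk_left (ν := μ)
          (s := {w : (ℝ × ℝ) × α | ENNReal.ofReal w.1.2 < a w.2 ∧ ENNReal.ofReal w.1.1 < b w.2})
          ((measurableSet_lt (ENNReal.measurable_ofReal.comp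
              (measurable_snd.comp measurable_fst)) (ha.comp measurable_snd)).inter
            (measurableSet_lt (ENNReal.measurable_ofReal.comp
              (measurable_fst.comp measurable_fst)) (hb.comp measurable_snd)))

end LayerCake

section Rearrangement
variable {n : ℕ}

/-- `∫_0^s w*`, expressed through the distribution function of `w`. -/
noncomputable def rearrangedMass (w : EuclideanSpace ℝ (Fin n) → ℝ≥0∞) (s : ℝ) : ℝ≥0∞ :=
  ∫⁻ l in Ioi (0 : ℝ), min (ENNReal.ofReal s) (volume {x | ENNReal.ofReal l < w x})

lemma rearrangedMass_mono (w : EuclideanSpace ℝ (Fin n) → ℝ≥0∞) : Monotone (rearrangedMass w) :=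
  fun _ _ h => lintegral_mono fun _ => min_le_min_right _ (ENNReal.ofReal_le_ofReal h)

lemma rearrangedMass_le_of_le {w w' : EuclideanSpace ℝ (Fin n) → ℝ≥0∞} (h : ∀ x, w x ≤ w' x)
    (s : ℝ) : rearrangedMass w s ≤ rearrangedMass w' s :=
  lintegral_mono fun _ => min_le_min_left _ (measure_mono fun x hx => lt_of_lt_of_le hx (h x))

lemma rearrangedMass_congr_ae {w w' : EuclideanSpace ℝ (Fin n) → ℝ≥0∞} (h : w =ᵐ[volume] w')
    (s : ℝ) : rearrangedMass w s = rearrangedMass w' s := by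
  refine lintegral_congr fun l => ?_
  congr 1
  refine measure_congr ?_
  filter_upwards [h] with x hx
  exact propext (by show _ < _ ↔ _ < _; rw [hx])

lemma rearrangedMass_le_lintegral {w : EuclideanSpace ℝ (Fin n) → ℝ≥0∞} (hw : Measurable w)
    (s : ℝ) : rearrangedMass w s ≤ ∫⁻ x, w x := by
  rw [lintegral_eq_lintegral_measure_lt hw]
  exact lintegral_mono fun _ => min_le_right _ _

lemma lt_rearrangement_iff (f : EuclideanSpace ℝ (Fin n) → EReal) (l : ℝ≥0∞) (t : ℝ) :
    l < rearrangement f t ↔ ENNReal.ofReal t < distribution f l := by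
  constructor
  · intro h
    by_contra hcon
    rw [not_lt] at hcon
    refine absurd h (not_lt.2 (le_of_forall_gt_imp_ge_of_dense fun m hm => ?_))
    refine sInf_le ⟨bot_le.trans_lt hm, le_trans (measure_mono fun x hx => ?_) hcon⟩
    exact lt_trans hm hx
  · intro h
    obtain ⟨l', hl', h'⟩ := exists_gt_lt_measure _ h
    refine hl'.trans_le (le_sInf fun m hm => ?_)
    by_contra hcon
    rw [not_le] at hcon
    refine absurd (h'.trans_le (le_trans (measure_mono fun x hx => ?_) hm.2)) (lt_irrefl _)
    exact lt_trans hcon hx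

lemma rearrangement_antitone (f : EuclideanSpace ℝ (Fin n) → EReal) :
    Antitone (rearrangement f) := fun _ _ h =>
  sInf_le_sInf fun _ hm => ⟨hm.1, hm.2.trans (ENNReal.ofReal_le_ofReal h)⟩

lemma lintegral_rearrangement (f : EuclideanSpace ℝ (Fin n) → EReal) (s : ℝ) :
    ∫⁻ t in Ioo 0 s, rearrangement f t = rearrangedMass (fun x => (f x).abs) s := by
  have hm := (rearrangement_antitone f).measurable
  rw [lintegral_eq_lintegral_measure_lt hm]
  refine lintegral_congr fun l => ?_
  rw [Measure.restrict_apply (measurableSet_lt measurable_const hm), ← volume_Ioo_inter_lt]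
  congr 1
  ext t
  simp only [mem_inter_iff, mem_ofPred_eq, lt_rearrangement_iff, distribution]
  exact and_comm

/-- The Hardy–Littlewood inequality. -/
lemma lintegral_abs_mul_abs_le {f g : EuclideanSpace ℝ (Fin n) → EReal}
    (hf : AEMeasurable (fun x => (f x).abs)) (hg : AEMeasurable (fun x => (g x).abs)) :
    ∫⁻ x, (f x).abs * (g x).abs ≤ ∫⁻ t in Ioi 0, rearrangement f t * rearrangement g t := by
  have hdist : ∀ {f : EuclideanSpace ℝ (Fin n) → EReal} (hf : AEMeasurable (fun x => (f x).abs))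
      (l : ℝ≥0∞), volume {x | l < hf.mk _ x} = distribution f l := by
    intro f hf l
    refine measure_congr ?_
    filter_upwards [hf.ae_eq_mk] with x hx
    exact propext (by show _ < _ ↔ _ < _; rw [hx])
  calc ∫⁻ x, (f x).abs * (g x).abs = ∫⁻ x, hf.mk _ x * hg.mk _ x := by
        refine lintegral_congr_ae ?_
        filter_upwards [hf.ae_eq_mk, hg.ae_eq_mk] with x h1 h2
        rw [h1, h2]
    _ = ∫⁻ l in Ioi (0 : ℝ), ∫⁻ m in Ioi (0 : ℝ),
          volume {x | ENNReal.ofReal l < hf.mk _ x ∧ ENNReal.ofReal m < hg.mk _ x} :=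
        lintegral_mul_eq_lintegral_measure_lt hf.measurable_mk hg.measurable_mk
    _ ≤ ∫⁻ l in Ioi (0 : ℝ), ∫⁻ m in Ioi (0 : ℝ),
          (volume.restrict (Ioi (0 : ℝ))) {t | ENNReal.ofReal l < rearrangement f t ∧
            ENNReal.ofReal m < rearrangement g t} := by
        refine lintegral_mono fun l => lintegral_mono fun m => ?_
        have hms : MeasurableSet {t : ℝ | ENNReal.ofReal l < rearrangement f t ∧
            ENNReal.ofReal m < rearrangement g t} :=
          (measurableSet_lt measurable_const (rearrangement_antitone f).measurable).inter
            (measurableSet_lt measurable_const (rearrangement_antitone g).measurable)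
        rw [Measure.restrict_apply hms]
        calc volume {x | ENNReal.ofReal l < hf.mk _ x ∧ ENNReal.ofReal m < hg.mk _ x}
            ≤ min (distribution f (ENNReal.ofReal l)) (distribution g (ENNReal.ofReal m)) := by
              rw [← hdist hf, ← hdist hg]
              exact le_min (measure_mono fun x hx => hx.1) (measure_mono fun x hx => hx.2)
          _ = volume {t : ℝ | t ∈ Ioi 0 ∧ ENNReal.ofReal t < min
                (distribution f (ENNReal.ofReal l)) (distribution g (ENNReal.ofReal m))} :=
              (volume_Ioi_inter_lt _).symm
          _ ≤ _ := by
              refine measure_mono fun t ht => ⟨?_, ht.1⟩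
              have := lt_min_iff.1 ht.2
              exact ⟨(lt_rearrangement_iff _ _ _).2 this.1, (lt_rearrangement_iff _ _ _).2 this.2⟩
    _ = _ := (lintegral_mul_eq_lintegral_measure_lt (rearrangement_antitone f).measurable
          (rearrangement_antitone g).measurable).symm

/-! ### Ranking the points of space by the size of a function -/

/-- A ranking for `w`: the sets `{τ < s}` have measure at most `s` and carry, up to the factor
two, the largest integral of `w` over sets of measure `s`. -/
structure IsRanking (w τ : EuclideanSpace ℝ (Fin n) → ℝ≥0∞) : Prop where
  measurable : Measurable τ
  volume_le : ∀ s : ℝ, 0 < s → volume {x | τ x < ENNReal.ofReal s} ≤ ENNReal.ofReal s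
  mass_le : ∀ s : ℝ, 0 < s →
    rearrangedMass w s ≤ 2 * ∫⁻ x in {x | τ x < ENNReal.ofReal s}, w x

/-- If no positive value of `w` is taken on a set of positive measure, the measure of the strict
superlevel set at `w x` is a ranking. -/
lemma exists_ranking_of_null_levels {w : EuclideanSpace ℝ (Fin n) → ℝ≥0∞} (hw : Measurable w)
    (hfin : ∀ x, w x ≠ ∞) (hsupp : volume {x | 0 < w x} ≠ ∞)
    (hnull : ∀ l : ℝ≥0∞, l ≠ 0 → l ≠ ∞ → volume {x | w x = l} = 0) :
    ∃ τ : EuclideanSpace ℝ (Fin n) → ℝ≥0∞, Measurable τ ∧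
      (∀ s : ℝ, 0 < s → volume {x | τ x < ENNReal.ofReal s} ≤ ENNReal.ofReal s) ∧
      ∀ s : ℝ, 0 < s → rearrangedMass w s ≤ ∫⁻ x in {x | τ x < ENNReal.ofReal s}, w x := by
  classical
  set d : ℝ≥0∞ → ℝ≥0∞ := fun l => volume {x | l < w x} with hd
  have hdanti : Antitone d := fun a b hab => measure_mono fun x hx => lt_of_le_of_lt hab hx
  -- points outside the support come last, so that the sets `{τ < s}` do not contain them
  set τ : EuclideanSpace ℝ (Fin n) → ℝ≥0∞ := fun x => if w x = 0 then ∞ else d (w x) with hτ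
  have hτm : Measurable τ :=
    Measurable.ite (hw (measurableSet_singleton 0)) measurable_const (hdanti.measurable.comp hw)
  -- the level at which the measure of the superlevel sets passes through `s`
  have key : ∀ s : ℝ, 0 < s → ∃ l₀ : ℝ≥0∞, d l₀ ≤ ENNReal.ofReal s ∧
      (∀ x, τ x < ENNReal.ofReal s → l₀ ≤ w x ∧ w x ≠ 0) ∧
      (∀ x, l₀ < w x → τ x < ENNReal.ofReal s) ∧
      ∀ l, 0 < l → ENNReal.ofReal s ≤ d l → l ≤ l₀ ∧ ENNReal.ofReal s ≤ d l₀ := by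
    intro s hs
    set S : Set ℝ≥0∞ := {l | d l < ENNReal.ofReal s} with hS
    have hlt : ∀ l, l < sInf S → ENNReal.ofReal s ≤ d l := fun l hl => by
      by_contra hcon
      exact absurd (sInf_le (show l ∈ S from not_le.1 hcon)) (not_le.2 hl)
    refine ⟨sInf S, ?_, ?_, ?_, ?_⟩
    · by_contra hcon
      obtain ⟨l', hl', h'⟩ := exists_gt_lt_measure (μ := volume) w (not_le.1 hcon)
      obtain ⟨l, hl, hll'⟩ := sInf_lt_iff.1 hl'
      exact absurd ((h'.trans_le (hdanti hll'.le)).trans hl) (lt_irrefl _)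
    · intro x hx
      by_cases h0 : w x = 0
      · simp [hτ, h0] at hx
      · simp only [hτ, h0, if_false] at hx
        exact ⟨sInf_le hx, h0⟩
    · intro x hx
      obtain ⟨l, hl, hlx⟩ := sInf_lt_iff.1 hx
      have h0 : w x ≠ 0 := (bot_le.trans_lt hx).ne'
      simp only [hτ, h0, if_false]
      exact (hdanti hlx.le).trans_lt hl
    · intro l hl0 hl
      have hle : l ≤ sInf S := le_sInf fun m hm => by
        by_contra hcon
        exact absurd ((hl.trans (hdanti (not_le.1 hcon).le)).trans_lt hm) (lt_irrefl _)
      refine ⟨hle, ?_⟩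
      set l₀ := sInf S with hl₀
      have hpos : 0 < l₀ := hl0.trans_le hle
      obtain ⟨u, hu, hul, hut⟩ := exists_seq_strictMono_tendsto' hpos
      have hI : {x | l₀ ≤ w x} = ⋂ n, {x | u n < w x} := by
        ext x
        simp only [mem_ofPred_eq, mem_iInter]
        constructor
        · intro hx n
          exact (hul n).2.trans_le hx
        · intro hx
          exact le_of_tendsto' hut fun n => (hx n).le
      have hmeas : ENNReal.ofReal s ≤ volume {x | l₀ ≤ w x} := by
        have hanti : Antitone fun n => {x | u n < w x} := fun i j hij x hx =>
          lt_of_le_of_lt (hu.monotone hij) hx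
        rw [hI, hanti.measure_iInter
          (fun n => (measurableSet_lt measurable_const hw).nullMeasurableSet)
          ⟨0, measure_ne_top_of_subset (t := {x | u 0 < w x})
            (fun x hx => lt_of_le_of_lt bot_le (show u 0 < w x from hx)) hsupp⟩]
        exact le_iInf fun n => hlt _ (hul n).2
      have hne : l₀ ≠ ∞ := by
        intro h
        have : {x | l₀ ≤ w x} = ∅ := by
          ext x; simp [h, hfin x]
        rw [this, measure_empty, nonpos_iff_eq_zero, ENNReal.ofReal_eq_zero] at hmeas
        linarith
      calc ENNReal.ofReal s ≤ volume {x | l₀ ≤ w x} := hmeas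
        _ ≤ volume ({x | l₀ < w x} ∪ {x | w x = l₀}) := measure_mono fun x hx =>
            (lt_or_eq_of_le (show l₀ ≤ w x from hx)).imp id Eq.symm
        _ ≤ volume {x | l₀ < w x} + volume {x | w x = l₀} := measure_union_le _ _
        _ = d l₀ := by rw [hnull l₀ hpos.ne' hne, add_zero]
  refine ⟨τ, hτm, fun s hs => ?_, fun s hs => ?_⟩
  · obtain ⟨l₀, h1, h2, -, -⟩ := key s hs
    rcases eq_or_ne l₀ 0 with rfl | hl0
    · exact (measure_mono fun x hx => bot_lt_iff_ne_bot.2 (h2 x hx).2).trans h1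
    rcases eq_or_ne l₀ ∞ with rfl | hlt
    · have : {x | τ x < ENNReal.ofReal s} = ∅ :=
        eq_empty_of_forall_notMem fun x hx => hfin x (top_le_iff.1 (h2 x hx).1)
      rw [this, measure_empty]
      exact bot_le
    calc volume {x | τ x < ENNReal.ofReal s} ≤ volume ({x | l₀ < w x} ∪ {x | w x = l₀}) :=
          measure_mono fun x hx => (lt_or_eq_of_le (h2 x hx).1).imp id Eq.symm
      _ ≤ volume {x | l₀ < w x} + volume {x | w x = l₀} := measure_union_le _ _
      _ = d l₀ := by rw [hnull l₀ hl0 hlt, add_zero]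
      _ ≤ _ := h1
  · obtain ⟨l₀, -, -, h3, h4⟩ := key s hs
    rw [lintegral_eq_lintegral_measure_lt hw, rearrangedMass]
    refine setLIntegral_mono' measurableSet_Ioi fun l hl => ?_
    have hl : 0 < ENNReal.ofReal l := ENNReal.ofReal_pos.2 hl
    rw [Measure.restrict_apply (measurableSet_lt measurable_const hw)]
    rcases lt_or_ge (d (ENNReal.ofReal l)) (ENNReal.ofReal s) with h | h
    · refine (min_le_right _ _).trans (measure_mono fun x hx => ⟨hx, ?_⟩)
      have h0 : w x ≠ 0 := (hl.trans hx).ne'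
      show τ x < _
      simp only [hτ, h0, if_false]
      exact (hdanti (le_of_lt hx)).trans_lt h
    · obtain ⟨h5, h6⟩ := h4 _ hl h
      refine (min_le_left _ _).trans (h6.trans (measure_mono fun x hx => ⟨?_, h3 x hx⟩))
      exact lt_of_le_of_lt h5 hx

/-- Finite functions with countably many values and a support of finite measure have rankings: a
multiplicative perturbation by a strictly radial factor between one and two makes all positive
levels null. -/
lemma exists_ranking (hn : 0 < n) {w : EuclideanSpace ℝ (Fin n) → ℝ≥0∞} (hw : Measurable w)
    (hcount : (range w).Countable) (hfin : ∀ x, w x ≠ ∞) (hsupp : volume {x | 0 < w x} ≠ ∞) :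
    ∃ τ, IsRanking w τ := by
  have : Nonempty (Fin n) := ⟨⟨0, hn⟩⟩
  have : Nontrivial (EuclideanSpace ℝ (Fin n)) := inferInstance
  set ρ : EuclideanSpace ℝ (Fin n) → ℝ := fun x => 1 + (1 + ‖x‖)⁻¹ with hρ
  have hρ1 : ∀ x, 1 ≤ ρ x := fun x => by
    have : 0 ≤ (1 + ‖x‖)⁻¹ := by positivity
    simp only [hρ]; linarith
  have hρ2 : ∀ x, ρ x ≤ 2 := fun x => by
    have : (1 + ‖x‖)⁻¹ ≤ 1 := inv_le_one_of_one_le₀ (by linarith [norm_nonneg x])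
    simp only [hρ]; linarith
  have hρinj : ∀ x y, ρ x = ρ y → ‖x‖ = ‖y‖ := fun x y h => by
    simp only [hρ, add_right_inj, inv_inj] at h
    exact h
  have hρm : Measurable ρ := (((measurable_norm).const_add 1).inv).const_add 1
  set w' : EuclideanSpace ℝ (Fin n) → ℝ≥0∞ := fun x => w x * ENNReal.ofReal (ρ x) with hw'
  have hww' : ∀ x, w x ≤ w' x := fun x => le_mul_of_one_le_right bot_le (by
    rw [← ENNReal.ofReal_one]; exact ENNReal.ofReal_le_ofReal (hρ1 x))
  have hw'w : ∀ x, w' x ≤ 2 * w x := fun x => by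
    simp only [hw']
    rw [mul_comm]
    gcongr
    rw [← ENNReal.ofReal_ofNat]; exact ENNReal.ofReal_le_ofReal (hρ2 x)
  have hnull : ∀ l : ℝ≥0∞, l ≠ 0 → l ≠ ∞ → volume {x | w' x = l} = 0 := by
    intro l hl0 _
    have hsub : {x | w' x = l} ⊆ ⋃ a ∈ range w, {x | w x = a ∧ w' x = l} := fun x hx => by
      simp only [mem_iUnion]
      exact ⟨w x, mem_range_self x, rfl, hx⟩
    refine measure_mono_null hsub ((measure_biUnion_null_iff hcount).2 fun a _ => ?_)
    rcases eq_empty_or_nonempty {x | w x = a ∧ w' x = l} with h | ⟨y, hy⟩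
    · rw [h, measure_empty]
    refine measure_mono_null (fun x hx => ?_) (Measure.addHaar_sphere volume 0 ‖y‖)
    rw [mem_sphere_zero_iff_norm]
    apply hρinj
    have ha0 : a ≠ 0 := by
      rintro rfl
      apply hl0
      rw [← hx.2]; simp [hw', hx.1]
    have hat : a ≠ ∞ := hx.1 ▸ hfin x
    have h1 : a * ENNReal.ofReal (ρ x) = a * ENNReal.ofReal (ρ y) := by
      have h2 := hx.2.trans hy.2.symm
      simp only [hw'] at h2
      rwa [hx.1, hy.1] at h2
    rw [ENNReal.mul_right_inj ha0 hat] at h1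
    have hx0 := zero_le_one.trans (hρ1 x)
    have hy0 := zero_le_one.trans (hρ1 y)
    exact (ENNReal.ofReal_eq_ofReal_iff hx0 hy0).1 h1
  have hsupp' : volume {x | 0 < w' x} ≠ ∞ := by
    refine ((measure_mono fun x hx => ?_).trans_lt (lt_top_iff_ne_top.2 hsupp)).ne
    by_contra h
    have h0 : w x = 0 := by simpa using h
    have hx : 0 < w' x := hx
    simp [hw', h0] at hx
  obtain ⟨τ, h1, h2, h3⟩ := exists_ranking_of_null_levels
    (hw.mul (ENNReal.measurable_ofReal.comp hρm))
    (fun x => ENNReal.mul_ne_top (hfin x) ENNReal.ofReal_ne_top) hsupp' hnull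
  refine ⟨τ, h1, h2, fun s hs => (rearrangedMass_le_of_le hww' s).trans ((h3 s hs).trans ?_)⟩
  rw [← lintegral_const_mul' _ _ (by simp)]
  exact lintegral_mono hw'w

/-- Exhaustion of a measurable function by bounded functions with rankings. -/
lemma exists_ranked_exhaustion (hn : 0 < n) {f : EuclideanSpace ℝ (Fin n) → ℝ≥0∞}
    (hf : Measurable f) : ∃ w : ℕ → EuclideanSpace ℝ (Fin n) → ℝ≥0∞, Monotone w ∧
      (∀ k, Measurable (w k)) ∧ (∀ k x, w k x ≤ f x) ∧
      (∀ s, rearrangedMass f s = ⨆ k, rearrangedMass (w k) s) ∧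
      (∀ k, ∃ M : ℝ≥0∞, M ≠ ∞ ∧ ∀ s, rearrangedMass (w k) s ≤ M) ∧ ∀ k, ∃ τ, IsRanking (w k) τ := by
  set w : ℕ → EuclideanSpace ℝ (Fin n) → ℝ≥0∞ := fun k =>
    (Metric.closedBall 0 (k : ℝ)).indicator (SimpleFunc.eapprox f k) with hw
  have hmono : Monotone w := by
    intro i j hij x
    have hb : Metric.closedBall (0 : EuclideanSpace ℝ (Fin n)) (i : ℝ) ⊆
        Metric.closedBall 0 (j : ℝ) := Metric.closedBall_subset_closedBall (by exact_mod_cast hij)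
    by_cases hx : x ∈ Metric.closedBall (0 : EuclideanSpace ℝ (Fin n)) (i : ℝ)
    · simp only [hw, indicator_of_mem hx, indicator_of_mem (hb hx)]
      exact SimpleFunc.monotone_eapprox f hij x
    · simp only [hw, indicator_of_notMem hx]
      exact bot_le
  have hwm : ∀ k, Measurable (w k) := fun k =>
    (SimpleFunc.eapprox f k).measurable.indicator Metric.isClosed_closedBall.measurableSet
  have hle : ∀ k x, w k x ≤ SimpleFunc.eapprox f k x := fun k x => indicator_le_self _ _ x
  have hlef : ∀ k x, w k x ≤ f x := fun k x => (hle k x).trans (by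
    rw [← SimpleFunc.iSup_eapprox_apply hf x]
    exact le_iSup (fun n => SimpleFunc.eapprox f n x) k)
  have hsup : ∀ x, f x = ⨆ k, w k x := by
    intro x
    refine le_antisymm ?_ (iSup_le fun k => hlef k x)
    rw [← SimpleFunc.iSup_eapprox_apply hf x]
    refine iSup_le fun k => ?_
    obtain ⟨j, hj⟩ := exists_nat_ge ‖x‖
    have hx : x ∈ Metric.closedBall (0 : EuclideanSpace ℝ (Fin n)) ((max k j : ℕ) : ℝ) := by
      rw [mem_closedBall_zero_iff]
      exact hj.trans (by exact_mod_cast le_max_right k j)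
    refine le_trans ?_ (le_iSup (fun k => w k x) (max k j))
    simp only [hw, indicator_of_mem hx]
    exact SimpleFunc.monotone_eapprox f (le_max_left k j) x
  have hball : ∀ k : ℕ, volume (Metric.closedBall (0 : EuclideanSpace ℝ (Fin n)) (k : ℝ)) ≠ ∞ :=
    fun k => measure_closedBall_lt_top.ne
  refine ⟨w, hmono, hwm, hlef, fun s => ?_, fun k => ?_, fun k => ?_⟩
  · unfold rearrangedMass
    rw [← lintegral_iSup]
    · refine lintegral_congr fun l => ?_
      have hU : {x | ENNReal.ofReal l < f x} = ⋃ k, {x | ENNReal.ofReal l < w k x} := by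
        ext x
        simp only [mem_ofPred_eq, mem_iUnion, hsup x, lt_iSup_iff]
      have hm : Monotone fun k => {x | ENNReal.ofReal l < w k x} := fun i j hij x hx =>
        lt_of_lt_of_le hx (hmono hij x)
      rw [hU, hm.measure_iUnion, inf_iSup_eq]
    · intro k
      refine measurable_const.min ?_
      have : Antitone fun l : ℝ => volume {x | ENNReal.ofReal l < w k x} := fun a b hab =>
        measure_mono fun x hx => lt_of_le_of_lt (ENNReal.ofReal_le_ofReal hab) hx
      exact this.measurable
    · intro i j hij l
      exact min_le_min_left _ (measure_mono fun x hx => lt_of_lt_of_le hx (hmono hij x))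
  · obtain ⟨M, hM⟩ : ∃ M : ℝ≥0∞, M ≠ ∞ ∧ ∀ x, SimpleFunc.eapprox f k x ≤ M := by
      refine ⟨(SimpleFunc.eapprox f k).range.sup id, ?_, fun x => ?_⟩
      · refine ((Finset.sup_lt_iff (by simp)).2 fun a ha => ?_).ne
        obtain ⟨x, rfl⟩ := SimpleFunc.mem_range.1 ha
        exact SimpleFunc.eapprox_lt_top f k x
      · exact Finset.le_sup (f := id) (SimpleFunc.mem_range_self _ x)
    refine ⟨M * volume (Metric.closedBall (0 : EuclideanSpace ℝ (Fin n)) (k : ℝ)),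
      ENNReal.mul_ne_top hM.1 (hball k), fun s => ?_⟩
    refine (rearrangedMass_le_lintegral (hwm k) s).trans ?_
    simp only [hw]
    rw [lintegral_indicator Metric.isClosed_closedBall.measurableSet, ← setLIntegral_const]
    exact lintegral_mono hM.2
  · refine exists_ranking hn (hwm k) ?_ (fun x => ?_) ?_
    · refine Countable.mono (s₂ := insert 0 (range (SimpleFunc.eapprox f k))) ?_
        ((SimpleFunc.finite_range _).countable.insert 0)
      rintro _ ⟨x, rfl⟩
      by_cases hx : x ∈ Metric.closedBall (0 : EuclideanSpace ℝ (Fin n)) (k : ℝ)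
      · right; exact ⟨x, by simp only [hw, indicator_of_mem hx]⟩
      · left; simp only [hw, indicator_of_notMem hx]
    · exact ((hle k x).trans_lt (SimpleFunc.eapprox_lt_top f k x)).ne
    · refine ((measure_mono fun x hx => ?_).trans_lt (lt_top_iff_ne_top.2 (hball k))).ne
      by_contra h
      have hx : 0 < w k x := hx
      simp only [hw, indicator_of_notMem h, lt_irrefl] at hx

end Rearrangement

/-! ### Gauge operators -/

/-- The properties of `Φ ↦ supGauge p Φ` and `Φ ↦ intGauge p Φ` on which the duality rests. The
field `short` is the upper estimate on intervals where the gauge is nearly constant, the field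
`test` provides the extremal measures for the lower estimate. -/
structure IsGaugeOperator (p : ℝ) (C₁ C₂ C₃ : ℝ≥0) (Γ : (ℝ → ℝ≥0∞) → ℝ → ℝ≥0∞) : Prop where
  antitone : ∀ Φ, Antitone (Γ Φ)
  isGauge : ∀ Φ, Monotone Φ → IsGauge p (Γ Φ)
  le : ∀ Φ, Monotone Φ → ∀ z, 0 < z → Φ z ≤ C₁ * (powWeight p z * Γ Φ z)
  short : ∀ (κ : Measure ℝ) [SFinite κ] (k : ℝ → ℝ≥0∞), Antitone k → ∀ c d, 0 < c →
    ∫⁻ s in Ioc c d, k s ∂κ ≤ C₂ * (Γ (fun z => κ (Ioc 0 z)) c * lpNormOn p k d)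
  zero_le : ∀ Φ, Γ Φ 0 ≤ ⨆ a ∈ Ioi (0 : ℝ), Γ Φ a
  test : ∀ Φ, Monotone Φ → ∀ t, 0 < t → Γ Φ t ≠ ∞ →
    ∃ μ : Measure ℝ, SFinite μ ∧ μ (Iic t) = 0 ∧ Γ Φ t ≤ 2 * ∫⁻ x, Φ x ∂μ ∧
      ∫⁻ x in Ioi 0, tail μ x ^ p ≤ C₃
  ne_top : ∀ Φ (M : ℝ≥0∞), M ≠ ∞ → (∀ z, Φ z ≤ M) → ∀ t, 0 < t → Γ Φ t ≠ ∞
  map_zero : ∀ z, Γ (fun _ => 0) z = 0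
  map_iSup : ∀ Φ : ℕ → ℝ → ℝ≥0∞, Monotone Φ → (∀ k, Monotone (Φ k)) → ∀ z,
    Γ (fun x => ⨆ k, Φ k x) z = ⨆ k, Γ (Φ k) z
  mono : ∀ Φ Φ' : ℝ → ℝ≥0∞, Φ ≤ Φ' → ∀ z, Γ Φ z ≤ Γ Φ' z

lemma exists_coe_powWeight_two {p : ℝ} (hp : 0 < p) : ∃ c : ℝ≥0, (c : ℝ≥0∞) = powWeight p 2 :=
  ⟨_, ENNReal.coe_toNNReal (powWeight_ne_top hp 2)⟩

lemma exists_isGaugeOperator_supGauge {p : ℝ} (hp : 0 < p) (hp1 : p ≤ 1) :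
    ∃ C₁ C₂ C₃ : ℝ≥0, IsGaugeOperator p C₁ C₂ C₃ (supGauge p) := by
  obtain ⟨c, hc⟩ := exists_coe_powWeight_two hp
  refine ⟨c, 2 * c, 1, ?_⟩
  constructor
  · exact fun Φ => supGauge_antitone
  · exact fun Φ hΦ => isGauge_supGauge hp hΦ
  · intro Φ hΦ z hz
    rw [hc]
    exact le_supGauge hp hΦ hz
  · intro κ _ k hk c' d hc'
    push_cast
    rw [hc]
    exact lintegral_Ioc_le_supGauge hp hp1 hk hc'
  · exact fun Φ => supGauge_zero_le
  · exact fun Φ _ t ht hfin => exists_test_supGauge hp ht hfin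
  · intro Φ M hM hΦM t ht
    refine ((?_ : supGauge p Φ t ≤ M / powWeight p t).trans_lt
      (ENNReal.div_lt_top hM (powWeight_ne_zero ht))).ne
    refine iSup₂_le fun x hx => ?_
    exact ENNReal.div_le_div (hΦM x) (powWeight_mono hp (mem_Ioi.1 hx).le)
  · intro z
    simp [supGauge]
  · intro Φ _ _ z
    simp only [supGauge, ENNReal.iSup_div]
    rw [iSup_comm]
    simp only [iSup_comm (ι := ℕ)]
  · intro Φ Φ' h z
    exact iSup₂_mono fun x _ => ENNReal.div_le_div_right (h x) _

lemma exists_isGaugeOperator_intGauge {p : ℝ} (hp : 1 < p) :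
    ∃ C₁ C₂ C₃ : ℝ≥0, IsGaugeOperator p C₁ C₂ C₃ (intGauge p) := by
  have hp0 : 0 < p := by linarith
  have hpq := Real.HolderConjugate.conjExponent hp
  have hq0 : 0 < p.conjExponent := hpq.symm.pos
  have hq1 : 0 < p.conjExponent - 1 := by have := hpq.symm.lt; linarith
  obtain ⟨c, hc⟩ := exists_coe_powWeight_two hp0
  obtain ⟨C, hC⟩ := exists_test_intGauge hp
  refine ⟨2, 2 * c, C, ?_⟩
  constructor
  · exact fun Φ => intGauge_antitone hp
  · exact fun Φ hΦ => isGauge_intGauge hp hΦ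
  · intro Φ hΦ z hz
    exact le_intGauge hp hΦ hz
  · intro κ _ k hk c' d hc'
    push_cast
    rw [hc]
    exact lintegral_Ioc_le_intGauge hp hk hc'
  · exact fun Φ => intGauge_zero_le hp
  · exact fun Φ hΦ t ht hfin => hC Φ hΦ.measurable t ht hfin
  · intro Φ M hM hΦM t ht
    refine ENNReal.rpow_ne_top_of_nonneg (by positivity) ?_
    refine ((?_ : _ ≤ M ^ p.conjExponent * (ENNReal.ofReal (p.conjExponent - 1)⁻¹ *
      ENNReal.ofReal t ^ (-(p.conjExponent - 1)))).trans_lt ?_).ne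
    · rw [← lintegral_Ioi_rpow hq1 ht, ← lintegral_const_mul' _ _
        (ENNReal.rpow_ne_top_of_nonneg hq0.le hM)]
      refine lintegral_mono fun x => ?_
      calc (Φ x / ENNReal.ofReal x) ^ p.conjExponent
          ≤ (M / ENNReal.ofReal x) ^ p.conjExponent := by
            gcongr
            exact hΦM x
        _ = M ^ p.conjExponent * ENNReal.ofReal x ^ (-(p.conjExponent - 1) - 1) := by
            rw [div_eq_mul_inv, ENNReal.mul_rpow_of_nonneg _ _ hq0.le, ENNReal.inv_rpow,
              ← ENNReal.rpow_neg]
            congr 2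
            ring
    · refine ENNReal.mul_lt_top (ENNReal.rpow_lt_top_of_nonneg hq0.le hM)
        (ENNReal.mul_lt_top ENNReal.ofReal_lt_top ?_)
      rw [ENNReal.ofReal_rpow_of_pos ht]
      exact ENNReal.ofReal_lt_top
  · intro z
    simp [intGauge, hq0]
  · intro Φ hΦ hΦk z
    have h1 : ∀ x, ((⨆ k, Φ k x) / ENNReal.ofReal x) ^ p.conjExponent =
        ⨆ k, (Φ k x / ENNReal.ofReal x) ^ p.conjExponent := fun x => by
      rw [ENNReal.iSup_div]
      exact (ENNReal.orderIsoRpow _ hq0).map_iSup _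
    simp only [intGauge, h1]
    rw [lintegral_iSup]
    · exact (ENNReal.orderIsoRpow _ (by positivity : 0 < 1 / p.conjExponent)).map_iSup _
    · exact fun k => ((hΦk k).measurable.div ENNReal.measurable_ofReal).pow_const _
    · intro i j hij x
      simp only
      gcongr
      exact hΦ hij x
  · intro Φ Φ' h z
    unfold intGauge
    gcongr 3 with x
    exact ENNReal.div_le_div_right (h x) _

/-! ### The change of variables `x = ∫_0^t ψ ^ p` -/

/-- A non-decreasing map `y` whose restriction to `[0, ∞)` is a bijection of `[0, ∞)`, together
with its inverse `σ`, which is extended by zero to the negative half-line. -/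
structure IsTimeChange (y σ : ℝ → ℝ) : Prop where
  mono_y : Monotone y
  mono_σ : Monotone σ
  y_nonneg : ∀ t, 0 ≤ y t
  σ_of_nonpos : ∀ z, z ≤ 0 → σ z = 0
  y_σ : ∀ z, 0 ≤ z → y (σ z) = z
  σ_y : ∀ t, 0 ≤ t → σ (y t) = t

namespace IsTimeChange
variable {y σ : ℝ → ℝ}

lemma σ_nonneg (h : IsTimeChange y σ) (z : ℝ) : 0 ≤ σ z := by
  rcases le_total z 0 with hz | hz
  · exact (h.σ_of_nonpos z hz).ge
  · rw [← h.σ_of_nonpos 0 le_rfl]; exact h.mono_σ hz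

lemma lt_σ_iff (h : IsTimeChange y σ) {t : ℝ} (ht : 0 ≤ t) (z : ℝ) : t < σ z ↔ y t < z := by
  constructor
  · intro hlt
    by_contra hcon
    have := h.mono_σ (not_lt.1 hcon)
    rw [h.σ_y t ht] at this
    linarith
  · intro hlt
    by_contra hcon
    have := h.mono_y (not_lt.1 hcon)
    rw [h.y_σ z ((h.y_nonneg t).trans hlt.le)] at this
    linarith

lemma y_pos (h : IsTimeChange y σ) {t : ℝ} (ht : 0 < t) : 0 < y t := by
  by_contra hcon
  have := h.σ_of_nonpos _ (not_lt.1 hcon)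
  rw [h.σ_y t ht.le] at this
  linarith

lemma y_lt_y_iff (h : IsTimeChange y σ) {s t : ℝ} (hs : 0 ≤ s) (ht : 0 ≤ t) :
    y s < y t ↔ s < t := by
  rw [← h.lt_σ_iff hs, h.σ_y t ht]

lemma σ_pos (h : IsTimeChange y σ) {z : ℝ} (hz : 0 < z) : 0 < σ z := by
  rw [h.lt_σ_iff le_rfl]
  have : y 0 = 0 := by
    have := h.y_σ 0 le_rfl
    rwa [h.σ_of_nonpos 0 le_rfl] at this
  rwa [this]

end IsTimeChange

/-- The admissibility of `t ↦ (∫_0^t ψ ^ p) ^ (1 / p)` makes `t ↦ ∫_0^t ψ ^ p` a time change. -/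
lemma exists_isTimeChange {p : ℝ} (hp : 0 < p) {ψ : ℝ → ℝ≥0∞} (hadm : IsAdmissible (lpNormOn p ψ)) :
    ∃ y σ : ℝ → ℝ, IsTimeChange y σ ∧
      ∀ t, 0 ≤ t → ∫⁻ s in Ioo 0 t, ψ s ^ p = ENNReal.ofReal (y t) := by
  set Y : ℝ → ℝ≥0∞ := fun t => ∫⁻ s in Ioo 0 t, ψ s ^ p with hY
  have hYeq : ∀ t, Y t = lpNormOn p ψ t ^ p := fun t => by
    rw [lpNormOn, ← ENNReal.rpow_mul, one_div_mul_cancel hp.ne', ENNReal.rpow_one]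
  have hYfin : ∀ t, Y t ≠ ∞ := fun t => by
    rcases le_total 0 t with h | h
    · rw [hYeq]; exact ENNReal.rpow_ne_top_of_nonneg hp.le (hadm.finite t h)
    · simp [hY, Ioo_eq_empty (not_lt.2 h)]
  have hYmono : Monotone Y := fun a b hab => lintegral_mono_set (Ioo_subset_Ioo_right hab)
  have hYstrict : StrictMonoOn Y (Ici 0) := fun a ha b hb hab => by
    rw [hYeq, hYeq]; exact ENNReal.rpow_lt_rpow (hadm.strictMonoOn ha hb hab) hp
  set y : ℝ → ℝ := fun t => (Y t).toReal with hy
  have hmono : Monotone y := fun a b hab => ENNReal.toReal_mono (hYfin b) (hYmono hab)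
  have hstrict : StrictMonoOn y (Ici 0) := fun a ha b hb hab =>
    (ENNReal.toReal_lt_toReal (hYfin a) (hYfin b)).2 (hYstrict ha hb hab)
  have hcont : ContinuousOn y (Ici 0) := by
    intro t ht
    refine (ENNReal.tendsto_toReal (hYfin t)).comp ?_
    have : Tendsto (fun t => lpNormOn p ψ t ^ p) (𝓝[Ici 0] t) (𝓝 (lpNormOn p ψ t ^ p)) :=
      (ENNReal.continuous_rpow_const.tendsto _).comp (hadm.continuousOn t ht)
    rw [hYeq]
    exact this.congr fun t => (hYeq t).symm
  have hy0 : y 0 = 0 := by simp [hy, hY]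
  have hsurj : ∀ z : ℝ, ∃ t, 0 ≤ t ∧ y t = max z 0 := by
    intro z
    have h1 : ∀ᶠ t in atTop, ENNReal.ofReal (max z 0) ^ (1 / p) < lpNormOn p ψ t :=
      (tendsto_order.1 hadm.tendsto).1 _
        (ENNReal.rpow_lt_top_of_nonneg (by positivity) ENNReal.ofReal_ne_top)
    obtain ⟨b, hb, hb0⟩ := (h1.and (eventually_ge_atTop 0)).exists
    have h2 : max z 0 ≤ y b := by
      rw [hy, ← ENNReal.ofReal_le_iff_le_toReal (hYfin b), hYeq]
      have := ENNReal.rpow_le_rpow hb.le hp.le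
      rwa [← ENNReal.rpow_mul, one_div_mul_cancel hp.ne', ENNReal.rpow_one] at this
    obtain ⟨t, ht, hty⟩ := intermediate_value_Icc hb0 (hcont.mono Icc_subset_Ici_self)
      (show max z 0 ∈ Icc (y 0) (y b) from ⟨by rw [hy0]; exact le_max_right _ _, h2⟩)
    exact ⟨t, ht.1, hty⟩
  choose σ hσ0 hσ using hsurj
  refine ⟨y, σ, ⟨hmono, ?_, fun t => ENNReal.toReal_nonneg, ?_, ?_, ?_⟩, fun t _ => ?_⟩
  · intro a b hab
    rw [← hstrict.le_iff_le (hσ0 a) (hσ0 b), hσ, hσ]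
    exact max_le_max_right _ hab
  · intro z hz
    refine hstrict.injOn (hσ0 z) (mem_Ici.2 le_rfl) ?_
    rw [hσ, hy0, max_eq_right hz]
  · intro z hz
    rw [hσ, max_eq_left hz]
  · intro t ht
    refine hstrict.injOn (hσ0 _) ht ?_
    rw [hσ, max_eq_left ENNReal.toReal_nonneg]
  · exact (ENNReal.ofReal_toReal (hYfin t)).symm

section ChangeOfVariables
variable {p : ℝ} {ψ : ℝ → ℝ≥0∞} {y σ : ℝ → ℝ}

lemma lpNormOn_eq_powWeight (hY : ∀ t, 0 ≤ t → ∫⁻ s in Ioo 0 t, ψ s ^ p = ENNReal.ofReal (y t))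
    {t : ℝ} (ht : 0 ≤ t) : lpNormOn p ψ t = powWeight p (y t) := by
  rw [lpNormOn, hY t ht, powWeight]

/-- The measure `ψ ^ p ds` is transported to Lebesgue measure. -/
lemma map_withDensity_eq (hT : IsTimeChange y σ)
    (hY : ∀ t, 0 ≤ t → ∫⁻ s in Ioo 0 t, ψ s ^ p = ENNReal.ofReal (y t)) :
    ((volume.restrict (Ioi 0)).withDensity fun s => ψ s ^ p).map y = volume.restrict (Ioi 0) := by
  symm
  refine Measure.ext_of_Ioc _ _ fun a b hab => ?_
  rw [Measure.map_apply hT.mono_y.measurable measurableSet_Ioc,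
    withDensity_apply _ (hT.mono_y.measurable measurableSet_Ioc),
    Measure.restrict_restrict (hT.mono_y.measurable measurableSet_Ioc),
    Measure.restrict_apply measurableSet_Ioc]
  have hset : y ⁻¹' Ioc a b ∩ Ioi 0 = Ioc (σ a) (σ b) := by
    ext s
    simp only [mem_inter_iff, mem_preimage, mem_Ioc, mem_Ioi]
    constructor
    · rintro ⟨⟨h1, h2⟩, h0⟩
      constructor
      · rw [← not_le]
        intro hle
        rcases hle.eq_or_lt with rfl | hlt
        · rcases le_total a 0 with ha | ha
          · rw [hT.σ_of_nonpos a ha] at h0; exact lt_irrefl _ h0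
          · rw [hT.y_σ a ha] at h1; exact lt_irrefl _ h1
        · exact absurd ((hT.lt_σ_iff h0.le a).1 hlt) (not_lt.2 h1.le)
      · have := hT.mono_σ h2
        rwa [hT.σ_y s h0.le] at this
    · rintro ⟨h1, h2⟩
      have h0 : 0 < s := (hT.σ_nonneg a).trans_lt h1
      refine ⟨⟨?_, ?_⟩, h0⟩
      · by_contra hcon
        have := hT.mono_σ (not_lt.1 hcon)
        rw [hT.σ_y s h0.le] at this
        linarith
      · have h3 := hT.mono_y h2
        have hb : 0 ≤ b := by
          by_contra hb
          rw [hT.σ_of_nonpos b (not_le.1 hb).le] at h2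
          linarith
        rwa [hT.y_σ b hb] at h3
  have hσab := hT.mono_σ hab.le
  have hIoc : ∀ c, 0 ≤ c → ∫⁻ s in Ioc 0 c, ψ s ^ p = ENNReal.ofReal (y c) := fun c hc => by
    rw [← hY c hc, restrict_Ioo_eq_restrict_Ioc]
  have hyσ : ∀ z, ENNReal.ofReal (y (σ z)) = ENNReal.ofReal z := fun z => by
    rcases le_total z 0 with hz | hz
    · have h0 := hT.y_σ 0 le_rfl
      rw [hT.σ_of_nonpos 0 le_rfl] at h0
      rw [hT.σ_of_nonpos z hz, h0, ENNReal.ofReal_zero, ENNReal.ofReal_of_nonpos hz]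
    · rw [hT.y_σ z hz]
  have hsplit : ENNReal.ofReal b = ENNReal.ofReal a + ∫⁻ s in Ioc (σ a) (σ b), ψ s ^ p := by
    rw [← hyσ a, ← hyσ b, ← hIoc _ (hT.σ_nonneg _), ← hIoc _ (hT.σ_nonneg _),
      ← Ioc_union_Ioc_eq_Ioc (hT.σ_nonneg a) hσab, lintegral_union measurableSet_Ioc]
    exact Ioc_disjoint_Ioc_of_le le_rfl
  have hvol : volume (Ioc a b ∩ Ioi 0) = ENNReal.ofReal b - ENNReal.ofReal a := by
    have : Ioc a b ∩ Ioi 0 = Ioc (max a 0) b := by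
      ext s; simp only [mem_inter_iff, mem_Ioc, mem_Ioi, max_lt_iff]; tauto
    rw [this, Real.volume_Ioc, ENNReal.ofReal_sub _ (le_max_right _ _)]
    congr 1
    rcases le_total a 0 with ha | ha
    · rw [max_eq_right ha, ENNReal.ofReal_zero, ENNReal.ofReal_of_nonpos ha]
    · rw [max_eq_left ha]
  rw [hset, hvol, hsplit, ENNReal.add_sub_cancel_left ENNReal.ofReal_ne_top]

lemma lintegral_comp_mul_rpow (hT : IsTimeChange y σ)
    (hY : ∀ t, 0 ≤ t → ∫⁻ s in Ioo 0 t, ψ s ^ p = ENNReal.ofReal (y t))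
    (hψ : AEMeasurable ψ (volume.restrict (Ioi 0))) {θ : ℝ → ℝ≥0∞} (hθ : Measurable θ) :
    ∫⁻ s in Ioi 0, θ (y s) * ψ s ^ p = ∫⁻ z in Ioi 0, θ z := by
  conv_rhs => rw [← map_withDensity_eq hT hY]
  rw [lintegral_map hθ hT.mono_y.measurable,
    lintegral_withDensity_eq_lintegral_mul₀ (g := fun s => θ (y s)) (hψ.pow_const p)
      (hθ.comp hT.mono_y.measurable).aemeasurable]
  exact lintegral_congr fun s => mul_comm _ _

lemma setLIntegral_Ioi_comp_mul_rpow (hT : IsTimeChange y σ)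
    (hY : ∀ t, 0 ≤ t → ∫⁻ s in Ioo 0 t, ψ s ^ p = ENNReal.ofReal (y t))
    (hψ : AEMeasurable ψ (volume.restrict (Ioi 0))) {θ : ℝ → ℝ≥0∞} (hθ : Measurable θ)
    {t : ℝ} (ht : 0 ≤ t) :
    ∫⁻ s in Ioi t, θ (y s) * ψ s ^ p = ∫⁻ z in Ioi (y t), θ z := by
  have h1 := lintegral_comp_mul_rpow hT hY hψ (hθ.indicator (measurableSet_Ioi (a := y t)))
  rw [setLIntegral_indicator measurableSet_Ioi, inter_eq_left.2 (Ioi_subset_Ioi (hT.y_nonneg t))]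
    at h1
  rw [← h1, ← inter_eq_left.2 (Ioi_subset_Ioi ht), ← setLIntegral_indicator measurableSet_Ioi]
  refine setLIntegral_congr_fun measurableSet_Ioi fun s hs => ?_
  have := hT.y_lt_y_iff ht (mem_Ioi.1 hs).le
  by_cases hts : t < s
  · simp [indicator, hts, this.2 hts]
  · simp [indicator, hts, mt this.1 hts]

lemma setLIntegral_Ioo_comp_mul_rpow (hT : IsTimeChange y σ)
    (hY : ∀ t, 0 ≤ t → ∫⁻ s in Ioo 0 t, ψ s ^ p = ENNReal.ofReal (y t))
    (hψ : AEMeasurable ψ (volume.restrict (Ioi 0))) {θ : ℝ → ℝ≥0∞} (hθ : Measurable θ)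
    {r : ℝ} (hr : 0 ≤ r) :
    ∫⁻ s in Ioo 0 r, θ (y s) * ψ s ^ p = ∫⁻ z in Ioo 0 (y r), θ z := by
  have h1 := lintegral_comp_mul_rpow hT hY hψ (hθ.indicator (measurableSet_Iio (a := y r)))
  rw [setLIntegral_indicator measurableSet_Iio, Iio_inter_Ioi] at h1
  rw [← h1, ← Iio_inter_Ioi, ← setLIntegral_indicator measurableSet_Iio]
  refine setLIntegral_congr_fun measurableSet_Ioi fun s hs => ?_
  have := hT.y_lt_y_iff (mem_Ioi.1 hs).le hr
  by_cases hsr : s < r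
  · simp [indicator, hsr, this.2 hsr]
  · simp [indicator, hsr, mt this.1 hsr]

/-- `L^p` norms with weight `ψ` become unweighted ones. -/
lemma lpNormOn_mul_comp (hp : 0 < p) (hT : IsTimeChange y σ)
    (hY : ∀ t, 0 ≤ t → ∫⁻ s in Ioo 0 t, ψ s ^ p = ENNReal.ofReal (y t))
    (hψ : AEMeasurable ψ (volume.restrict (Ioi 0))) {k : ℝ → ℝ≥0∞} (hk : Measurable k)
    {r : ℝ} (hr : 0 ≤ r) :
    lpNormOn p (fun s => ψ s * k (y s)) r = lpNormOn p k (y r) := by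
  unfold lpNormOn
  rw [← setLIntegral_Ioo_comp_mul_rpow hT hY hψ (hk.pow_const p) hr]
  congr 1
  refine lintegral_congr fun s => ?_
  rw [ENNReal.mul_rpow_of_nonneg _ _ hp.le, mul_comm]

/-- The part of `ν` on `[0, ∞)`, transported by `y`. -/
noncomputable def transportedMeasure (ν : Measure ℝ) (y : ℝ → ℝ) : Measure ℝ :=
  (ν.restrict (Ici 0)).map y

lemma lintegral_transportedMeasure (hT : IsTimeChange y σ) (ν : Measure ℝ) {G : ℝ → ℝ≥0∞}
    (hG : Measurable G) :
    ∫⁻ z in Ici 0, G z ∂(transportedMeasure ν y) = ∫⁻ t in Ici 0, G (y t) ∂ν := by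
  have : y ⁻¹' Ici 0 = univ := by ext t; simp [hT.y_nonneg t]
  rw [transportedMeasure, setLIntegral_map measurableSet_Ici hG hT.mono_y.measurable, this,
    Measure.restrict_univ]

lemma fundamentalFunction_transportedMeasure (hT : IsTimeChange y σ)
    (hY : ∀ t, 0 ≤ t → ∫⁻ s in Ioo 0 t, ψ s ^ p = ENNReal.ofReal (y t)) (ν : Measure ℝ)
    {t : ℝ} (ht : 0 ≤ t) :
    fundamentalFunction (powWeight p) (transportedMeasure ν y) (y t) =
      fundamentalFunction (lpNormOn p ψ) ν t := by
  have hm : Measurable fun z => (powWeight p z + powWeight p (y t))⁻¹ :=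
    (continuous_powWeight.measurable.add_const _).inv
  unfold fundamentalFunction
  rw [lintegral_transportedMeasure hT ν hm, lpNormOn_eq_powWeight hY ht]
  congr 1
  refine setLIntegral_congr_fun measurableSet_Ici fun s hs => ?_
  rw [lpNormOn_eq_powWeight hY hs]

variable {n : ℕ}

lemma ofReal_mul_maximalRearrangement (f : EuclideanSpace ℝ (Fin n) → EReal) {s : ℝ} (hs : 0 < s) :
    ENNReal.ofReal s * maximalRearrangement f s = rearrangedMass (fun x => (f x).abs) s := by
  rw [maximalRearrangement, ENNReal.mul_div_cancel (by simpa using hs) ENNReal.ofReal_ne_top,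
    lintegral_rearrangement]

lemma supExpression_eq (hT : IsTimeChange y σ)
    (hY : ∀ t, 0 ≤ t → ∫⁻ s in Ioo 0 t, ψ s ^ p = ENNReal.ofReal (y t)) (ν : Measure ℝ)
    (f : EuclideanSpace ℝ (Fin n) → EReal) :
    supExpression p ψ ν f = ∫⁻ z in Ici 0,
      supGauge p (fun z => rearrangedMass (fun x => (f x).abs) (σ z)) z
        ∂(transportedMeasure ν y) := by
  rw [lintegral_transportedMeasure hT ν supGauge_antitone.measurable]
  refine setLIntegral_congr_fun measurableSet_Ici fun t ht => ?_
  have ht : 0 ≤ t := ht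
  refine le_antisymm (iSup₂_le fun s hs => ?_) (iSup₂_le fun z hz => ?_)
  · have hs : t < s := hs
    have hs0 := ht.trans_lt hs
    rw [ofReal_mul_maximalRearrangement f hs0, lpNormOn_eq_powWeight hY hs0.le]
    have := div_powWeight_le_supGauge (p := p)
      (Φ := fun z => rearrangedMass (fun x => (f x).abs) (σ z)) ((hT.y_lt_y_iff ht hs0.le).2 hs)
    rwa [hT.σ_y s hs0.le] at this
  · have hz : y t < z := hz
    have hz0 := (hT.y_nonneg t).trans_lt hz
    have hts := (hT.lt_σ_iff ht z).2 hz
    refine le_trans (le_of_eq ?_) (le_iSup₂ (f := fun s (_ : s ∈ Ioi t) =>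
      ENNReal.ofReal s * maximalRearrangement f s / lpNormOn p ψ s) (σ z) hts)
    rw [ofReal_mul_maximalRearrangement f (hT.σ_pos hz0),
      lpNormOn_eq_powWeight hY (hT.σ_nonneg z), hT.y_σ z hz0.le]

lemma integralExpression_eq (hp : 1 < p) (hT : IsTimeChange y σ)
    (hY : ∀ t, 0 ≤ t → ∫⁻ s in Ioo 0 t, ψ s ^ p = ENNReal.ofReal (y t))
    (hψ : AEMeasurable ψ (volume.restrict (Ioi 0))) (ν : Measure ℝ)
    (f : EuclideanSpace ℝ (Fin n) → EReal) :
    integralExpression p ψ ν f = ∫⁻ z in Ici 0,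
      intGauge p (fun z => rearrangedMass (fun x => (f x).abs) (σ z)) z
        ∂(transportedMeasure ν y) := by
  have hp0 : 0 < p := by linarith
  rw [lintegral_transportedMeasure hT ν (intGauge_antitone hp).measurable]
  refine setLIntegral_congr_fun measurableSet_Ici fun t ht => ?_
  have ht : 0 ≤ t := ht
  simp only [intGauge]
  have hm : Measurable fun z => rearrangedMass (fun x => (f x).abs) (σ z) :=
    ((rearrangedMass_mono _).comp hT.mono_σ).measurable
  have hθ : Measurable fun z => (rearrangedMass (fun x => (f x).abs) (σ z) /
      ENNReal.ofReal z) ^ p.conjExponent :=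
    (hm.div ENNReal.measurable_ofReal).pow_const p.conjExponent
  rw [← setLIntegral_Ioi_comp_mul_rpow hT hY hψ hθ ht]
  congr 1
  refine setLIntegral_congr_fun measurableSet_Ioi fun s hs => ?_
  have hs0 : 0 < s := ht.trans_lt hs
  rw [ofReal_mul_maximalRearrangement f hs0, lpNormOn_eq_powWeight hY hs0.le, powWeight_rpow hp0,
    hT.σ_y s hs0.le]

end ChangeOfVariables

/-! ### The duality for a gauge operator -/

lemma measurable_ereal_abs : Measurable EReal.abs :=
  EReal.measurable_of_measurable_real (by
    simp only [EReal.abs_def]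
    exact ENNReal.measurable_ofReal.comp measurable_norm)

lemma ereal_abs_coe_ennreal (a : ℝ≥0∞) : (a : EReal).abs = a := by
  induction a with
  | top => simp
  | coe a =>
    rw [EReal.coe_nnreal_eq_coe_real, EReal.abs_def, abs_of_nonneg a.coe_nonneg]
    simp

section Duality
variable {p : ℝ} {n : ℕ} {ψ φ : ℝ → ℝ≥0∞} {ν : Measure ℝ} {y σ : ℝ → ℝ}

lemma gLambdaNorm_le_one_iff {g : EuclideanSpace ℝ (Fin n) → EReal} :
    gLambdaNorm p ψ φ g ≤ 1 ↔
      ∀ r, 0 < r → lpNormOn p (fun s => ψ s * rearrangement g s) r ≤ (φ r)⁻¹ := by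
  simp only [gLambdaNorm, iSup_le_iff, mem_Ioi]
  refine forall₂_congr fun r _ => ?_
  rw [ENNReal.le_inv_iff_mul_le, mul_comm]

lemma lintegral_le_associateNorm (N : (EuclideanSpace ℝ (Fin n) → EReal) → ℝ≥0∞)
    (f : EuclideanSpace ℝ (Fin n) → EReal) {g : EuclideanSpace ℝ (Fin n) → EReal}
    (hg : AEMeasurable g volume) (hN : N g ≤ 1) :
    ∫⁻ x, (f x).abs * (g x).abs ≤ associateNorm N f :=
  le_iSup_of_le g (le_iSup_of_le hg (le_iSup_of_le hN le_rfl))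

/-- The associate norm is at most the integral of the gauge. -/
theorem exists_associateNorm_le (hp : 0 < p) {C₁ C₂ C₃ : ℝ≥0} {Γ : (ℝ → ℝ≥0∞) → ℝ → ℝ≥0∞}
    (hΓ : IsGaugeOperator p C₁ C₂ C₃ Γ) (K : ℝ≥0) : ∃ C : ℝ≥0,
    ∀ (n : ℕ) (ψ φ : ℝ → ℝ≥0∞) (ν : Measure ℝ) (y σ : ℝ → ℝ), IsTimeChange y σ →
      (∀ t, 0 ≤ t → ∫⁻ s in Ioo 0 t, ψ s ^ p = ENNReal.ofReal (y t)) →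
      AEMeasurable ψ (volume.restrict (Ioi 0)) →
      (∀ t, 0 < t → (φ t)⁻¹ ≤ K * fundamentalFunction (lpNormOn p ψ) ν t) →
      ∀ f : EuclideanSpace ℝ (Fin n) → EReal, AEMeasurable f volume →
        associateNorm (gLambdaNorm p ψ φ) f ≤ C * ∫⁻ z in Ici 0,
          Γ (fun z => rearrangedMass (fun x => (f x).abs) (σ z)) z ∂(transportedMeasure ν y) := by
  obtain ⟨C, hC⟩ := exists_lintegral_le_gauge hp K C₁ C₂
  refine ⟨C, fun n ψ φ ν y σ hT hY hψ hφ f hf => ?_⟩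
  refine iSup_le fun g => iSup_le fun hg => iSup_le fun hN => ?_
  rw [gLambdaNorm_le_one_iff] at hN
  have hfm := (rearrangement_antitone f).measurable
  set κ : Measure ℝ := ((volume.restrict (Ioi 0)).withDensity (rearrangement f)).map y with hκ
  set k : ℝ → ℝ≥0∞ := fun z => rearrangement g (σ z) with hk
  have hkanti : Antitone k := (rearrangement_antitone g).comp_monotone hT.mono_σ
  have hΦ : (fun z => κ (Ioc 0 z)) = fun z => rearrangedMass (fun x => (f x).abs) (σ z) := by
    funext z
    have hm := hT.mono_y.measurable (measurableSet_Ioc (a := (0 : ℝ)) (b := z))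
    rw [hκ, Measure.map_apply hT.mono_y.measurable measurableSet_Ioc, withDensity_apply _ hm,
      Measure.restrict_restrict hm, ← lintegral_rearrangement, restrict_Ioo_eq_restrict_Ioc]
    congr 2
    ext s
    simp only [mem_inter_iff, mem_preimage, mem_Ioc, mem_Ioi]
    constructor
    · rintro ⟨⟨-, h2⟩, h0⟩
      refine ⟨h0, ?_⟩
      have := hT.mono_σ h2
      rwa [hT.σ_y s h0.le] at this
    · rintro ⟨h0, h2⟩
      have hz : 0 ≤ z := by
        by_contra hz
        rw [hT.σ_of_nonpos z (not_le.1 hz).le] at h2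
        linarith
      refine ⟨⟨hT.y_pos h0, ?_⟩, h0⟩
      have := hT.mono_y h2
      rwa [hT.y_σ z hz] at this
  have hΦm : Monotone fun z => rearrangedMass (fun x => (f x).abs) (σ z) :=
    (rearrangedMass_mono _).comp hT.mono_σ
  have key := hC κ (Γ fun z => κ (Ioc 0 z)) (transportedMeasure ν y) k
    (hΓ.isGauge _ (hΦ ▸ hΦm)) (fun z hz => hΓ.le _ (hΦ ▸ hΦm) z hz)
    (fun c d hc _ => hΓ.short κ k hkanti c d hc) hkanti (fun z hz => by
      have h1 := hφ (σ z) (hT.σ_pos hz)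
      rw [← fundamentalFunction_transportedMeasure hT hY ν (hT.σ_nonneg z), hT.y_σ z hz.le] at h1
      refine le_trans ?_ h1
      refine le_trans (le_of_eq ?_) (hN (σ z) (hT.σ_pos hz))
      conv_lhs => rw [← hT.y_σ z hz.le]
      rw [← lpNormOn_mul_comp hp hT hY hψ hkanti.measurable (hT.σ_nonneg z)]
      unfold lpNormOn
      congr 1
      refine setLIntegral_congr_fun measurableSet_Ioo fun s hs => ?_
      simp only [hk, hT.σ_y s hs.1.le])
  rw [hΦ] at key
  refine le_trans ?_ key
  refine (lintegral_abs_mul_abs_le (measurable_ereal_abs.comp_aemeasurable hf)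
    (measurable_ereal_abs.comp_aemeasurable hg)).trans (le_of_eq ?_)
  have hpre : y ⁻¹' Ioi 0 ∩ Ioi 0 = Ioi 0 := inter_eq_right.2 fun s hs => hT.y_pos hs
  have hm := hT.mono_y.measurable (measurableSet_Ioi (a := (0 : ℝ)))
  rw [hκ, setLIntegral_map measurableSet_Ioi hkanti.measurable hT.mono_y.measurable,
    setLIntegral_withDensity_eq_setLIntegral_mul (g := fun s => k (y s)) _ hfm
      (hkanti.measurable.comp hT.mono_y.measurable) hm, Measure.restrict_restrict hm, hpre]
  refine setLIntegral_congr_fun measurableSet_Ioi fun s hs => ?_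
  simp only [Pi.mul_apply, hk, hT.σ_y s (mem_Ioi.1 hs).le]

/-- A measure whose tail has small `L^p` norms, pulled back along a ranking of a function below
`|f|`, is a competitor in the definition of the associate norm of `f`. -/
lemma lintegral_rearrangedMass_le_associateNorm (hp : 0 < p) (hT : IsTimeChange y σ)
    (hY : ∀ t, 0 ≤ t → ∫⁻ s in Ioo 0 t, ψ s ^ p = ENNReal.ofReal (y t))
    (hψ : AEMeasurable ψ (volume.restrict (Ioi 0)))
    {f : EuclideanSpace ℝ (Fin n) → EReal} {w τ : EuclideanSpace ℝ (Fin n) → ℝ≥0∞}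
    (hw : Measurable w) (hwf : ∀ᵐ x, w x ≤ (f x).abs) (hτ : IsRanking w τ)
    {μ : Measure ℝ} [SFinite μ]
    (hμ : ∀ r, 0 < r → lpNormOn p (tail μ) (y r) ≤ (φ r)⁻¹) :
    ∫⁻ z, rearrangedMass w (σ z) ∂μ ≤ 2 * associateNorm (gLambdaNorm p ψ φ) f := by
  have hσm : Measurable fun z => ENNReal.ofReal (σ z) :=
    ENNReal.measurable_ofReal.comp hT.mono_σ.measurable
  have hset : MeasurableSet {q : EuclideanSpace ℝ (Fin n) × ℝ | τ q.1 < ENNReal.ofReal (σ q.2)} :=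
    measurableSet_lt (hτ.measurable.comp measurable_fst) (hσm.comp measurable_snd)
  set γ : EuclideanSpace ℝ (Fin n) → ℝ≥0∞ := fun x => μ {z | τ x < ENNReal.ofReal (σ z)} with hγ
  have hγm : Measurable γ := measurable_measure_prodMk_left hset
  set g : EuclideanSpace ℝ (Fin n) → EReal := fun x => (γ x : EReal) with hg
  have hgabs : ∀ x, (g x).abs = γ x := fun x => ereal_abs_coe_ennreal _
  have hgstar : ∀ t, 0 < t → rearrangement g t ≤ tail μ (y t) := by
    intro t ht
    refine le_of_forall_gt_imp_ge_of_dense fun m hm => sInf_le ⟨bot_le.trans_lt hm, ?_⟩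
    refine le_trans (measure_mono fun x hx => ?_) (hτ.volume_le t ht)
    have hx : m < (g x).abs := hx
    rw [hgabs] at hx
    by_contra hcon
    have hcon : ENNReal.ofReal t ≤ τ x := not_lt.1 hcon
    refine absurd (hx.trans_le (measure_mono fun z hz => ?_)) (not_lt.2 hm.le)
    have hz : ENNReal.ofReal t < ENNReal.ofReal (σ z) := hcon.trans_lt hz
    exact (hT.lt_σ_iff ht.le z).1 ((ENNReal.ofReal_lt_ofReal_iff_of_nonneg ht.le).1 hz)
  have hN : gLambdaNorm p ψ φ g ≤ 1 := by
    rw [gLambdaNorm_le_one_iff]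
    intro r hr
    refine le_trans ?_ (hμ r hr)
    rw [← lpNormOn_mul_comp hp hT hY hψ (tail_antitone μ).measurable hr.le]
    refine lpNormOn_mono hp fun s hs => ?_
    gcongr
    exact hgstar s hs.1
  have hgm : AEMeasurable g volume := hγm.coe_ereal_ennreal.aemeasurable
  calc ∫⁻ z, rearrangedMass w (σ z) ∂μ
      ≤ ∫⁻ z, 2 * (∫⁻ x in {x | τ x < ENNReal.ofReal (σ z)}, w x) ∂μ := by
        refine lintegral_mono fun z => ?_
        rcases (hT.σ_nonneg z).eq_or_lt with h | h
        · rw [← h]; simp [rearrangedMass]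
        · exact hτ.mass_le _ h
    _ = 2 * ∫⁻ z, (∫⁻ x in {x | τ x < ENNReal.ofReal (σ z)}, w x) ∂μ :=
        lintegral_const_mul' _ _ (by simp)
    _ = 2 * ∫⁻ z, (∫⁻ x, {q : EuclideanSpace ℝ (Fin n) × ℝ |
          τ q.1 < ENNReal.ofReal (σ q.2)}.indicator (fun q => w q.1) (x, z)) ∂μ := by
        congr 1
        refine lintegral_congr fun z => ?_
        rw [← lintegral_indicator (measurableSet_lt hτ.measurable measurable_const)]
        rfl
    _ = 2 * ∫⁻ x, ∫⁻ z, {q : EuclideanSpace ℝ (Fin n) × ℝ |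
          τ q.1 < ENNReal.ofReal (σ q.2)}.indicator (fun q => w q.1) (x, z) ∂μ := by
        congr 1
        refine (lintegral_lintegral_swap (Measurable.aemeasurable ?_)).symm
        exact (hw.comp measurable_fst).indicator hset
    _ = 2 * ∫⁻ x, w x * γ x := by
        congr 1
        refine lintegral_congr fun x => ?_
        rw [hγ]
        simp only
        rw [← setLIntegral_const, ← lintegral_indicator (measurableSet_lt measurable_const hσm)]
        rfl
    _ ≤ 2 * ∫⁻ x, (f x).abs * (g x).abs := by
        gcongr 1
        refine lintegral_mono_ae ?_
        filter_upwards [hwf] with x hx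
        rw [hgabs]
        gcongr
    _ ≤ _ := by
        gcongr
        exact lintegral_le_associateNorm _ _ hgm hN

/-- The integral of the gauge is bounded by the associate norm. -/
theorem exists_le_associateNorm (hp : 0 < p) {C₁ C₂ C₃ : ℝ≥0} {Γ : (ℝ → ℝ≥0∞) → ℝ → ℝ≥0∞}
    (hΓ : IsGaugeOperator p C₁ C₂ C₃ Γ) (K : ℝ≥0) : ∃ C : ℝ≥0,
    ∀ (n : ℕ) (_ : 0 < n) (ψ φ : ℝ → ℝ≥0∞) (ν : Measure ℝ) (y σ : ℝ → ℝ), IsTimeChange y σ →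
      (∀ t, 0 ≤ t → ∫⁻ s in Ioo 0 t, ψ s ^ p = ENNReal.ofReal (y t)) →
      AEMeasurable ψ (volume.restrict (Ioi 0)) → AntitoneOn φ (Ioi 0) →
      MonotoneOn (fun r => φ r * ENNReal.ofReal r ^ (1 / p)) (Ioi 0) →
      (∀ t, 0 < t → fundamentalFunction (lpNormOn p ψ) ν t ≤ K * (φ t)⁻¹) →
      ∀ f : EuclideanSpace ℝ (Fin n) → EReal, AEMeasurable f volume →
        ∫⁻ z in Ici 0, Γ (fun z => rearrangedMass (fun x => (f x).abs) (σ z)) z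
          ∂(transportedMeasure ν y) ≤ C * associateNorm (gLambdaNorm p ψ φ) f := by
  obtain ⟨C, hC⟩ := exists_gauge_le_lintegral hp C₃
  -- the summand one keeps the constant positive where the associate norm is infinite
  refine ⟨C * (K * 2) + 1, fun n hn ψ φ ν y σ hT hY hψ hφa hφm hφ f hf => ?_⟩
  set ν' := transportedMeasure ν y with hν'
  set h := fundamentalFunction (powWeight p) ν' with hh
  have hhy : ∀ r, 0 ≤ r → h (y r) = fundamentalFunction (lpNormOn p ψ) ν r := fun r hr =>
    fundamentalFunction_transportedMeasure hT hY ν hr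
  have habs : AEMeasurable (fun x => (f x).abs) := measurable_ereal_abs.comp_aemeasurable hf
  by_cases h0 : ∃ z, 0 < z ∧ h z = 0
  · -- here `ν` is null on `[0, ∞)`
    obtain ⟨z, hz, hz0⟩ := h0
    have hm : Measurable fun s => (powWeight p s + powWeight p z)⁻¹ :=
      (continuous_powWeight.measurable.add_const _).inv
    have h1 := (mul_eq_zero.1 hz0).resolve_left (powWeight_ne_zero hz)
    rw [lintegral_eq_zero_iff hm] at h1
    have h2 : ν' (Ici 0) = 0 := by
      rw [← Measure.restrict_apply_univ, Measure.measure_univ_eq_zero, ← ae_eq_bot,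
        ← eventually_false_iff_eq_bot]
      filter_upwards [h1] with s hs
      simp only [Pi.zero_apply, ENNReal.inv_eq_zero] at hs
      exact ENNReal.add_ne_top.2 ⟨powWeight_ne_top hp s, powWeight_ne_top hp z⟩ hs
    rw [setLIntegral_measure_zero _ _ h2]
    exact bot_le
  by_cases ht : ∃ z, 0 < z ∧ h z = ∞
  · -- here `φ` vanishes identically, so that every function has norm zero
    obtain ⟨z, hz, hzt⟩ := ht
    have hr := hT.σ_pos hz
    have h1 := hφ (σ z) hr
    rw [← hhy _ hr.le, hT.y_σ z hz.le, hzt, top_le_iff] at h1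
    have hφ0 : φ (σ z) = 0 := by
      by_contra hne
      exact ENNReal.mul_ne_top ENNReal.coe_ne_top (ENNReal.inv_ne_top.2 hne) h1
    have hφ0' : ∀ r, 0 < r → φ r = 0 := by
      intro r hr0
      rcases le_total (σ z) r with hle | hle
      · exact le_antisymm ((hφa hr hr0 hle).trans hφ0.le) bot_le
      · have h2 := hφm hr0 hr hle
        simp only [hφ0, zero_mul, nonpos_iff_eq_zero, mul_eq_zero] at h2
        exact h2.resolve_right (powWeight_ne_zero (p := p) hr0)
    have h3 := lintegral_le_associateNorm (gLambdaNorm p ψ φ) f (g := fun _ => ⊤)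
      aemeasurable_const (gLambdaNorm_le_one_iff.2 fun r hr => by simp [hφ0' r hr])
    simp only [EReal.abs_top] at h3
    rw [lintegral_mul_const'' _ habs] at h3
    by_cases hf0 : ∫⁻ x, (f x).abs = 0
    · rw [lintegral_eq_zero_iff' habs] at hf0
      have hz : (fun z => rearrangedMass (fun x => (f x).abs) (σ z)) = fun _ => 0 := by
        funext z
        rw [rearrangedMass_congr_ae hf0]
        simp [rearrangedMass]
      rw [hz]
      simp [hΓ.map_zero]
    · rw [ENNReal.mul_top hf0, top_le_iff] at h3
      rw [h3, ENNReal.mul_top]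
      · exact le_top
      · push_cast; positivity
  push Not at h0 ht
  set N := associateNorm (gLambdaNorm p ψ φ) f with hN
  have hK : (K : ℝ≥0∞) ≠ 0 := by
    intro hK
    have h1 := hφ 1 one_pos
    rw [← hhy 1 zero_le_one, hK, zero_mul, nonpos_iff_eq_zero] at h1
    exact h0 _ (hT.y_pos one_pos) h1
  obtain ⟨w, hwmono, hwm, hwf, hwsup, hwfin, hwrank⟩ :=
    exists_ranked_exhaustion hn habs.measurable_mk
  have hΦk : ∀ k, Monotone fun z => rearrangedMass (w k) (σ z) := fun k =>
    (rearrangedMass_mono _).comp hT.mono_σ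
  have hΦ : (fun z => rearrangedMass (fun x => (f x).abs) (σ z)) =
      fun z => ⨆ k, rearrangedMass (w k) (σ z) := by
    funext z
    rw [rearrangedMass_congr_ae habs.ae_eq_mk, hwsup]
  have hΦmono : Monotone fun k z => rearrangedMass (w k) (σ z) := fun i j hij z =>
    rearrangedMass_le_of_le (hwmono hij) _
  have hstep : ∀ k, ∫⁻ z in Ici 0, Γ (fun z => rearrangedMass (w k) (σ z)) z ∂ν' ≤
      C * (K * 2 * N) := by
    intro k
    obtain ⟨M, hM, hMle⟩ := hwfin k
    obtain ⟨τ, hτ⟩ := hwrank k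
    refine hC _ (fun z => rearrangedMass (w k) (σ z)) ν' _ (hΓ.isGauge _ (hΦk k)) (hΓ.zero_le _)
      (fun t ht0 => hΓ.test _ (hΦk k) t ht0 (hΓ.ne_top _ M hM (fun z => hMle _) t ht0)) h0 ht ?_
    intro μ hμ _ hμr
    have hwf' : ∀ᵐ x, w k x ≤ (f x).abs := by
      filter_upwards [habs.ae_eq_mk] with x hx
      rw [hx]
      exact hwf k x
    have h1 := lintegral_rearrangedMass_le_associateNorm (φ := φ) hp hT hY hψ (hwm k) hwf' hτ
      (μ := (K : ℝ≥0∞)⁻¹ • μ) (fun r hr => by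
        rw [tail_smul, lpNormOn_const_mul hp (tail_antitone μ).measurable]
        calc (K : ℝ≥0∞)⁻¹ * lpNormOn p (tail μ) (y r) ≤ (K : ℝ≥0∞)⁻¹ * (K * (φ r)⁻¹) := by
              gcongr
              refine (hμr _ (hT.y_pos hr)).trans ?_
              rw [← hh, hhy r hr.le]
              exact hφ r hr
          _ = (φ r)⁻¹ := by
              rw [← mul_assoc, ENNReal.inv_mul_cancel hK ENNReal.coe_ne_top, one_mul])
    rw [lintegral_smul_measure, smul_eq_mul] at h1
    calc ∫⁻ z, rearrangedMass (w k) (σ z) ∂μ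
        = K * ((K : ℝ≥0∞)⁻¹ * ∫⁻ z, rearrangedMass (w k) (σ z) ∂μ) := by
          rw [← mul_assoc, ENNReal.mul_inv_cancel hK ENNReal.coe_ne_top, one_mul]
      _ ≤ K * (2 * N) := by gcongr
      _ = _ := by ring
  rw [hΦ]
  simp only [hΓ.map_iSup _ hΦmono hΦk]
  rw [lintegral_iSup (fun k => (hΓ.antitone _).measurable)
    (fun i j hij => hΓ.mono _ _ (hΦmono hij))]
  calc _ ≤ C * (K * 2 * N) := iSup_le hstep
    _ = (C * (K * 2) : ℝ≥0) * N := by push_cast; ring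
    _ ≤ _ := by
      gcongr
      exact le_self_add

end Duality

end Lorentz

theorem mainTheorem1 (p : ℝ) (hp : 0 < p) (K : ℝ≥0) :
    ∃ C : ℝ≥0, ∀ (n : ℕ) (_ : 0 < n) (ψ φ : ℝ → ℝ≥0∞) (ν : Measure ℝ),
      AEMeasurable ψ (volume.restrict (Ioi 0)) →
      AntitoneOn φ (Ioi 0) →
      MonotoneOn (fun r => φ r * ENNReal.ofReal r ^ (1 / p)) (Ioi 0) →
      Lorentz.IsRepresentationMeasure K ν (fun t => (φ t)⁻¹) (Lorentz.lpNormOn p ψ) →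
      ∀ f : EuclideanSpace ℝ (Fin n) → EReal, AEMeasurable f volume →
        (p ≤ 1 →
          Lorentz.associateNorm (Lorentz.gLambdaNorm p ψ φ) f ≤ C * Lorentz.supExpression p ψ ν f ∧
          Lorentz.supExpression p ψ ν f ≤
            C * Lorentz.associateNorm (Lorentz.gLambdaNorm p ψ φ) f) ∧
        (1 < p →
          Lorentz.associateNorm (Lorentz.gLambdaNorm p ψ φ) f ≤
            C * Lorentz.integralExpression p ψ ν f ∧
          Lorentz.integralExpression p ψ ν f ≤
            C * Lorentz.associateNorm (Lorentz.gLambdaNorm p ψ φ) f) := by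
  rcases le_or_gt p 1 with h1 | h1
  · obtain ⟨C₁, C₂, C₃, hΓ⟩ := Lorentz.exists_isGaugeOperator_supGauge hp h1
    obtain ⟨A, hA⟩ := Lorentz.exists_associateNorm_le hp hΓ K
    obtain ⟨B, hB⟩ := Lorentz.exists_le_associateNorm hp hΓ K
    refine ⟨A + B, fun n hn ψ φ ν hψ hφa hφm hrep f hf => ⟨fun _ => ?_, fun h => ?_⟩⟩
    · obtain ⟨y, σ, hT, hY⟩ := Lorentz.exists_isTimeChange hp hrep.admissible
      rw [Lorentz.supExpression_eq hT hY ν f]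
      refine ⟨(hA n ψ φ ν y σ hT hY hψ hrep.le_fundamental f hf).trans ?_,
        (hB n hn ψ φ ν y σ hT hY hψ hφa hφm hrep.fundamental_le f hf).trans ?_⟩
      · gcongr; exact le_self_add
      · gcongr; exact le_add_self
    · exact absurd h (not_lt.2 h1)
  · obtain ⟨C₁, C₂, C₃, hΓ⟩ := Lorentz.exists_isGaugeOperator_intGauge h1
    obtain ⟨A, hA⟩ := Lorentz.exists_associateNorm_le hp hΓ K
    obtain ⟨B, hB⟩ := Lorentz.exists_le_associateNorm hp hΓ K
    refine ⟨A + B, fun n hn ψ φ ν hψ hφa hφm hrep f hf => ⟨fun h => ?_, fun _ => ?_⟩⟩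
    · exact absurd h (not_le.2 h1)
    · obtain ⟨y, σ, hT, hY⟩ := Lorentz.exists_isTimeChange hp hrep.admissible
      rw [Lorentz.integralExpression_eq h1 hT hY hψ ν f]
      refine ⟨(hA n ψ φ ν y σ hT hY hψ hrep.le_fundamental f hf).trans ?_,
        (hB n hn ψ φ ν y σ hT hY hψ hφa hφm hrep.fundamental_le f hf).trans ?_⟩
      · gcongr; exact le_self_add
      · gcongr; exact le_add_self
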